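/- Let $n\ge 1$, $0<s<1$, and let $u:\mathbb R^n\times\mathbb R\to(0,\infty)$ satisfy $u\in C^{2s+\epsilon,s+\epsilon}_{x,t,\mathrm{loc}}(\mathbb R^n\times\mathbb R)$ for some $\epsilon>0$ and $u\in\mathcal L^{2s,s}(\mathbb R^n\times\mathbb R)$, i.e. $u\in L^1_{\rm loc}$ and $$\int_{\mathbb R}\int_{\mathbb R^n}\frac{|u(x,t)|}{1+|x|^{n+2+2s}+|t|^{\frac n2+1+s}}\,dx\,dt<\infty .$$ The Hölder assumption means that $u$ lies in $C^{2\alpha,\alpha}_{x,t,\mathrm{loc}}$ for some $\alpha>s$, a space defined by the following conditions on every bounded cylinder. - If $0<\alpha\le\frac12$: $|u(x,t)-u(y,\tau)|\le C(|x-y|+|t-\tau|^{1/2})^{2\alpha}$. - If $\frac12<\alpha\le 1$: $u$ is $\alpha$-Hölder in $t$ uniformly in $x$, and $\nabla_xu$ exists and is $(2\alpha-1)$-Hölder in $x$ uniformly in $t$ and $(\alpha-\frac12)$-Hölder in $t$ uniformly in $x$. - If $\alpha>1$: $\partial_tu$ and $D_x^2u$ exist and lie in $C^{2\alpha-2,\alpha-1}_{x,t,\mathrm{loc}}$.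 Let $f:\mathbb R^n\times\mathbb R\times(0,\infty)\to[0,\infty)$ be continuous, and assume that for every $C_1>0$ there is $C_2>0$ such that $$f(x,t,\zeta)\ge C_2\quad\text{for all }\zeta\ge C_1\text{ and all }(x,t)\in\mathbb R^n\times\mathbb R .$$ Then $u$ satisfies the equation $$(\partial_t-\Delta)^su(x,t):=\frac{1}{(4\pi)^{n/2}|\Gamma(-s)|}\int_{-\infty}^t\left(\mathrm{P.V.}\int_{\mathbb R^n}\frac{u(x,t)-u(y,\tau)}{(t-\tau)^{\frac n2+1+s}}e^{-\frac{|x-y|^2}{4(t-\tau)}}\,dy\right)d\tau=f(x,t,u(x,t))$$ at every $(x,t)\in\mathbb R^n\times\mathbb R$ if and only if it satisfies $$u(x,t)=\int_{-\infty}^{\infty}\int_{\mathbb R^n}G(x-y,t-\tau)\,f(y,\tau,u(y,\tau))\,dy\,d\tau$$ at every $(x,t)\in\mathbb R^n\times\mathbb R$, where $$G(x,t)=\frac{1}{(4\pi)^{n/2}\Gamma(s)}\,\frac{e^{-|x|^2/(4t)}}{t^{\frac n2+1-s}}\,\chi_{\{t>0\}} .$$ In both equations it is part of the claim that the integrals converge.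 -/

import Mathlib

open MeasureTheory Filter Set Topology

/-- The space `ℝⁿ` with its Euclidean norm. -/
abbrev RSpace (n : ℕ) : Type := EuclideanSpace ℝ (Fin n)

/-- The weighted space `ℒ^{2s,s}(ℝⁿ × ℝ)` of slowly increasing functions. -/
def SlowlyIncreasing {n : ℕ} (s : ℝ) (u : RSpace n → ℝ → ℝ) : Prop :=
  LocallyIntegrable (fun p : RSpace n × ℝ => u p.1 p.2) ∧
  Integrable (fun p : RSpace n × ℝ =>
    |u p.1 p.2| / (1 + ‖p.1‖ ^ ((n : ℝ) + 2 + 2 * s) + |p.2| ^ ((n : ℝ) / 2 + 1 + s)))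

/-- `ParabolicHolderLoc α u` says that `u` lies in the local parabolic Hölder space
`C^{2α,α}_{x,t,loc}(ℝⁿ × ℝ)`; the estimates hold on every bounded cylinder
`{|x| ≤ R, |t| ≤ R}`, with a constant that may depend on `R`.  For `α > 1` the second spatial
derivatives are the functions `(x,t) ↦ D²ₓu(x,t)(v,w)` with `v`, `w` fixed vectors. -/
inductive ParabolicHolderLoc {n : ℕ} : ℝ → (RSpace n → ℝ → ℝ) → Prop
  | low (α : ℝ) (u : RSpace n → ℝ → ℝ) (hα0 : 0 < α) (hα1 : α ≤ 1 / 2)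
      (h : ∀ R : ℝ, ∃ C : ℝ, ∀ x y : RSpace n, ∀ t τ : ℝ,
        ‖x‖ ≤ R → ‖y‖ ≤ R → |t| ≤ R → |τ| ≤ R →
          |u x t - u y τ| ≤ C * (‖x - y‖ + |t - τ| ^ (1 / 2 : ℝ)) ^ (2 * α)) :
      ParabolicHolderLoc α u
  | mid (α : ℝ) (u : RSpace n → ℝ → ℝ) (hα0 : 1 / 2 < α) (hα1 : α ≤ 1)
      (hdiff : ∀ t : ℝ, Differentiable ℝ (fun x => u x t))
      (htime : ∀ R : ℝ, ∃ C : ℝ, ∀ x : RSpace n, ∀ t τ : ℝ,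
        ‖x‖ ≤ R → |t| ≤ R → |τ| ≤ R → |u x t - u x τ| ≤ C * |t - τ| ^ α)
      (hgradx : ∀ R : ℝ, ∃ C : ℝ, ∀ x y : RSpace n, ∀ t : ℝ,
        ‖x‖ ≤ R → ‖y‖ ≤ R → |t| ≤ R →
          ‖gradient (fun z => u z t) x - gradient (fun z => u z t) y‖
            ≤ C * ‖x - y‖ ^ (2 * α - 1))
      (hgradt : ∀ R : ℝ, ∃ C : ℝ, ∀ x : RSpace n, ∀ t τ : ℝ,
        ‖x‖ ≤ R → |t| ≤ R → |τ| ≤ R →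
          ‖gradient (fun z => u z t) x - gradient (fun z => u z τ) x‖
            ≤ C * |t - τ| ^ (α - 1 / 2)) :
      ParabolicHolderLoc α u
  | high (α : ℝ) (u : RSpace n → ℝ → ℝ) (hα : 1 < α)
      (hdifft : ∀ x : RSpace n, Differentiable ℝ (fun t => u x t))
      (hdiffx : ∀ t : ℝ, ContDiff ℝ 2 (fun x => u x t))
      (ht : ParabolicHolderLoc (α - 1) (fun x t => deriv (fun τ => u x τ) t))
      (hx : ∀ v w : RSpace n, ParabolicHolderLoc (α - 1)
        (fun x t => iteratedFDeriv ℝ 2 (fun z => u z t) x ![v, w])) :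
      ParabolicHolderLoc α u

/-- `I` is the Cauchy principal value of `∫ F(y) dy` with respect to the point `x`:
the integrals over `{|y - x| ≥ δ}` converge absolutely and tend to `I` as `δ → 0⁺`. -/
def HasPrincipalValue {n : ℕ} (F : RSpace n → ℝ) (x : RSpace n) (I : ℝ) : Prop :=
  (∀ δ : ℝ, 0 < δ → IntegrableOn F (Metric.ball x δ)ᶜ) ∧
  Tendsto (fun δ : ℝ => ∫ y in (Metric.ball x δ)ᶜ, F y) (𝓝[>] 0) (𝓝 I)

/-- The constant `C_{n,s} = 1 / ((4π)^{n/2} |Γ(-s)|)`. -/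
noncomputable def masterConst (n : ℕ) (s : ℝ) : ℝ :=
  1 / ((4 * Real.pi) ^ ((n : ℝ) / 2) * |Real.Gamma (-s)|)

/-- `HasFracHeatAt s u x t L` says that the singular integral
`C_{n,s} ∫_{-∞}^t (P.V. ∫_{ℝⁿ} (u(x,t) - u(y,τ)) (t-τ)^{-(n/2+1+s)} e^{-|x-y|²/(4(t-τ))} dy) dτ`
defining `(∂_t - Δ)^s u(x,t)` converges and has the value `L`. -/
def HasFracHeatAt {n : ℕ} (s : ℝ) (u : RSpace n → ℝ → ℝ) (x : RSpace n) (t L : ℝ) : Prop :=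
  ∃ I : ℝ → ℝ,
    (∀ᵐ τ : ℝ ∂(volume.restrict (Iio t)),
      HasPrincipalValue (fun y : RSpace n =>
        (u x t - u y τ) / (t - τ) ^ ((n : ℝ) / 2 + 1 + s)
          * Real.exp (-‖x - y‖ ^ 2 / (4 * (t - τ)))) x (I τ)) ∧
    IntegrableOn I (Iio t) ∧
    masterConst n s * ∫ τ in Iio t, I τ = L

/-- The fundamental solution
`G(x,t) = A_{n,s} e^{-|x|²/(4t)} t^{-(n/2+1-s)} χ_{t>0}`, `A_{n,s} = 1 / ((4π)^{n/2} Γ(s))`. -/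
noncomputable def masterKernel {n : ℕ} (s : ℝ) (x : RSpace n) (t : ℝ) : ℝ :=
  if 0 < t then
    1 / ((4 * Real.pi) ^ ((n : ℝ) / 2) * Real.Gamma s)
      * (Real.exp (-‖x‖ ^ 2 / (4 * t)) / t ^ ((n : ℝ) / 2 + 1 - s))
  else 0

open scoped ENNReal

/-! Let S_σ be the heat average over lag σ combined with the time shift t ↦ t - σ; these operators
form a semigroup. Absorbing constants, the fractional operator is the superposition of 1 - S_σ with
the Lévy density s σ^{-1-s}/Γ(1-s) of the s-stable subordinator (`hasFracHeatAt_iff`), and the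
kernel G is the superposition of S_σ with the potential density σ^{s-1}/Γ(s) of the same
subordinator (`integral_masterKernel_iff`). Composing superpositions amounts to convolving densities
on the half-line (`heatPot_heatPot`), so the algebra of the two equations reduces to explicit
one-variable identities. Since u and f are nonnegative, almost everything is done in `ℝ≥0∞`, where
Tonelli needs no integrability.

From the integral equation to the differential one: cut the Lévy density at ε. Its mass times the
Riesz density equals the Lévy–Riesz convolution plus a nonnegative remainder (`levyMass_mul_riesz`),
and the remainders are an approximate identity as ε → 0. Hence the truncated operator applied to a
potential tends to its density (`tendsto_heatPot_defectW`), while the Hölder exponent above s makes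
it tend to the fractional operator (`fracHeat_approx`).

From the differential equation to the integral one: stop the subordinator when it first passes N.
Then u is the potential of the source up to level N plus an average of u over the landing points
beyond N (`slab_representation`). The truncated operators converge only locally uniformly, so the
identity is first tested with spatial cutoffs; the error of moving a cutoff through the heat
averages vanishes as its radius grows (`SlowlyIncreasing.tendsto_errPot`).

It remains to exclude a positive remainder w as N → ∞. Exit potentials satisfy a forward Harnack
inequality whose constant tends to exp(|x-x₀|²/4h), so w > 0 forces u(x, t₀+h) ≥ w exp(-|x-x₀|²/4h).
Thus u is bounded below on forward paraboloids; by the lower bound on f so is the source, and its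
potential then makes u at least c T^s for |x-x₀|² ≤ T. This contradicts the weighted integrability
of u, because the weighted integral over the paraboloid dominates ∫ dT/T
(`SlowlyIncreasing.not_growth`). -/

/-! ### Regularity: from the Hölder classes to parabolic second differences -/

/-- Mean value inequality for w ↦ f(x+w) + f(x-w), whose derivative is a difference of derivatives
of f, so that Hölder continuity of the derivative gains a power. -/
theorem norm_second_diff_le {E F : Type*} [NormedAddCommGroup E] [NormedSpace ℝ E]
    [NormedAddCommGroup F] [NormedSpace ℝ F] {f : E → F} (hf : Differentiable ℝ f) (x z : E) (K : ℝ)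
    (hK : ∀ w, ‖w‖ ≤ ‖z‖ → ‖fderiv ℝ f (x + w) - fderiv ℝ f (x - w)‖ ≤ K) :
    ‖f (x + z) + f (x - z) - (2 : ℝ) • f x‖ ≤ K * ‖z‖ := by
  have hd : ∀ w, HasFDerivAt (fun w => f (x + w) + f (x - w))
      (fderiv ℝ f (x + w) - fderiv ℝ f (x - w)) w := by
    intro w
    have h1 : HasFDerivAt (fun w => f (x + w)) (fderiv ℝ f (x + w)) w := by
      have := (hf (x + w)).hasFDerivAt.comp w ((hasFDerivAt_id w).const_add x)
      simpa [Function.comp_def] using this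
    have h2 : HasFDerivAt (fun w => f (x - w)) (-fderiv ℝ f (x - w)) w := by
      have := (hf (x - w)).hasFDerivAt.comp w ((hasFDerivAt_id w).const_sub x)
      simpa [Function.comp_def] using this
    simpa [sub_eq_add_neg] using h1.fun_add h2
  have := (convex_closedBall (0 : E) ‖z‖).norm_image_sub_le_of_norm_hasFDerivWithin_le
    (f := fun w => f (x + w) + f (x - w)) (C := K)
    (f' := fun w => fderiv ℝ f (x + w) - fderiv ℝ f (x - w))
    (x := 0) (y := z) (fun w _ => (hd w).hasFDerivWithinAt)
    (fun w hw => hK w (by simpa using hw)) (by simp) (by simp)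
  simpa [two_smul] using this

/-- Hölder continuity in time, locally uniformly in space. -/
def LocTimeHolder {n : ℕ} (u : RSpace n → ℝ → ℝ) : Prop :=
  ∃ θ : ℝ, 0 < θ ∧ ∀ R : ℝ, ∃ C : ℝ, 0 ≤ C ∧ ∀ x : RSpace n, ∀ t τ : ℝ,
    ‖x‖ ≤ R → |t| ≤ R → |τ| ≤ R → |u x t - u x τ| ≤ C * |t - τ| ^ θ

theorem LocTimeHolder.bounded {n : ℕ} {u : RSpace n → ℝ → ℝ} (h : LocTimeHolder u)
    (hc : ∀ t, Continuous fun x => u x t) (R : ℝ) :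
    ∃ B : ℝ, 0 ≤ B ∧ ∀ x t, ‖x‖ ≤ R → |t| ≤ R → |u x t| ≤ B := by
  obtain ⟨θ, hθ, h⟩ := h
  obtain ⟨C, hC0, hC⟩ := h R
  obtain ⟨B, hB⟩ := (isCompact_closedBall (0 : RSpace n) R).exists_bound_of_continuousOn
    (hc 0).continuousOn
  refine ⟨|B| + C * |R| ^ θ, by positivity, fun x t hx ht => ?_⟩
  have hR : 0 ≤ R := (norm_nonneg x).trans hx
  have h1 := hC x t 0 hx ht (by simpa using hR)
  have h2 := hB x (by simpa using hx)
  have h3 : |t - 0| ^ θ ≤ |R| ^ θ := by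
    apply Real.rpow_le_rpow (abs_nonneg _) _ hθ.le
    simpa [abs_of_nonneg hR] using ht
  have h4 := mul_le_mul_of_nonneg_left h3 hC0
  rw [Real.norm_eq_abs] at h2
  have h5 := abs_sub_abs_le_abs_sub (u x t) (u x 0)
  linarith [le_abs_self B]

theorem LocTimeHolder.continuous {n : ℕ} {u : RSpace n → ℝ → ℝ} (h : LocTimeHolder u)
    (hc : ∀ t, Continuous fun x => u x t) : Continuous fun p : RSpace n × ℝ => u p.1 p.2 := by
  obtain ⟨θ, hθ, h⟩ := h
  rw [continuous_iff_continuousAt]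
  rintro ⟨x0, t0⟩
  set R := ‖x0‖ + |t0| + 1 with hR
  obtain ⟨C, hC0, hC⟩ := h R
  have h1 : Tendsto (fun p : RSpace n × ℝ => C * |p.2 - t0| ^ θ) (𝓝 (x0, t0)) (𝓝 0) := by
    have : ContinuousAt (fun p : RSpace n × ℝ => C * |p.2 - t0| ^ θ) (x0, t0) := by
      apply ContinuousAt.mul continuousAt_const
      apply ContinuousAt.rpow_const (by fun_prop) (Or.inr hθ.le)
    have h2 := this.tendsto
    simpa [Real.zero_rpow hθ.ne'] using h2
  have h2 : Tendsto (fun p : RSpace n × ℝ => u p.1 t0) (𝓝 (x0, t0)) (𝓝 (u x0 t0)) :=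
    ((hc t0).comp continuous_fst).continuousAt.tendsto
  have h3 : Tendsto (fun p : RSpace n × ℝ => u p.1 p.2 - u p.1 t0) (𝓝 (x0, t0)) (𝓝 0) := by
    apply squeeze_zero_norm' _ h1
    have hb : ∀ᶠ p : RSpace n × ℝ in 𝓝 (x0, t0), p ∈ Metric.ball (x0, t0) 1 :=
      Metric.ball_mem_nhds _ one_pos
    filter_upwards [hb] with p hp
    have hp' : dist p.1 x0 < 1 ∧ dist p.2 t0 < 1 := by
      simpa [Prod.dist_eq] using hp
    apply hC
    · have := norm_le_norm_add_norm_sub' p.1 x0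
      rw [← dist_eq_norm] at this
      linarith [hp'.1, abs_nonneg t0]
    · have := abs_sub_abs_le_abs_sub p.2 t0
      have h5 := hp'.2
      rw [Real.dist_eq] at h5
      linarith [norm_nonneg x0]
    · linarith [norm_nonneg x0]
  have h4 := h3.add h2
  simpa [ContinuousAt] using h4

theorem ParabolicHolderLoc.locTimeHolder {n : ℕ} {α : ℝ} {u : RSpace n → ℝ → ℝ}
    (h : ParabolicHolderLoc α u) : LocTimeHolder u ∧ ∀ t, Continuous fun x => u x t := by
  induction h with
  | low α u h0 h1 h =>
    refine ⟨⟨α, h0, fun R => ?_⟩, fun t => ?_⟩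
    · obtain ⟨C, hC⟩ := h R
      refine ⟨|C|, abs_nonneg C, fun x t τ hx ht hτ => ?_⟩
      have := hC x x t τ hx hx ht hτ
      rw [sub_self, norm_zero, zero_add, ← Real.rpow_mul (abs_nonneg _)] at this
      rw [show (1 / 2 : ℝ) * (2 * α) = α by ring] at this
      exact this.trans (mul_le_mul_of_nonneg_right (le_abs_self C) (by positivity))
    · rw [continuous_iff_continuousAt]
      intro x0
      obtain ⟨C, hC⟩ := h (‖x0‖ + |t| + 1)
      have h1 : Tendsto (fun x : RSpace n => C * ‖x - x0‖ ^ (2 * α)) (𝓝 x0) (𝓝 0) := by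
        have : ContinuousAt (fun x : RSpace n => C * ‖x - x0‖ ^ (2 * α)) x0 := by
          apply ContinuousAt.mul continuousAt_const
          apply ContinuousAt.rpow_const (by fun_prop) (Or.inr (by positivity))
        have h2 := this.tendsto
        simpa [Real.zero_rpow (by positivity : (2 * α) ≠ 0)] using h2
      have h3 : Tendsto (fun x : RSpace n => u x t - u x0 t) (𝓝 x0) (𝓝 0) := by
        apply squeeze_zero_norm' _ h1
        have hb : ∀ᶠ p : RSpace n in 𝓝 x0, p ∈ Metric.ball x0 1 :=
          Metric.ball_mem_nhds _ one_pos
        filter_upwards [hb] with p hp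
        rw [Metric.mem_ball, dist_eq_norm] at hp
        have h4 := norm_le_norm_add_norm_sub' p x0
        have h5 := hC p x0 t t (by linarith [abs_nonneg t]) (by linarith [abs_nonneg t])
          (by linarith [norm_nonneg x0]) (by linarith [norm_nonneg x0])
        simpa [Real.zero_rpow (by positivity : (2 : ℝ)⁻¹ ≠ 0)] using h5
      simpa [ContinuousAt] using h3.add_const (u x0 t)
  | mid α u h0 h1 hdiff htime _ _ =>
    refine ⟨⟨α, by linarith, fun R => ?_⟩, fun t => (hdiff t).continuous⟩
    obtain ⟨C, hC⟩ := htime R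
    refine ⟨|C|, abs_nonneg C, fun x t τ hx ht hτ => (hC x t τ hx ht hτ).trans ?_⟩
    exact mul_le_mul_of_nonneg_right (le_abs_self C) (by positivity)
  | high α u hα hdt hdx ht hx iht ihx =>
    refine ⟨⟨1, one_pos, fun R => ?_⟩, fun t => (hdx t).continuous⟩
    obtain ⟨B, hB0, hB⟩ := iht.1.bounded iht.2 R
    refine ⟨B, hB0, fun x t τ hx ht hτ => ?_⟩
    rw [Real.rpow_one]
    have := (convex_Icc (-R) R).norm_image_sub_le_of_norm_deriv_le (f := fun t => u x t) (C := B)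
      (x := τ) (y := t) (fun w _ => hdt x w)
      (fun w hw => hB x w hx (abs_le.2 hw)) (abs_le.1 hτ) (abs_le.1 ht)
    simpa using this

theorem ParabolicHolderLoc.continuous {n : ℕ} {α : ℝ} {u : RSpace n → ℝ → ℝ}
    (h : ParabolicHolderLoc α u) : Continuous fun p : RSpace n × ℝ => u p.1 p.2 :=
  h.locTimeHolder.1.continuous h.locTimeHolder.2

theorem ParabolicHolderLoc.bounded {n : ℕ} {α : ℝ} {u : RSpace n → ℝ → ℝ}
    (h : ParabolicHolderLoc α u) (R : ℝ) :
    ∃ B : ℝ, 0 ≤ B ∧ ∀ x t, ‖x‖ ≤ R → |t| ≤ R → |u x t| ≤ B :=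
  h.locTimeHolder.1.bounded h.locTimeHolder.2 R

/-- In the class α > 1 the second derivatives are controlled only for fixed pairs of directions;
expanding in the standard basis turns these finitely many bounds into one operator norm bound. -/
theorem norm_bilin_le_of_basis {n : ℕ} (T : RSpace n →L[ℝ] RSpace n →L[ℝ] ℝ)
    (B : Fin n → Fin n → ℝ)
    (hB : ∀ i j, |T (EuclideanSpace.single i 1) (EuclideanSpace.single j 1)| ≤ B i j) :
    ‖T‖ ≤ ∑ i, ∑ j, B i j := by
  have hB0 : ∀ i j, 0 ≤ B i j := fun i j => (abs_nonneg _).trans (hB i j)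
  have hs : 0 ≤ ∑ i, ∑ j, B i j :=
    Finset.sum_nonneg fun i _ => Finset.sum_nonneg fun j _ => hB0 i j
  have hexp : ∀ v : RSpace n, v = ∑ i, v i • EuclideanSpace.single i (1 : ℝ) := by
    intro v
    have := (EuclideanSpace.basisFun (Fin n) ℝ).sum_repr v
    simpa using this.symm
  refine T.opNorm_le_bound hs fun v => ?_
  refine (T v).opNorm_le_bound (by positivity) fun w => ?_
  have h1 : T v w = ∑ i, ∑ j, v i * w j *
      T (EuclideanSpace.single i 1) (EuclideanSpace.single j 1) := by
    conv_lhs => rw [hexp v, hexp w]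
    simp only [map_sum, sum_apply, map_smul, smul_apply,
      smul_eq_mul, Finset.mul_sum]
    rw [Finset.sum_comm]
    exact Finset.sum_congr rfl fun i _ => Finset.sum_congr rfl fun j _ => by ring
  rw [h1, Finset.sum_mul, Finset.sum_mul]
  refine (norm_sum_le _ _).trans (Finset.sum_le_sum fun i _ => ?_)
  rw [Finset.sum_mul, Finset.sum_mul]
  refine (norm_sum_le _ _).trans (Finset.sum_le_sum fun j _ => ?_)
  rw [norm_mul, norm_mul]
  have h2 : ‖v i‖ ≤ ‖v‖ := PiLp.norm_apply_le v i
  have h3 : ‖w j‖ ≤ ‖w‖ := PiLp.norm_apply_le w j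
  calc ‖v i‖ * ‖w j‖ * _ ≤ ‖v‖ * ‖w‖ * B i j := by
        gcongr
        exact hB i j
    _ = _ := by ring

/-- Parabolic second differences are controlled with an exponent above `s`. -/
theorem ParabolicHolderLoc.second_diff {n : ℕ} {s α : ℝ} {u : RSpace n → ℝ → ℝ} (hs0 : 0 < s)
    (hs1 : s < 1) (hsα : s < α) (h : ParabolicHolderLoc α u) :
    ∃ β : ℝ, s < β ∧ β ≤ 1 ∧ ∀ R : ℝ, ∃ C : ℝ, 0 ≤ C ∧ ∀ x z : RSpace n, ∀ t r : ℝ, ‖x‖ ≤ R →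
      |t| ≤ R → ‖z‖ ≤ 1 → 0 ≤ r → r ≤ 1 →
      |u (x + z) (t - r) + u (x - z) (t - r) - 2 * u x t| ≤ C * (‖z‖ ^ (2 * β) + r ^ β) := by
  have aux : ∀ (R : ℝ) (x z : RSpace n) (t r : ℝ), ‖x‖ ≤ R → |t| ≤ R → ‖z‖ ≤ 1 → 0 ≤ r → r ≤ 1 →
      (‖x + z‖ ≤ R + 1 ∧ ‖x - z‖ ≤ R + 1 ∧ |t - r| ≤ R + 1) := by
    intro R x z t r hx ht hz hr0 hr1
    refine ⟨(norm_add_le _ _).trans (by linarith), (norm_sub_le _ _).trans (by linarith),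
      (abs_sub _ _).trans ?_⟩
    rw [abs_of_nonneg hr0]; linarith
  cases h with
  | low _ _ h0 h1 h =>
    refine ⟨α, hsα, by linarith, fun R => ?_⟩
    obtain ⟨C, hC⟩ := h (R + 1)
    refine ⟨4 * |C|, by positivity, fun x z t r hx ht hz hr0 hr1 => ?_⟩
    obtain ⟨hp, hm, htr⟩ := aux R x z t r hx ht hz hr0 hr1
    have key : ∀ w : RSpace n, ‖w‖ ≤ R + 1 → ‖w - x‖ = ‖z‖ →
        |u w (t - r) - u x t| ≤ |C| * (2 * (‖z‖ ^ (2 * α) + r ^ α)) := by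
      intro w hw hwx
      refine (hC w x (t - r) t hw (by linarith) htr (by linarith)).trans ?_
      rw [hwx, show |t - r - t| = r by rw [sub_sub_cancel_left, abs_neg, abs_of_nonneg hr0]]
      -- Here 2α ≤ 1, so the power is subadditive.
      have h2 : (‖z‖ + r ^ (1 / 2 : ℝ)) ^ (2 * α) ≤ ‖z‖ ^ (2 * α) + r ^ α := by
        have := Real.rpow_add_le_add_rpow (norm_nonneg z) (Real.rpow_nonneg hr0 (1 / 2))
          (p := 2 * α) (by linarith) (by linarith)
        rwa [← Real.rpow_mul hr0, show (1 / 2 : ℝ) * (2 * α) = α by ring] at this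
      have h3 : 0 ≤ ‖z‖ ^ (2 * α) + r ^ α := by positivity
      calc C * _ ≤ |C| * (‖z‖ + r ^ (1 / 2 : ℝ)) ^ (2 * α) :=
            mul_le_mul_of_nonneg_right (le_abs_self C) (by positivity)
        _ ≤ _ := by gcongr; linarith
    have k1 := key (x + z) hp (by simp)
    have k2 := key (x - z) hm (by simp)
    calc |u (x + z) (t - r) + u (x - z) (t - r) - 2 * u x t|
        = |(u (x + z) (t - r) - u x t) + (u (x - z) (t - r) - u x t)| := by ring_nf
      _ ≤ _ := (abs_add_le _ _).trans (by linarith)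
  | mid _ _ h0 h1 hdiff htime hgradx _ =>
    refine ⟨α, hsα, h1, fun R => ?_⟩
    obtain ⟨C, hC⟩ := htime (R + 1)
    obtain ⟨D, hD⟩ := hgradx (R + 1)
    refine ⟨2 * |C| + |D| * 2 ^ (2 * α - 1), by positivity, fun x z t r hx ht hz hr0 hr1 => ?_⟩
    obtain ⟨hp, hm, htr⟩ := aux R x z t r hx ht hz hr0 hr1
    -- The second difference is taken in space at the single time t - r, and the time increment at x
    -- is added separately; this uses only Hölder continuity of the gradient in space.
    have k1 : ‖u (x + z) (t - r) + u (x - z) (t - r) - (2 : ℝ) • u x (t - r)‖ ≤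
        |D| * (2 * ‖z‖) ^ (2 * α - 1) * ‖z‖ := by
      apply norm_second_diff_le (f := fun y => u y (t - r)) (hdiff (t - r)) x z
      intro w hw
      obtain ⟨hp', hm', _⟩ := aux R x w t r hx ht (hw.trans hz) hr0 hr1
      have h2 := hD (x + w) (x - w) (t - r) hp' hm' htr
      have h3 : ∀ y, gradient (fun z => u z (t - r)) y =
        (InnerProductSpace.toDual ℝ _).symm (fderiv ℝ (fun z => u z (t - r)) y) := fun y => rfl
      rw [h3, h3, ← map_sub, LinearIsometryEquiv.norm_map] at h2
      refine h2.trans ?_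
      have h4 : ‖x + w - (x - w)‖ ≤ 2 * ‖z‖ := by
        rw [show x + w - (x - w) = (2 : ℝ) • w by rw [two_smul]; abel, norm_smul]
        simpa using hw
      calc D * _ ≤ |D| * ‖x + w - (x - w)‖ ^ (2 * α - 1) :=
            mul_le_mul_of_nonneg_right (le_abs_self D) (by positivity)
        _ ≤ _ := by
          gcongr
          linarith
    have k2 := hC x (t - r) t (by linarith) htr (by linarith)
    rw [show |t - r - t| = r by rw [sub_sub_cancel_left, abs_neg, abs_of_nonneg hr0]] at k2
    have k3 : C * r ^ α ≤ |C| * r ^ α :=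
      mul_le_mul_of_nonneg_right (le_abs_self C) (by positivity)
    have k4 : |D| * (2 * ‖z‖) ^ (2 * α - 1) * ‖z‖ ≤ |D| * 2 ^ (2 * α - 1) * ‖z‖ ^ (2 * α) := by
      rw [Real.mul_rpow (by norm_num) (norm_nonneg z)]
      rcases (norm_nonneg z).eq_or_lt with h | h
      · rw [← h]; simp; positivity
      · rw [show (2 * α) = (2 * α - 1) + 1 by ring, Real.rpow_add h, Real.rpow_one,
          add_sub_cancel_right]
        apply le_of_eq; ring
    rw [Real.norm_eq_abs, smul_eq_mul] at k1
    have k5 : 0 ≤ ‖z‖ ^ (2 * α) := by positivity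
    have k6 : 0 ≤ r ^ α := by positivity
    have k7 : (0 : ℝ) ≤ 2 ^ (2 * α - 1) := by positivity
    calc |u (x + z) (t - r) + u (x - z) (t - r) - 2 * u x t|
        = |(u (x + z) (t - r) + u (x - z) (t - r) - 2 * u x (t - r)) +
            2 * (u x (t - r) - u x t)| := by ring_nf
      _ ≤ |D| * 2 ^ (2 * α - 1) * ‖z‖ ^ (2 * α) + 2 * (|C| * r ^ α) := by
          refine (abs_add_le _ _).trans ?_
          rw [abs_mul, abs_two]
          linarith
      _ ≤ _ := by
          nlinarith [mul_nonneg (abs_nonneg C) k5,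
            mul_nonneg (mul_nonneg (abs_nonneg D) k7) k6]
  | high _ _ hα hdt hdx ht hx =>
    -- Bounded ∂_t u and D²u give exponent 1, however large α is; s < 1 puts it above s.
    refine ⟨1, hs1, le_rfl, fun R => ?_⟩
    obtain ⟨B, hB0, hB⟩ := ht.bounded (R + 1)
    choose D hD0 hD using fun i j : Fin n =>
      (hx (EuclideanSpace.single i 1) (EuclideanSpace.single j 1)).bounded (R + 1)
    set K := ∑ i, ∑ j, D i j with hK
    have hK0 : 0 ≤ K := Finset.sum_nonneg fun i _ => Finset.sum_nonneg fun j _ => hD0 i j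
    refine ⟨2 * B + 2 * K, by positivity, fun x z t r hx ht hz hr0 hr1 => ?_⟩
    obtain ⟨hp, hm, htr⟩ := aux R x z t r hx ht hz hr0 hr1
    set f := fun y => u y (t - r) with hf
    have hf2 : ContDiff ℝ 2 f := hdx (t - r)
    have hf1 : Differentiable ℝ (fderiv ℝ f) :=
      (hf2.fderiv_right (m := 1) (by norm_num)).differentiable (by norm_num)
    have k1 : ‖f (x + z) + f (x - z) - (2 : ℝ) • f x‖ ≤ K * (2 * ‖z‖) * ‖z‖ := by
      apply norm_second_diff_le (hf2.differentiable (by norm_num)) x z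
      intro w hw
      obtain ⟨hp', hm', _⟩ := aux R x w t r hx ht (hw.trans hz) hr0 hr1
      have := (convex_closedBall (0 : RSpace n) (R + 1)).norm_image_sub_le_of_norm_fderiv_le
        (f := fderiv ℝ f) (C := K) (x := x - w) (y := x + w) (fun y _ => hf1 y) (fun y hy => by
          apply norm_bilin_le_of_basis
          intro i j
          have := hD i j y (t - r) (by simpa using hy) htr
          simpa [iteratedFDeriv_two_apply] using this)
          (by simpa using hm') (by simpa using hp')
      refine this.trans ?_
      gcongr
      rw [show x + w - (x - w) = (2 : ℝ) • w by rw [two_smul]; abel, norm_smul]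
      simpa using hw
    have k2 : |u x (t - r) - u x t| ≤ B * r := by
      have := (convex_Icc (-(R + 1)) (R + 1)).norm_image_sub_le_of_norm_deriv_le
        (f := fun t => u x t) (C := B) (x := t) (y := t - r) (fun w _ => hdt x w)
        (fun w hw => hB x w (by linarith) (abs_le.2 hw)) (abs_le.1 (by linarith)) (abs_le.1 htr)
      have e : |t - r - t| = r := by rw [sub_sub_cancel_left, abs_neg, abs_of_nonneg hr0]
      simpa only [Real.norm_eq_abs, e] using this
    rw [Real.norm_eq_abs, smul_eq_mul] at k1
    have e2 : ‖z‖ ^ (2 * (1 : ℝ)) = ‖z‖ * ‖z‖ := by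
      rw [mul_one, Real.rpow_two, sq]
    rw [e2, Real.rpow_one]
    calc |u (x + z) (t - r) + u (x - z) (t - r) - 2 * u x t|
        = |(f (x + z) + f (x - z) - 2 * f x) + 2 * (u x (t - r) - u x t)| := by
          simp only [hf]; ring_nf
      _ ≤ K * (2 * ‖z‖) * ‖z‖ + 2 * (B * r) := by
          refine (abs_add_le _ _).trans ?_
          rw [abs_mul, abs_two]
          linarith
      _ ≤ _ := by
          nlinarith [mul_nonneg hK0 hr0, mul_nonneg hB0 (mul_nonneg (norm_nonneg z) (norm_nonneg z))]

/-! ### The heat kernel and Gaussian estimates -/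

/-- The heat kernel on `ℝⁿ`. -/
noncomputable def heatKer {n : ℕ} (r : ℝ) (z : RSpace n) : ℝ :=
  (4 * Real.pi * r) ^ (-((n : ℝ) / 2)) * Real.exp (-‖z‖ ^ 2 / (4 * r))

theorem heatKer_pos {n : ℕ} {r : ℝ} (hr : 0 < r) (z : RSpace n) : 0 < heatKer r z := by
  unfold heatKer; positivity

theorem heatKer_neg {n : ℕ} (r : ℝ) (z : RSpace n) : heatKer r (-z) = heatKer r z := by
  simp [heatKer]

theorem heatKer_sub_comm {n : ℕ} (r : ℝ) (x y : RSpace n) :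
    heatKer r (x - y) = heatKer r (y - x) := by
  rw [← heatKer_neg, neg_sub]

@[fun_prop]
theorem measurable_heatKer {n : ℕ} {α : Type*} [MeasurableSpace α] {f : α → ℝ} {g : α → RSpace n}
    (hf : Measurable f) (hg : Measurable g) : Measurable fun a => heatKer (f a) (g a) := by
  unfold heatKer
  have h1 : Measurable fun a => (4 * Real.pi * f a) ^ (-((n : ℝ) / 2)) :=
    (hf.const_mul _).pow_const _
  exact h1.mul (by fun_prop)

theorem integral_heatKer {n : ℕ} {r : ℝ} (hr : 0 < r) : ∫ z : RSpace n, heatKer r z = 1 := by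
  have h := GaussianFourier.integral_rexp_neg_mul_sq_norm (V := RSpace n) (b := 1 / (4 * r))
    (by positivity)
  unfold heatKer
  rw [integral_const_mul]
  have e : ∀ z : RSpace n, Real.exp (-‖z‖ ^ 2 / (4 * r)) = Real.exp (-(1 / (4 * r)) * ‖z‖ ^ 2) := by
    intro z; congr 1; ring
  simp_rw [e]
  rw [h, finrank_euclideanSpace_fin, show Real.pi / (1 / (4 * r)) = 4 * Real.pi * r by
    field_simp, ← Real.rpow_add (by positivity)]
  simp

theorem integrable_heatKer {n : ℕ} {r : ℝ} (hr : 0 < r) :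
    Integrable fun z : RSpace n => heatKer r z := by
  by_contra h
  have := integral_heatKer (n := n) hr
  rw [integral_undef h] at this
  exact zero_ne_one this

theorem lintegral_heatKer {n : ℕ} {r : ℝ} (hr : 0 < r) :
    ∫⁻ z : RSpace n, ENNReal.ofReal (heatKer r z) = 1 := by
  rw [← ofReal_integral_eq_lintegral_ofReal (integrable_heatKer hr)
    (ae_of_all _ fun z => (heatKer_pos hr z).le), integral_heatKer hr, ENNReal.ofReal_one]

theorem lintegral_heatKer_sub {n : ℕ} {r : ℝ} (hr : 0 < r) (x : RSpace n) :
    ∫⁻ z : RSpace n, ENNReal.ofReal (heatKer r (x - z)) = 1 := by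
  rw [lintegral_sub_left_eq_self (fun z => ENNReal.ofReal (heatKer r z)) x, lintegral_heatKer hr]

/-- Completing the square in y. The last factor is the law of the intermediate point of a Brownian
bridge from x to z; it is kept, rather than integrated out, because cutoffs will be averaged against
it. -/
theorem heatKer_mul {n : ℕ} {q r : ℝ} (hq : 0 < q) (hr : 0 < r) (x y z : RSpace n) :
    heatKer q (x - y) * heatKer r (y - z) = heatKer (q + r) (x - z) *
      heatKer (q * r / (q + r)) (y - ((r / (q + r)) • x + (q / (q + r)) • z)) := by
  have hqr : 0 < q + r := by positivity
  unfold heatKer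
  have h1 : (4 * Real.pi * q) ^ (-((n : ℝ) / 2)) * (4 * Real.pi * r) ^ (-((n : ℝ) / 2)) =
      (4 * Real.pi * (q + r)) ^ (-((n : ℝ) / 2)) *
        (4 * Real.pi * (q * r / (q + r))) ^ (-((n : ℝ) / 2)) := by
    rw [← Real.mul_rpow (by positivity) (by positivity),
      ← Real.mul_rpow (by positivity) (by positivity)]
    congr 1
    field_simp
  have h2 : -‖x - y‖ ^ 2 / (4 * q) + -‖y - z‖ ^ 2 / (4 * r) = -‖x - z‖ ^ 2 / (4 * (q + r)) +
      -‖y - ((r / (q + r)) • x + (q / (q + r)) • z)‖ ^ 2 / (4 * (q * r / (q + r))) := by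
    set a := x - y with ha
    set b := y - z with hb
    have e1 : x - z = a + b := by rw [ha, hb]; abel
    have e2 : y - ((r / (q + r)) • x + (q / (q + r)) • z) =
        (q / (q + r)) • b - (r / (q + r)) • a := by
      have : y = (r / (q + r)) • y + (q / (q + r)) • y := by
        rw [← add_smul, ← add_div, add_comm r q, div_self hqr.ne', one_smul]
      conv_lhs => rw [this]
      rw [ha, hb, smul_sub, smul_sub]
      abel
    clear_value a b
    rw [e1, e2, norm_add_sq_real, norm_sub_sq_real, norm_smul, norm_smul,
      inner_smul_left, inner_smul_right, real_inner_comm, Real.norm_of_nonneg (by positivity),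
      Real.norm_of_nonneg (by positivity)]
    simp only [conj_trivial]
    field_simp
    ring
  rw [mul_mul_mul_comm, h1, ← Real.exp_add, h2, Real.exp_add]
  ring

theorem heatKer_double {n : ℕ} {r : ℝ} (hr : 0 < r) (z : RSpace n) :
    heatKer (2 * r) z = 2 ^ (-((n : ℝ) / 2)) * ((4 * Real.pi * r) ^ (-((n : ℝ) / 2)) *
      Real.exp (-‖z‖ ^ 2 / (8 * r))) := by
  unfold heatKer
  rw [show 4 * Real.pi * (2 * r) = 2 * (4 * Real.pi * r) by ring,
    Real.mul_rpow (by positivity) (by positivity)]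
  ring_nf

/-- Half of the Gaussian exponent pays for ‖z‖² ≤ 8r exp(‖z‖²/8r); the other half is the kernel at
time 2r. This is how powers of ‖z‖ are exchanged for powers of time throughout. -/
theorem sq_mul_heatKer_le {n : ℕ} {r : ℝ} (hr : 0 < r) (z : RSpace n) :
    ‖z‖ ^ 2 * heatKer r z ≤ 8 * 2 ^ ((n : ℝ) / 2) * r * heatKer (2 * r) z := by
  have h1 : ‖z‖ ^ 2 / (8 * r) ≤ Real.exp (‖z‖ ^ 2 / (8 * r)) := by
    linarith [Real.add_one_le_exp (‖z‖ ^ 2 / (8 * r))]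
  have h2 : Real.exp (-‖z‖ ^ 2 / (4 * r)) =
      Real.exp (-‖z‖ ^ 2 / (8 * r)) * Real.exp (-‖z‖ ^ 2 / (8 * r)) := by
    rw [← Real.exp_add]; congr 1; ring
  have h3 : Real.exp (‖z‖ ^ 2 / (8 * r)) * Real.exp (-‖z‖ ^ 2 / (8 * r)) = 1 := by
    rw [← Real.exp_add, ← Real.exp_zero]; congr 1; ring
  have h4 : ‖z‖ ^ 2 * Real.exp (-‖z‖ ^ 2 / (4 * r)) ≤ 8 * r * Real.exp (-‖z‖ ^ 2 / (8 * r)) := by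
    rw [div_le_iff₀ (by positivity)] at h1
    calc ‖z‖ ^ 2 * Real.exp (-‖z‖ ^ 2 / (4 * r))
        ≤ (Real.exp (‖z‖ ^ 2 / (8 * r)) * (8 * r)) * Real.exp (-‖z‖ ^ 2 / (4 * r)) := by gcongr
      _ = 8 * r * (Real.exp (‖z‖ ^ 2 / (8 * r)) * Real.exp (-‖z‖ ^ 2 / (8 * r))) *
          Real.exp (-‖z‖ ^ 2 / (8 * r)) := by rw [h2]; ring
      _ = _ := by rw [h3]; ring
  rw [heatKer_double hr]
  have h5 : (2 : ℝ) ^ ((n : ℝ) / 2) * 2 ^ (-((n : ℝ) / 2)) = 1 := by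
    rw [← Real.rpow_add (by norm_num)]; simp
  calc ‖z‖ ^ 2 * heatKer r z
      = (4 * Real.pi * r) ^ (-((n : ℝ) / 2)) * (‖z‖ ^ 2 * Real.exp (-‖z‖ ^ 2 / (4 * r))) := by
        unfold heatKer; ring
    _ ≤ (4 * Real.pi * r) ^ (-((n : ℝ) / 2)) * (8 * r * Real.exp (-‖z‖ ^ 2 / (8 * r))) := by gcongr
    _ = ((2 : ℝ) ^ ((n : ℝ) / 2) * 2 ^ (-((n : ℝ) / 2))) *
      ((4 * Real.pi * r) ^ (-((n : ℝ) / 2)) * (8 * r * Real.exp (-‖z‖ ^ 2 / (8 * r)))) := by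
        rw [h5, one_mul]
    _ = _ := by ring

/-- Interpolation between the powers 0 and 2 through v^β ≤ 1 + v with v = ‖z‖²/r. -/
theorem rpow_mul_heatKer_le {n : ℕ} {β r : ℝ} (hβ0 : 0 ≤ β) (hβ1 : β ≤ 1) (hr : 0 < r)
    (z : RSpace n) :
    ‖z‖ ^ (2 * β) * heatKer r z ≤
      r ^ β * (heatKer r z + 8 * 2 ^ ((n : ℝ) / 2) * heatKer (2 * r) z) := by
  have h1 : ‖z‖ ^ (2 * β) ≤ r ^ β * (1 + ‖z‖ ^ 2 / r) := by
    have e : ‖z‖ ^ (2 * β) = r ^ β * (‖z‖ ^ 2 / r) ^ β := by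
      rw [← Real.mul_rpow hr.le (by positivity), mul_div_cancel₀ _ hr.ne', Real.rpow_mul
        (norm_nonneg z), Real.rpow_two]
    rw [e]
    gcongr
    rcases le_total (‖z‖ ^ 2 / r) 1 with h | h
    · have := Real.rpow_le_one (by positivity : 0 ≤ ‖z‖ ^ 2 / r) h hβ0
      have h0 : 0 ≤ ‖z‖ ^ 2 / r := by positivity
      linarith
    · have := Real.rpow_le_rpow_of_exponent_le h hβ1
      rw [Real.rpow_one] at this
      linarith
  have h2 := sq_mul_heatKer_le hr z
  calc ‖z‖ ^ (2 * β) * heatKer r z ≤ r ^ β * (1 + ‖z‖ ^ 2 / r) * heatKer r z := by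
        have := heatKer_pos hr z; gcongr
    _ = r ^ β * (heatKer r z + (‖z‖ ^ 2 * heatKer r z) / r) := by ring
    _ ≤ r ^ β * (heatKer r z + (8 * 2 ^ ((n : ℝ) / 2) * r * heatKer (2 * r) z) / r) := by gcongr
    _ = _ := by field_simp

/-- Raise v/(8m) ≤ exp(v/(8m)) to the power m. The rate 1/8 matches the Gaussian left after half of
the exponent has been spent. -/
theorem rpow_mul_exp_le {m v : ℝ} (hm : 0 < m) (hv : 0 ≤ v) :
    v ^ m ≤ (8 * m) ^ m * Real.exp (v / 8) := by
  have h1 : v / (8 * m) ≤ Real.exp (v / (8 * m)) := by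
    linarith [Real.add_one_le_exp (v / (8 * m))]
  rw [div_le_iff₀ (by positivity)] at h1
  calc v ^ m ≤ (Real.exp (v / (8 * m)) * (8 * m)) ^ m := by gcongr
    _ = (8 * m) ^ m * Real.exp (v / (8 * m)) ^ m := by
      rw [mul_comm, Real.mul_rpow (by positivity) (by positivity)]
    _ = _ := by
      rw [← Real.exp_mul]
      congr 2
      field_simp

/-! ### Gaussian tails against the growth weight -/

/-- The weight of the space `ℒ^{2s,s}`. -/
noncomputable def growthWeight {n : ℕ} (s : ℝ) (z : RSpace n) (τ : ℝ) : ℝ :=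
  1 + ‖z‖ ^ ((n : ℝ) + 2 + 2 * s) + |τ| ^ ((n : ℝ) / 2 + 1 + s)

theorem growthWeight_pos {n : ℕ} (s : ℝ) (z : RSpace n) (τ : ℝ) : 0 < growthWeight s z τ := by
  unfold growthWeight; positivity

/-- The kernel decays like the -m-th power of the parabolic distance D = ‖x-z‖² + σ, where m = n/2 +
1 + s, because D/σ = ‖x-z‖²/σ + 1 is the Gaussian exponent up to constants. The weight grows at most
like D^m once D ≥ δ. So membership in `ℒ^{2s,s}` is just what makes the operator converge away from
its singularity. -/
theorem exists_gaussian_le_weight {n : ℕ} {s : ℝ} (hs : 0 < s) {R δ : ℝ} (hR : 0 ≤ R)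
    (hδ : 0 < δ) :
    ∃ C : ℝ, 0 < C ∧ ∀ (x z : RSpace n) (t σ : ℝ), ‖x‖ ≤ R → |t| ≤ R → 0 < σ →
      δ ≤ ‖x - z‖ ^ 2 + σ →
      σ ^ (-((n : ℝ) / 2 + 1 + s)) * Real.exp (-‖x - z‖ ^ 2 / (8 * σ)) ≤
        C * (growthWeight s z (t - σ))⁻¹ := by
  set m : ℝ := (n : ℝ) / 2 + 1 + s with hm
  have hm0 : 0 < m := by positivity
  set C2 : ℝ := δ⁻¹ ^ m + (2 * R ^ 2 / δ + 2) ^ m + (R / δ + 1) ^ m with hC2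
  have hC20 : 0 < C2 := by positivity
  refine ⟨(8 * m) ^ m * Real.exp (1 / 8) * C2, by positivity, fun x z t σ hx ht hσ hD => ?_⟩
  set D := ‖x - z‖ ^ 2 + σ with hDdef
  have hD0 : 0 < D := hδ.trans_le hD
  have hw : growthWeight s z (t - σ) ≤ C2 * D ^ m := by
    have h1 : 1 ≤ δ⁻¹ ^ m * D ^ m := by
      rw [← Real.mul_rpow (by positivity) hD0.le]
      apply Real.one_le_rpow _ hm0.le
      rw [inv_mul_eq_div, le_div_iff₀ hδ]; linarith
    have hR2 : R ^ 2 ≤ R ^ 2 / δ * D := by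
      rw [div_mul_eq_mul_div, le_div_iff₀ hδ]; gcongr
    have hR1 : R ≤ R / δ * D := by
      rw [div_mul_eq_mul_div, le_div_iff₀ hδ]; gcongr
    have h2 : ‖z‖ ^ ((n : ℝ) + 2 + 2 * s) ≤ (2 * R ^ 2 / δ + 2) ^ m * D ^ m := by
      rw [show (n : ℝ) + 2 + 2 * s = 2 * m by rw [hm]; ring, Real.rpow_mul (norm_nonneg z),
        Real.rpow_two, ← Real.mul_rpow (by positivity) hD0.le]
      apply Real.rpow_le_rpow (by positivity) _ hm0.le
      have h3 : ‖z‖ ≤ R + ‖x - z‖ := by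
        have := norm_sub_norm_le z x
        rw [norm_sub_rev] at this
        linarith
      have h4 : ‖z‖ ^ 2 ≤ (R + ‖x - z‖) ^ 2 := by gcongr
      have h5 : (R + ‖x - z‖) ^ 2 ≤ 2 * R ^ 2 + 2 * ‖x - z‖ ^ 2 := by
        nlinarith [sq_nonneg (R - ‖x - z‖)]
      have h6 : ‖x - z‖ ^ 2 ≤ D := by linarith
      calc ‖z‖ ^ 2 ≤ 2 * R ^ 2 + 2 * D := by linarith
        _ ≤ 2 * (R ^ 2 / δ * D) + 2 * D := by linarith
        _ = _ := by ring
    have h3 : |t - σ| ^ m ≤ (R / δ + 1) ^ m * D ^ m := by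
      rw [← Real.mul_rpow (by positivity) hD0.le]
      apply Real.rpow_le_rpow (abs_nonneg _) _ hm0.le
      have h4 := abs_sub t σ
      rw [abs_of_pos hσ] at h4
      have h5 : 0 ≤ ‖x - z‖ ^ 2 := by positivity
      calc |t - σ| ≤ R + D := by linarith
        _ ≤ R / δ * D + D := by linarith
        _ = _ := by ring
    unfold growthWeight
    rw [← hm, hC2]
    linarith
  have hk : σ ^ (-m) * Real.exp (-‖x - z‖ ^ 2 / (8 * σ)) * D ^ m ≤
      (8 * m) ^ m * Real.exp (1 / 8) := by
    have h1 := rpow_mul_exp_le hm0 (div_nonneg hD0.le hσ.le)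
    rw [Real.div_rpow hD0.le hσ.le] at h1
    have h2 : Real.exp (D / σ / 8) * Real.exp (-‖x - z‖ ^ 2 / (8 * σ)) = Real.exp (1 / 8) := by
      rw [← Real.exp_add]; congr 1; rw [hDdef]; field_simp; ring
    calc σ ^ (-m) * Real.exp (-‖x - z‖ ^ 2 / (8 * σ)) * D ^ m
        = D ^ m / σ ^ m * Real.exp (-‖x - z‖ ^ 2 / (8 * σ)) := by
          rw [Real.rpow_neg hσ.le]; ring
      _ ≤ (8 * m) ^ m * Real.exp (D / σ / 8) * Real.exp (-‖x - z‖ ^ 2 / (8 * σ)) := by gcongr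
      _ = _ := by rw [mul_assoc, h2]
  have hwp := growthWeight_pos s z (t - σ)
  rw [← div_eq_mul_inv, le_div_iff₀ hwp]
  calc σ ^ (-m) * Real.exp (-‖x - z‖ ^ 2 / (8 * σ)) * growthWeight s z (t - σ)
      ≤ σ ^ (-m) * Real.exp (-‖x - z‖ ^ 2 / (8 * σ)) * (C2 * D ^ m) := by gcongr
    _ = (σ ^ (-m) * Real.exp (-‖x - z‖ ^ 2 / (8 * σ)) * D ^ m) * C2 := by ring
    _ ≤ _ := by gcongr

theorem heatKer_mul_rpow_le {n : ℕ} {s : ℝ} {σ : ℝ} (hσ : 0 < σ) (z : RSpace n) :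
    heatKer σ z * σ ^ (-1 - s) ≤
      σ ^ (-((n : ℝ) / 2 + 1 + s)) * Real.exp (-‖z‖ ^ 2 / (8 * σ)) := by
  unfold heatKer
  have h1 : (4 * Real.pi * σ) ^ (-((n : ℝ) / 2)) ≤ σ ^ (-((n : ℝ) / 2)) := by
    apply Real.rpow_le_rpow_of_nonpos hσ _ (by simp; positivity)
    nlinarith [Real.pi_gt_three]
  have h2 : Real.exp (-‖z‖ ^ 2 / (4 * σ)) ≤ Real.exp (-‖z‖ ^ 2 / (8 * σ)) := by
    apply Real.exp_le_exp.2
    rw [neg_div, neg_div, neg_le_neg_iff]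
    gcongr; norm_num
  calc _ ≤ σ ^ (-((n : ℝ) / 2)) * Real.exp (-‖z‖ ^ 2 / (8 * σ)) * σ ^ (-1 - s) := by gcongr
    _ = (σ ^ (-((n : ℝ) / 2)) * σ ^ (-1 - s)) * Real.exp (-‖z‖ ^ 2 / (8 * σ)) := by ring
    _ = _ := by rw [← Real.rpow_add hσ]; congr 2; ring

/-- For a test function of small second differences, averaging against a Gaussian with a nearby
centre changes little. -/
theorem abs_integral_heatKer_sub_le {n : ℕ} {χ : RSpace n → ℝ} (hχ : Continuous χ)
    (h0 : ∀ y, 0 ≤ χ y) (h1 : ∀ y, χ y ≤ 1) {L₁ L₂ : ℝ}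
    (hL₁ : ∀ y z, |χ y - χ z| ≤ L₁ * ‖y - z‖)
    (hL₂ : ∀ y w, |χ (y + w) + χ (y - w) - 2 * χ y| ≤ L₂ * ‖w‖ ^ 2)
    {v : ℝ} (hv : 0 < v) (m z : RSpace n) (hL₂0 : 0 ≤ L₂) :
    |(∫ y, heatKer v (y - m) * χ y) - χ z| ≤
      L₁ * ‖m - z‖ + L₂ * (4 * 2 ^ ((n : ℝ) / 2)) * v := by
  have hb : ∀ y, ‖χ y‖ ≤ 1 := fun y => by rw [Real.norm_of_nonneg (h0 y)]; exact h1 y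
  have hint := integrable_heatKer (n := n) hv
  have i1 : Integrable fun w : RSpace n => heatKer v w * χ (m + w) :=
    hint.mul_bdd (c := 1) (by fun_prop) (ae_of_all _ fun w => hb _)
  have i2 : Integrable fun w : RSpace n => heatKer v w * χ (m - w) :=
    hint.mul_bdd (c := 1) (by fun_prop) (ae_of_all _ fun w => hb _)
  have e1 : ∫ y, heatKer v (y - m) * χ y = ∫ w, heatKer v w * χ (m + w) := by
    rw [← integral_add_right_eq_self (fun y => heatKer v (y - m) * χ y) m]
    simp [add_comm]
  have e2 : ∫ y, heatKer v (y - m) * χ y = ∫ w, heatKer v w * χ (m - w) := by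
    rw [e1, ← integral_neg_eq_self (fun w => heatKer v w * χ (m + w))]
    simp [heatKer_neg, sub_eq_add_neg]
  -- Averaging over w and -w removes the first-order term, so the spread of the Gaussian costs only
  -- v instead of √v.
  have e3 : (∫ y, heatKer v (y - m) * χ y) - χ m =
      ∫ w, heatKer v w * (χ (m + w) + χ (m - w) - 2 * χ m) / 2 := by
    have : ∀ w, heatKer v w * (χ (m + w) + χ (m - w) - 2 * χ m) / 2 =
        (heatKer v w * χ (m + w)) / 2 + (heatKer v w * χ (m - w)) / 2 - heatKer v w * χ m := by
      intro w; ring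
    simp_rw [this]
    rw [integral_sub (f := fun w => heatKer v w * χ (m + w) / 2 + heatKer v w * χ (m - w) / 2)
      ((i1.div_const 2).add (i2.div_const 2)) (hint.mul_const _),
      integral_add (i1.div_const 2) (i2.div_const 2), integral_div, integral_div, ← e1, ← e2,
      integral_mul_const, integral_heatKer hv]
    ring
  have hint2 := integrable_heatKer (n := n) (r := 2 * v) (by positivity)
  have h3 : |(∫ y, heatKer v (y - m) * χ y) - χ m| ≤ L₂ * (4 * 2 ^ ((n : ℝ) / 2)) * v := by
    rw [e3, ← Real.norm_eq_abs]
    have := norm_integral_le_of_norm_le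
      (hint2.const_mul (L₂ * (4 * 2 ^ ((n : ℝ) / 2)) * v)) (ae_of_all _ fun w => ?_)
      (f := fun w => heatKer v w * (χ (m + w) + χ (m - w) - 2 * χ m) / 2)
    · rwa [integral_const_mul, integral_heatKer (by positivity), mul_one] at this
    · have hk := heatKer_pos hv w
      have hs := sq_mul_heatKer_le hv w
      rw [norm_div, norm_mul, Real.norm_of_nonneg hk.le, Real.norm_eq_abs, Real.norm_two]
      have := mul_le_mul_of_nonneg_left (hL₂ m w) hk.le
      have h7 := mul_le_mul_of_nonneg_left hs hL₂0
      linarith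
  have h4 := abs_add_le ((∫ y, heatKer v (y - m) * χ y) - χ m) (χ m - χ z)
  rw [sub_add_sub_cancel] at h4
  linarith [hL₁ m z]

/-! ### Potential, Lévy and exit densities of the stable subordinator -/

/-- The density `ρ^{s-1}/Γ(s)` on `(0,∞)`. -/
noncomputable def rieszW (s ρ : ℝ) : ℝ≥0∞ :=
  if 0 < ρ then ENNReal.ofReal (ρ ^ (s - 1) / Real.Gamma s) else 0

/-- The density `ρ^{s-1}/Γ(s)` on `(0,N)`. -/
noncomputable def rieszTrunc (s N ρ : ℝ) : ℝ≥0∞ :=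
  if 0 < ρ ∧ ρ < N then ENNReal.ofReal (ρ ^ (s - 1) / Real.Gamma s) else 0

/-- The Lévy density `s r^{-1-s}/Γ(1-s)` on `(ε,∞)`. -/
noncomputable def levyW (s ε r : ℝ) : ℝ≥0∞ :=
  if ε < r then ENNReal.ofReal (s / Real.Gamma (1 - s) * r ^ (-1 - s)) else 0

/-- The total mass of `levyW s ε`. -/
noncomputable def levyMass (s ε : ℝ) : ℝ := ε ^ (-s) / Real.Gamma (1 - s)

/-- The constant `sin (π s) / π`. -/
noncomputable def stableConst (s : ℝ) : ℝ := 1 / (Real.Gamma s * Real.Gamma (1 - s))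

/-- The approximate identity by which the truncated fractional derivative inverts the
fractional integral. -/
noncomputable def defectW (s ε σ : ℝ) : ℝ≥0∞ :=
  if 0 < σ then
    ENNReal.ofReal (stableConst s * (ε ^ (-s) * (σ ^ s - (max (σ - ε) 0) ^ s) / σ)) else 0

/-- The density of the position of the first jump over `N` of the stable subordinator. -/
noncomputable def exitW (s N σ : ℝ) : ℝ≥0∞ :=
  if N < σ then ENNReal.ofReal (stableConst s * (N ^ s / (σ * (σ - N) ^ s))) else 0

/-- Convolution of densities on the line. -/
noncomputable def lconv (a b : ℝ → ℝ≥0∞) (σ : ℝ) : ℝ≥0∞ := ∫⁻ r, a (σ - r) * b r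

theorem measurable_rieszW (s : ℝ) : Measurable (rieszW s) :=
  Measurable.ite measurableSet_Ioi (by fun_prop) measurable_const

theorem measurable_rieszTrunc (s N : ℝ) : Measurable (rieszTrunc s N) :=
  Measurable.ite measurableSet_Ioo (by fun_prop) measurable_const

theorem measurable_levyW (s ε : ℝ) : Measurable (levyW s ε) :=
  Measurable.ite measurableSet_Ioi (by fun_prop) measurable_const

theorem measurable_defectW (s ε : ℝ) : Measurable (defectW s ε) :=
  Measurable.ite measurableSet_Ioi (by fun_prop) measurable_const

theorem measurable_exitW (s N : ℝ) : Measurable (exitW s N) :=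
  Measurable.ite measurableSet_Ioi (by fun_prop) measurable_const

theorem measurable_lconv {a b : ℝ → ℝ≥0∞} (ha : Measurable a) (hb : Measurable b) :
    Measurable (lconv a b) := by
  unfold lconv
  have : Measurable fun p : ℝ × ℝ => a (p.1 - p.2) * b p.2 := by fun_prop
  exact this.lintegral_prod_right'

theorem stableConst_pos {s : ℝ} (hs0 : 0 < s) (hs1 : s < 1) : 0 < stableConst s := by
  have h1 := Real.Gamma_pos_of_pos hs0
  have h2 := Real.Gamma_pos_of_pos (sub_pos.2 hs1)
  unfold stableConst; positivity

theorem lintegral_Ioo_of_hasDerivAt {g g' : ℝ → ℝ} {a b : ℝ} (hab : a ≤ b)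
    (hcont : ContinuousOn g (Icc a b)) (hderiv : ∀ x ∈ Ioo a b, HasDerivAt g (g' x) x)
    (hpos : ∀ x ∈ Ioo a b, 0 ≤ g' x) :
    ∫⁻ x in Ioo a b, ENNReal.ofReal (g' x) = ENNReal.ofReal (g b - g a) := by
  have h1 := intervalIntegral.integrableOn_deriv_of_nonneg hcont hderiv hpos
  have h2 := intervalIntegral.integral_eq_sub_of_hasDerivAt_of_le hab hcont hderiv
    ((intervalIntegrable_iff_integrableOn_Ioc_of_le hab).2 h1)
  rw [← h2, intervalIntegral.integral_of_le hab, integral_Ioc_eq_integral_Ioo,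
    ofReal_integral_eq_lintegral_ofReal (h1.mono_set Ioo_subset_Ioc_self)]
  exact (ae_restrict_iff' measurableSet_Ioo).2 (ae_of_all _ hpos)

/-- The integrand has the elementary primitive -`stableConst s`·((σ-r)/r)^s/σ. Taking l = ε produces
the truncated Lévy–Riesz convolution, and l = σ - N the exit density. -/
theorem lintegral_riesz_levy {s : ℝ} (hs0 : 0 < s) (hs1 : s < 1) {l σ : ℝ} (hl : 0 < l)
    (hlσ : l ≤ σ) :
    ∫⁻ r in Ioo l σ, ENNReal.ofReal ((σ - r) ^ (s - 1) / Real.Gamma s) *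
      ENNReal.ofReal (s / Real.Gamma (1 - s) * r ^ (-1 - s)) =
    ENNReal.ofReal (stableConst s * ((σ - l) ^ s / (σ * l ^ s))) := by
  have hσ : 0 < σ := hl.trans_le hlσ
  have hG1 := Real.Gamma_pos_of_pos hs0
  have hG2 := Real.Gamma_pos_of_pos (sub_pos.2 hs1)
  have key := lintegral_Ioo_of_hasDerivAt (a := l) (b := σ)
    (g := fun r => -(stableConst s * ((σ - r) ^ s * r ^ (-s) / σ)))
    (g' := fun r => ((σ - r) ^ (s - 1) / Real.Gamma s) *
      (s / Real.Gamma (1 - s) * r ^ (-1 - s))) hlσ ?_ ?_ ?_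
  · rw [setLIntegral_congr_fun measurableSet_Ioo (g := fun r => ENNReal.ofReal
      (((σ - r) ^ (s - 1) / Real.Gamma s) * (s / Real.Gamma (1 - s) * r ^ (-1 - s)))), key]
    · congr 1
      rw [sub_self, Real.zero_rpow hs0.ne', Real.rpow_neg hl.le]
      field_simp
      ring
    · intro r hr
      have : 0 < σ - r := sub_pos.2 hr.2
      exact (ENNReal.ofReal_mul (by positivity)).symm
  · intro r hr
    apply ContinuousAt.continuousWithinAt
    have h1 : ContinuousAt (fun r : ℝ => (σ - r) ^ s) r :=
      ContinuousAt.rpow_const (by fun_prop) (Or.inr hs0.le)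
    have h2 : ContinuousAt (fun r : ℝ => r ^ (-s)) r :=
      Real.continuousAt_rpow_const _ _ (Or.inl (hl.trans_le hr.1).ne')
    exact (((h1.mul h2).div_const σ).const_mul _).neg
  · intro r hr
    have hr0 : 0 < r := hl.trans hr.1
    have hσr : 0 < σ - r := sub_pos.2 hr.2
    have h1 : HasDerivAt (fun r : ℝ => (σ - r) ^ s) (-1 * s * (σ - r) ^ (s - 1)) r :=
      ((hasDerivAt_id r).const_sub σ).rpow_const (Or.inl hσr.ne')
    have h2 : HasDerivAt (fun r : ℝ => r ^ (-s)) (-s * r ^ (-s - 1)) r :=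
      Real.hasDerivAt_rpow_const (Or.inl hr0.ne')
    have h3 := (((h1.mul h2).div_const σ).const_mul (stableConst s)).neg
    refine h3.congr_deriv ?_
    have e1 : (σ - r) ^ s = (σ - r) ^ (s - 1) * (σ - r) := by
      rw [← Real.rpow_add_one hσr.ne']; ring_nf
    have e2 : r ^ (-s) = r ^ (-s - 1) * r := by
      rw [← Real.rpow_add_one hr0.ne']; ring_nf
    rw [e1, e2, show -1 - s = -s - 1 by ring]
    unfold stableConst
    field_simp
    ring
  · intro r hr
    have hr0 : 0 < r := hl.trans hr.1
    have hσr : 0 < σ - r := sub_pos.2 hr.2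
    positivity

theorem lconv_riesz_levy {s : ℝ} (hs0 : 0 < s) (hs1 : s < 1) {ε σ : ℝ} (hε : 0 < ε) :
    lconv (rieszW s) (levyW s ε) σ =
      if ε < σ then ENNReal.ofReal (stableConst s * ((σ - ε) ^ s / (σ * ε ^ s))) else 0 := by
  have h : ∀ r, rieszW s (σ - r) * levyW s ε r = (Ioo ε σ).indicator (fun r =>
      ENNReal.ofReal ((σ - r) ^ (s - 1) / Real.Gamma s) *
      ENNReal.ofReal (s / Real.Gamma (1 - s) * r ^ (-1 - s))) r := by
    intro r
    simp only [rieszW, levyW, indicator, mem_Ioo, sub_pos]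
    by_cases h1 : r < σ <;> by_cases h2 : ε < r <;> simp [h1, h2]
  unfold lconv
  simp_rw [h]
  rw [lintegral_indicator measurableSet_Ioo]
  split_ifs with h1
  · exact lintegral_riesz_levy hs0 hs1 hε h1.le
  · rw [Ioo_eq_empty h1]; simp

/-- A jump from a position in (0,N) to σ > N is longer than σ - N, so cutting the Lévy density at a
smaller ε does not change anything. -/
theorem lconv_trunc_levy {s : ℝ} (hs0 : 0 < s) (hs1 : s < 1) {ε N σ : ℝ}
    (hN : 0 < N) (hσ : N < σ) (hεσ : ε < σ - N) :
    lconv (rieszTrunc s N) (levyW s ε) σ = exitW s N σ := by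
  have h : ∀ r, rieszTrunc s N (σ - r) * levyW s ε r = (Ioo (σ - N) σ).indicator (fun r =>
      ENNReal.ofReal ((σ - r) ^ (s - 1) / Real.Gamma s) *
      ENNReal.ofReal (s / Real.Gamma (1 - s) * r ^ (-1 - s))) r := by
    intro r
    simp only [rieszTrunc, levyW, indicator, mem_Ioo, sub_pos]
    by_cases h1 : r < σ <;> by_cases h2 : σ - N < r
    · have h3 : ε < r := by linarith
      have h4 : σ - r < N := by linarith
      simp [h1, h2, h3, h4]
    all_goals
      have h4 : ¬ (σ - r < N ∧ r < σ) := fun h => by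
        first | exact h1 h.2 | exact h2 (by linarith [h.1])
      have h5 : ¬ (r < σ ∧ σ - r < N) := fun h => h4 ⟨h.2, h.1⟩
      simp [h1, h2]
      try (intros; exfalso; linarith)
  unfold lconv
  simp_rw [h]
  rw [lintegral_indicator measurableSet_Ioo,
    lintegral_riesz_levy hs0 hs1 (by linarith) (by linarith), exitW, if_pos hσ, sub_sub_cancel]

theorem levyW_anti {s ε ε' : ℝ} (h : ε' ≤ ε) (r : ℝ) : levyW s ε r ≤ levyW s ε' r := by
  unfold levyW
  by_cases h1 : ε < r
  · rw [if_pos h1, if_pos (h.trans_lt h1)]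
  · rw [if_neg h1]; exact zero_le

theorem lconv_trunc_levy_le {s : ℝ} (hs0 : 0 < s) (hs1 : s < 1) {ε N σ : ℝ} (hε : 0 ≤ ε)
    (hN : 0 < N) (hσ : N < σ) :
    lconv (rieszTrunc s N) (levyW s ε) σ ≤ exitW s N σ := by
  rw [← lconv_trunc_levy (ε := 0) hs0 hs1 hN hσ (by linarith)]
  exact lintegral_mono fun r => mul_le_mul_right (levyW_anti hε r) _

theorem lconv_eq_zero {a b : ℝ → ℝ≥0∞} (ha : ∀ ρ ≤ 0, a ρ = 0) (hb : ∀ r ≤ 0, b r = 0) {σ : ℝ}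
    (hσ : σ ≤ 0) : lconv a b σ = 0 := by
  unfold lconv
  rw [lintegral_eq_zero_of_ae_eq_zero]
  refine ae_of_all _ fun r => ?_
  rcases le_total r 0 with h | h
  · simp [hb r h]
  · simp [ha (σ - r) (by linarith)]

theorem rieszW_zero {s ρ : ℝ} (h : ρ ≤ 0) : rieszW s ρ = 0 := if_neg (not_lt.2 h)

theorem rieszTrunc_zero {s N ρ : ℝ} (h : ρ ≤ 0) : rieszTrunc s N ρ = 0 :=
  if_neg fun h' => (not_lt.2 h) h'.1

theorem levyW_zero {s ε r : ℝ} (hε : 0 ≤ ε) (h : r ≤ 0) : levyW s ε r = 0 :=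
  if_neg (not_lt.2 (h.trans hε))

theorem defectW_zero {s ε σ : ℝ} (h : σ ≤ 0) : defectW s ε σ = 0 := if_neg (not_lt.2 h)

/-- With all terms explicit this is σ^s = (σ-ε)₊^s + (σ^s - (σ-ε)₊^s), up to a common factor. It
says that the truncated fractional derivative of the Riesz kernel is `defectW`, in additive form
because subtraction in `ℝ≥0∞` truncates. -/
theorem levyMass_mul_riesz {s : ℝ} (hs0 : 0 < s) (hs1 : s < 1) {ε : ℝ} (hε : 0 < ε) (σ : ℝ) :
    ENNReal.ofReal (levyMass s ε) * rieszW s σ =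
      lconv (rieszW s) (levyW s ε) σ + defectW s ε σ := by
  have hG1 := Real.Gamma_pos_of_pos hs0
  have hG2 := Real.Gamma_pos_of_pos (sub_pos.2 hs1)
  have hC := stableConst_pos hs0 hs1
  rcases le_or_gt σ 0 with h | h
  · rw [rieszW_zero h, defectW_zero h, lconv_eq_zero (fun _ => rieszW_zero)
      (fun _ => levyW_zero hε.le) h]
    simp
  · have e1 : σ ^ (s - 1) = σ ^ s / σ := Real.rpow_sub_one h.ne' s
    rw [lconv_riesz_levy hs0 hs1 hε, rieszW, if_pos h, defectW, if_pos h,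
      ← ENNReal.ofReal_mul (by unfold levyMass; positivity)]
    split_ifs with h1
    · have h2 : 0 < σ - ε := sub_pos.2 h1
      rw [max_eq_left h2.le, ← ENNReal.ofReal_add (by positivity)]
      · congr 1
        rw [e1, levyMass, stableConst, Real.rpow_neg hε.le]
        field_simp
        ring
      · have : (σ - ε) ^ s ≤ σ ^ s := by gcongr; linarith
        have h3 := sub_nonneg.2 this
        positivity
    · rw [max_eq_right (by linarith), Real.zero_rpow hs0.ne', zero_add, e1, levyMass, stableConst]
      congr 1
      field_simp
      ring

theorem lconv_trunc_eq {s N : ℝ} {ε σ : ℝ} (hε : 0 ≤ ε) (hσ : σ < N) :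
    lconv (rieszTrunc s N) (levyW s ε) σ = lconv (rieszW s) (levyW s ε) σ := by
  unfold lconv
  congr 1
  ext r
  rcases le_or_gt r ε with h | h
  · simp [levyW, not_lt.2 h]
  · congr 1
    have : σ - r < N := by linarith
    simp [rieszTrunc, rieszW, this]

/-- A jump ending below N starts below N, so on σ < N truncation of the Riesz density is invisible
and the previous identity holds. On σ ≥ N only the jumps across N remain, and they are added to the
left side for balance. -/
theorem levyMass_mul_trunc {s : ℝ} (hs0 : 0 < s) (hs1 : s < 1) {ε N : ℝ} (hε : 0 < ε) (σ : ℝ) :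
    ENNReal.ofReal (levyMass s ε) * rieszTrunc s N σ +
        (if N ≤ σ then lconv (rieszTrunc s N) (levyW s ε) σ else 0) =
      lconv (rieszTrunc s N) (levyW s ε) σ + (if σ < N then defectW s ε σ else 0) := by
  rcases le_or_gt N σ with h | h
  · have : rieszTrunc s N σ = 0 := if_neg fun h' => not_lt.2 h h'.2
    rw [if_pos h, if_neg (not_lt.2 h), this]; simp
  · have : rieszTrunc s N σ = rieszW s σ := by simp [rieszTrunc, rieszW, h]
    rw [if_neg (not_le.2 h), if_pos h, add_zero, lconv_trunc_eq hε.le h, this,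
      levyMass_mul_riesz hs0 hs1 hε]

/-- With v = (σ-ε)₊/σ, use 1 - v^s ≤ 1 - v. At lags bounded away from 0 the defect is therefore
O(ε^{1-s}), which is the concentration needed of an approximate identity; the power σ^{s-2} is the
kernel of `farPot`. -/
theorem defectW_le {s : ℝ} (hs0 : 0 < s) (hs1 : s < 1) {ε : ℝ} (hε : 0 < ε) {σ : ℝ} (hσ : 0 < σ) :
    defectW s ε σ ≤ ENNReal.ofReal (stableConst s * ε ^ (1 - s)) *
      ENNReal.ofReal (σ ^ (s - 2)) := by
  have hC := stableConst_pos hs0 hs1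
  rw [defectW, if_pos hσ, ← ENNReal.ofReal_mul (by positivity), mul_assoc]
  apply ENNReal.ofReal_le_ofReal
  gcongr
  have h1 : σ ^ s - (max (σ - ε) 0) ^ s ≤ σ ^ (s - 1) * ε := by
    set v := max (σ - ε) 0 / σ with hv
    have hv0 : 0 ≤ v := by positivity
    have hv1 : v ≤ 1 := by
      rw [hv, div_le_one hσ]; exact max_le (by linarith) hσ.le
    have h2 : v ≤ v ^ s := Real.self_le_rpow_of_le_one hv0 hv1 hs1.le
    have h3 : max (σ - ε) 0 = v * σ := by rw [hv]; field_simp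
    rw [h3, Real.mul_rpow hv0 hσ.le, Real.rpow_sub_one hσ.ne']
    have h4 : σ - ε ≤ v * σ := by rw [← h3]; exact le_max_left _ _
    have h5 : 0 < σ ^ s := by positivity
    have h6 : (1 - v) * σ ≤ ε := by linarith
    calc σ ^ s - v ^ s * σ ^ s = (1 - v ^ s) * σ ^ s := by ring
      _ ≤ (1 - v) * σ ^ s := by gcongr
      _ = σ ^ s / σ * ((1 - v) * σ) := by field_simp
      _ ≤ _ := by gcongr
  calc ε ^ (-s) * (σ ^ s - (max (σ - ε) 0) ^ s) / σ ≤ ε ^ (-s) * (σ ^ (s - 1) * ε) / σ := by gcongr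
    _ = (ε ^ (-s) * ε) * (σ ^ (s - 1) / σ) := by ring
    _ = _ := by
      rw [← Real.rpow_add_one hε.ne', ← Real.rpow_sub_one hσ.ne']; ring_nf

/-- The substitution r ↦ σr gives the Beta(1-s, s) density. The value does not depend on σ; this
serves both to normalise the defect and to bound cutoff errors uniformly in the lag. -/
theorem lintegral_beta {s : ℝ} (hs0 : 0 < s) (hs1 : s < 1) {σ : ℝ} (hσ : 0 < σ) :
    ∫⁻ r, rieszW s (σ - r) * rieszW (1 - s) r = 1 := by
  have hG1 := Real.Gamma_pos_of_pos hs0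
  have hG2 := Real.Gamma_pos_of_pos (sub_pos.2 hs1)
  have h1 := ProbabilityTheory.lintegral_betaPDF_eq_one (sub_pos.2 hs1) hs0
  have h2 : ∀ r, ENNReal.ofReal σ * (rieszW s (σ - σ * r) * rieszW (1 - s) (σ * r)) =
      ProbabilityTheory.betaPDF (1 - s) s r := by
    intro r
    unfold ProbabilityTheory.betaPDF ProbabilityTheory.betaPDFReal rieszW
    have e1 : 0 < σ - σ * r ↔ r < 1 := by
      rw [show σ - σ * r = σ * (1 - r) by ring, mul_pos_iff_of_pos_left hσ, sub_pos]
    have e2 : 0 < σ * r ↔ 0 < r := mul_pos_iff_of_pos_left hσ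
    simp only [e1, e2]
    by_cases h3 : r < 1 <;> by_cases h4 : 0 < r
    · have h5 : 0 < 1 - r := sub_pos.2 h3
      rw [if_pos h3, if_pos h4, if_pos ⟨h4, h3⟩, ← ENNReal.ofReal_mul,
        ← ENNReal.ofReal_mul hσ.le]
      · congr 1
        rw [show σ - σ * r = σ * (1 - r) by ring, Real.mul_rpow hσ.le h5.le,
          Real.mul_rpow hσ.le h4.le, ProbabilityTheory.beta, sub_add_cancel, Real.Gamma_one,
          Real.rpow_sub_one hσ.ne' s, show (1 - s - 1 : ℝ) = -s by ring, Real.rpow_neg hσ.le]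
        field_simp
      · rw [show σ - σ * r = σ * (1 - r) by ring]; positivity
    all_goals simp [h3, h4]
  have h3 : ∫⁻ r, rieszW s (σ - r) * rieszW (1 - s) r =
      ENNReal.ofReal σ * ∫⁻ r, rieszW s (σ - σ * r) * rieszW (1 - s) (σ * r) := by
    have hm : Measurable fun r => rieszW s (σ - r) * rieszW (1 - s) r :=
      ((measurable_rieszW s).comp (by fun_prop)).mul (measurable_rieszW (1 - s))
    have := lintegral_map hm (measurable_const_mul σ) (μ := volume)
    rw [Real.map_volume_mul_left hσ.ne', lintegral_smul_measure] at this
    rw [← this, smul_eq_mul, ← mul_assoc, ← ENNReal.ofReal_mul hσ.le, abs_of_pos (by positivity),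
      mul_inv_cancel₀ hσ.ne']
    simp
  have hm2 : Measurable fun r => rieszW s (σ - σ * r) * rieszW (1 - s) (σ * r) :=
    ((measurable_rieszW s).comp (by fun_prop)).mul
      ((measurable_rieszW (1 - s)).comp (by fun_prop))
  rw [h3, ← lintegral_const_mul _ hm2, ← h1]
  exact lintegral_congr h2

theorem lintegral_levyW_Ici {s : ℝ} (hs0 : 0 < s) (hs1 : s < 1) {ε l : ℝ}
    (hmax : 0 < max ε l) :
    ∫⁻ r, (if l ≤ r then levyW s ε r else 0) = ENNReal.ofReal (levyMass s (max ε l)) := by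
  have hG2 := Real.Gamma_pos_of_pos (sub_pos.2 hs1)
  have h1 : ∀ᵐ r : ℝ, (if l ≤ r then levyW s ε r else 0) = (Ioi (max ε l)).indicator
      (fun r => ENNReal.ofReal (s / Real.Gamma (1 - s) * r ^ (-1 - s))) r := by
    have : ∀ᵐ r : ℝ, r ≠ l := by simp [ae_iff]
    filter_upwards [this] with r hr
    have : l ≤ r ↔ l < r := ⟨fun h => lt_of_le_of_ne h hr.symm, le_of_lt⟩
    simp only [levyW, indicator, mem_Ioi, max_lt_iff, this]
    by_cases h1 : l < r <;> by_cases h2 : ε < r <;> simp [h1, h2]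
  rw [lintegral_congr_ae h1, lintegral_indicator measurableSet_Ioi,
    ← ofReal_integral_eq_lintegral_ofReal
      ((integrableOn_Ioi_rpow_of_lt (by linarith) hmax).const_mul _)]
  · rw [integral_const_mul, integral_Ioi_rpow_of_lt (by linarith) hmax, levyMass]
    congr 1
    rw [show -1 - s + 1 = -s by ring]
    field_simp
  · refine (ae_restrict_iff' measurableSet_Ioi).2 (ae_of_all _ fun r hr => ?_)
    have : (0 : ℝ) < r := hmax.trans hr
    simp only [Pi.zero_apply]
    positivity

theorem lintegral_rieszTrunc {s : ℝ} (hs0 : 0 < s) {N : ℝ} (hN : 0 ≤ N) :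
    ∫⁻ ρ, rieszTrunc s N ρ = ENNReal.ofReal (N ^ s / (s * Real.Gamma s)) := by
  have hG1 := Real.Gamma_pos_of_pos hs0
  have h : ∀ ρ, rieszTrunc s N ρ = (Ioo 0 N).indicator
      (fun ρ => ENNReal.ofReal (ρ ^ (s - 1) / Real.Gamma s)) ρ := by
    intro ρ
    simp [rieszTrunc, indicator]
  simp_rw [h]
  rw [lintegral_indicator measurableSet_Ioo,
    lintegral_Ioo_of_hasDerivAt (g := fun ρ => ρ ^ s / (s * Real.Gamma s)) hN]
  · simp [Real.zero_rpow hs0.ne']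
  · intro r _
    exact ((Real.continuousAt_rpow_const _ _ (Or.inr hs0.le)).div_const _).continuousWithinAt
  · intro r hr
    refine ((Real.hasDerivAt_rpow_const (p := s) (Or.inl hr.1.ne')).div_const
      (s * Real.Gamma s)).congr_deriv ?_
    field_simp
  · intro r hr
    have := hr.1
    positivity

theorem lintegral_levyW {s : ℝ} (hs0 : 0 < s) (hs1 : s < 1) {ε : ℝ} (hε : 0 < ε) :
    ∫⁻ r, levyW s ε r = ENNReal.ofReal (levyMass s ε) := by
  have h := lintegral_levyW_Ici hs0 hs1 (ε := ε) (l := 0) (by positivity)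
  rw [max_eq_left hε.le] at h
  rw [← h]
  congr 1
  ext r
  split_ifs with h1
  · rfl
  · exact levyW_zero hε.le (not_le.1 h1).le

/-- Integrate the mass balance with N = 1 over σ < 1. Jumps from ρ that land below 1 account for C;
cancelling this finite quantity leaves the jumps from ρ that land beyond 1, whose mass is that of
the Lévy density past max ε (1-ρ). -/
theorem lintegral_defectW_lt_one {s : ℝ} (hs0 : 0 < s) (hs1 : s < 1) {ε : ℝ} (hε : 0 < ε) :
    ∫⁻ σ, (if σ < 1 then defectW s ε σ else 0) =
      ∫⁻ ρ, rieszTrunc s 1 ρ * ENNReal.ofReal (levyMass s (max ε (1 - ρ))) := by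
  have ma := measurable_rieszTrunc s 1
  have mb := measurable_levyW s ε
  have hfin : ENNReal.ofReal (levyMass s ε) * ∫⁻ ρ, rieszTrunc s 1 ρ ≠ ∞ := by
    rw [lintegral_rieszTrunc hs0 zero_le_one]
    exact ENNReal.mul_ne_top ENNReal.ofReal_ne_top ENNReal.ofReal_ne_top
  have mconv := measurable_lconv ma mb
  set C := ∫⁻ σ, (if σ < 1 then lconv (rieszTrunc s 1) (levyW s ε) σ else 0) with hC
  have h1 : ENNReal.ofReal (levyMass s ε) * ∫⁻ ρ, rieszTrunc s 1 ρ =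
      C + ∫⁻ σ, (if σ < 1 then defectW s ε σ else 0) := by
    rw [hC, ← lintegral_const_mul _ ma, ← lintegral_add_left
      (Measurable.ite measurableSet_Iio mconv measurable_const)]
    congr 1
    ext σ
    have := levyMass_mul_trunc hs0 hs1 (N := 1) hε σ
    rcases lt_or_ge σ 1 with h | h
    · rw [if_neg (not_le.2 h), if_pos h, add_zero] at this
      rw [if_pos h, if_pos h, this]
    · rw [if_neg (not_lt.2 h), if_neg (not_lt.2 h), rieszTrunc,
        if_neg fun h' => not_lt.2 h h'.2]
      simp
  have h2 : C = ∫⁻ ρ, rieszTrunc s 1 ρ * ∫⁻ r, (if r < 1 - ρ then levyW s ε r else 0) := by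
    have e1 : C = ∫⁻ σ, ∫⁻ r, (if σ < 1 then rieszTrunc s 1 (σ - r) * levyW s ε r else 0) := by
      rw [hC]
      congr 1
      ext σ
      split_ifs with h
      · rfl
      · simp
    have m1 : Measurable fun p : ℝ × ℝ =>
        if p.1 < 1 then rieszTrunc s 1 (p.1 - p.2) * levyW s ε p.2 else 0 :=
      Measurable.ite (measurableSet_lt measurable_fst measurable_const) (by fun_prop)
        measurable_const
    have m2 : Measurable fun p : ℝ × ℝ =>
        if p.1 + p.2 < 1 then rieszTrunc s 1 p.1 * levyW s ε p.2 else 0 :=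
      Measurable.ite (measurableSet_lt (by fun_prop) measurable_const) (by fun_prop)
        measurable_const
    rw [e1, lintegral_lintegral_swap m1.aemeasurable]
    have e2 : ∀ r, (∫⁻ σ, if σ < 1 then rieszTrunc s 1 (σ - r) * levyW s ε r else 0) =
        ∫⁻ ρ, if ρ + r < 1 then rieszTrunc s 1 ρ * levyW s ε r else 0 := by
      intro r
      rw [← lintegral_add_right_eq_self _ r]
      simp
    simp_rw [e2]
    rw [← lintegral_lintegral_swap m2.aemeasurable]
    congr 1
    ext ρ
    rw [← lintegral_const_mul _ (Measurable.ite measurableSet_Iio mb measurable_const)]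
    congr 1
    ext r
    have : ρ + r < 1 ↔ r < 1 - ρ := by constructor <;> intro h <;> linarith
    simp only [this]
    split_ifs <;> simp
  have h3 : ENNReal.ofReal (levyMass s ε) * ∫⁻ ρ, rieszTrunc s 1 ρ =
      C + ∫⁻ ρ, rieszTrunc s 1 ρ * ENNReal.ofReal (levyMass s (max ε (1 - ρ))) := by
    rw [h2, ← lintegral_add_left, ← lintegral_const_mul _ ma]
    · congr 1
      ext ρ
      rw [← mul_add, mul_comm, ← lintegral_levyW hs0 hs1 hε,
        ← lintegral_levyW_Ici hs0 hs1 (ε := ε) (l := 1 - ρ) (by positivity),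
        ← lintegral_add_left (Measurable.ite measurableSet_Iio mb measurable_const)]
      congr 2
      ext r
      rcases lt_or_ge r (1 - ρ) with h | h
      · simp [h, not_le.2 h]
      · simp [h, not_lt.2 h]
    · have m2 : Measurable fun p : ℝ × ℝ => if p.2 < 1 - p.1 then levyW s ε p.2 else 0 :=
        Measurable.ite (measurableSet_lt (by fun_prop) (by fun_prop)) (by fun_prop)
          measurable_const
      exact ma.mul m2.lintegral_prod_right'
  have hCfin : C ≠ ∞ := ne_top_of_le_ne_top hfin (by rw [h1]; exact le_self_add)
  exact (ENNReal.add_right_inj hCfin).1 (h1.symm.trans h3)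

theorem levyMass_nonneg {s : ℝ} (hs1 : s < 1) {ε : ℝ} (hε : 0 ≤ ε) : 0 ≤ levyMass s ε := by
  have hG2 := Real.Gamma_pos_of_pos (sub_pos.2 hs1)
  unfold levyMass; positivity

/-- Letting ε → 0 by dominated convergence gives the integral of ρ^{s-1}(1-ρ)^{-s}/(Γ(s)Γ(1-s)) over
(0,1), the Beta integral with s and 1-s exchanged. -/
theorem tendsto_lintegral_defectW {s : ℝ} (hs0 : 0 < s) (hs1 : s < 1) :
    Tendsto (fun ε => ∫⁻ σ, (if σ < 1 then defectW s ε σ else 0)) (𝓝[>] 0) (𝓝 1) := by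
  have hG2 := Real.Gamma_pos_of_pos (sub_pos.2 hs1)
  have hb := lintegral_beta (sub_pos.2 hs1) (by linarith) one_pos (s := 1 - s)
  have ha : ∀ ρ, rieszTrunc s 1 ρ * ENNReal.ofReal (levyMass s (1 - ρ)) =
      rieszW (1 - s) (1 - ρ) * rieszW (1 - (1 - s)) ρ := by
    intro ρ
    rw [sub_sub_cancel]
    by_cases h1 : 0 < ρ <;> by_cases h2 : ρ < 1
    · rw [mul_comm]
      simp [rieszTrunc, rieszW, h1, h2, levyMass]
    all_goals simp [rieszTrunc, rieszW, h1, h2]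
  have hlim : Tendsto (fun ε => ∫⁻ ρ, rieszTrunc s 1 ρ *
      ENNReal.ofReal (levyMass s (max ε (1 - ρ)))) (𝓝[>] 0)
      (𝓝 (∫⁻ ρ, rieszTrunc s 1 ρ * ENNReal.ofReal (levyMass s (1 - ρ)))) := by
    have ma := measurable_rieszTrunc s 1
    apply tendsto_lintegral_filter_of_dominated_convergence
      (fun ρ => rieszTrunc s 1 ρ * ENNReal.ofReal (levyMass s (1 - ρ)))
    · filter_upwards with ε
      unfold levyMass
      fun_prop
    · filter_upwards [self_mem_nhdsWithin] with ε hε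
      refine ae_of_all _ fun ρ => ?_
      by_cases h : 0 < ρ ∧ ρ < 1
      · gcongr
        unfold levyMass
        gcongr ?_ / _
        exact Real.rpow_le_rpow_of_nonpos (by linarith [h.2]) (le_max_right _ _) (by linarith)
      · simp [rieszTrunc, h]
    · simp_rw [ha]
      rw [hb]; exact ENNReal.one_ne_top
    · refine ae_of_all _ fun ρ => ?_
      by_cases h : 0 < ρ ∧ ρ < 1
      · apply tendsto_const_nhds.congr'
        filter_upwards [Ioo_mem_nhdsGT (by linarith [h.2] : (0 : ℝ) < 1 - ρ)] with ε hε
        rw [max_eq_right hε.2.le]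
      · simp [rieszTrunc, h]
  simp_rw [ha] at hlim
  rw [hb] at hlim
  refine hlim.congr' ?_
  filter_upwards [self_mem_nhdsWithin] with ε hε
  exact (lintegral_defectW_lt_one hs0 hs1 hε).symm

/-! ### Superpositions of heat averages and their convolution calculus -/

/-- The heat average `e^{σΔ} h(·, t - σ)` at `x`. -/
noncomputable def heatAvg {n : ℕ} (h : RSpace n → ℝ → ℝ≥0∞) (x : RSpace n) (t σ : ℝ) : ℝ≥0∞ :=
  ∫⁻ y, ENNReal.ofReal (heatKer σ (x - y)) * h y (t - σ)

/-- The superposition of heat averages with density `a`. -/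
noncomputable def heatPot {n : ℕ} (a : ℝ → ℝ≥0∞) (h : RSpace n → ℝ → ℝ≥0∞) (x : RSpace n)
    (t : ℝ) : ℝ≥0∞ :=
  ∫⁻ σ, a σ * heatAvg h x t σ

theorem measurable_uncurry_comp {n : ℕ} {α : Type*} [MeasurableSpace α]
    {h : RSpace n → ℝ → ℝ≥0∞} (hh : Measurable fun p : RSpace n × ℝ => h p.1 p.2)
    {f : α → RSpace n} {g : α → ℝ} (hf : Measurable f) (hg : Measurable g) :
    Measurable fun a => h (f a) (g a) :=
  hh.comp (hf.prodMk hg)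

theorem measurable_heatAvg {n : ℕ} {α : Type*} [MeasurableSpace α]
    {h : RSpace n → ℝ → ℝ≥0∞} (hh : Measurable fun p : RSpace n × ℝ => h p.1 p.2)
    {f : α → RSpace n} {g k : α → ℝ} (hf : Measurable f) (hg : Measurable g)
    (hk : Measurable k) : Measurable fun a => heatAvg h (f a) (g a) (k a) := by
  have : Measurable fun p : α × RSpace n =>
      ENNReal.ofReal (heatKer (k p.1) (f p.1 - p.2)) * h p.2 (g p.1 - k p.1) := by
    apply Measurable.mul
    · exact (measurable_heatKer (by fun_prop) (by fun_prop)).ennreal_ofReal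
    · exact measurable_uncurry_comp hh (by fun_prop) (by fun_prop)
  exact this.lintegral_prod_right'

theorem measurable_heatPot {n : ℕ} {α : Type*} [MeasurableSpace α] {a : ℝ → ℝ≥0∞}
    (ha : Measurable a)
    {h : RSpace n → ℝ → ℝ≥0∞} (hh : Measurable fun p : RSpace n × ℝ => h p.1 p.2)
    {f : α → RSpace n} {g : α → ℝ} (hf : Measurable f) (hg : Measurable g) :
    Measurable fun b => heatPot a h (f b) (g b) := by
  have : Measurable fun p : α × ℝ => a p.2 * heatAvg h (f p.1) (g p.1) p.2 :=
    (ha.comp measurable_snd).mul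
      (measurable_heatAvg hh (by fun_prop) (by fun_prop) measurable_snd)
  exact this.lintegral_prod_right'

theorem heatPot_mono {n : ℕ} {a b : ℝ → ℝ≥0∞} {h k : RSpace n → ℝ → ℝ≥0∞}
    (hab : ∀ σ, a σ ≤ b σ) (hhk : ∀ y τ, h y τ ≤ k y τ) (x : RSpace n) (t : ℝ) :
    heatPot a h x t ≤ heatPot b k x t :=
  lintegral_mono fun σ => mul_le_mul' (hab σ)
    (lintegral_mono fun y => mul_le_mul' le_rfl (hhk y _))

theorem heatPot_add {n : ℕ} {a b : ℝ → ℝ≥0∞} {h : RSpace n → ℝ → ℝ≥0∞} (ha : Measurable a)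
    (hh : Measurable fun p : RSpace n × ℝ => h p.1 p.2) (x : RSpace n) (t : ℝ) :
    heatPot (fun σ => a σ + b σ) h x t = heatPot a h x t + heatPot b h x t := by
  unfold heatPot
  have m : Measurable fun σ => a σ * heatAvg h x t σ :=
    ha.mul (measurable_heatAvg hh measurable_const measurable_const measurable_id)
  rw [← lintegral_add_left m]
  simp_rw [add_mul]

theorem heatPot_const_mul {n : ℕ} {a : ℝ → ℝ≥0∞} {h : RSpace n → ℝ → ℝ≥0∞} (ha : Measurable a)
    (hh : Measurable fun p : RSpace n × ℝ => h p.1 p.2) (c : ℝ≥0∞) (x : RSpace n) (t : ℝ) :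
    heatPot (fun σ => c * a σ) h x t = c * heatPot a h x t := by
  unfold heatPot
  have m : Measurable fun σ => a σ * heatAvg h x t σ :=
    ha.mul (measurable_heatAvg hh measurable_const measurable_const measurable_id)
  rw [← lintegral_const_mul _ m]
  simp_rw [mul_assoc]

/-- The heat kernels satisfy the Chapman–Kolmogorov identity, with a weight at the intermediate
point. -/
theorem lintegral_heatKer_mul_heatAvg {n : ℕ} {h : RSpace n → ℝ → ℝ≥0∞}
    (hh : Measurable fun p : RSpace n × ℝ => h p.1 p.2) {χ : RSpace n → ℝ≥0∞} (hχ : Measurable χ)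
    {q r : ℝ} (hq : 0 < q) (hr : 0 < r) (x : RSpace n) (t : ℝ) :
    ∫⁻ y, ENNReal.ofReal (heatKer q (x - y)) * χ y * heatAvg h y (t - q) r =
      ∫⁻ z, ENNReal.ofReal (heatKer (q + r) (x - z)) * h z (t - (q + r)) *
        ∫⁻ y, ENNReal.ofReal (heatKer (q * r / (q + r))
          (y - ((r / (q + r)) • x + (q / (q + r)) • z))) * χ y := by
  have hk : ∀ (ρ : ℝ) {α : Type} [MeasurableSpace α] {f : α → RSpace n} (_ : Measurable f),
      Measurable fun a => ENNReal.ofReal (heatKer ρ (f a)) :=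
    fun ρ _ _ f hf => (measurable_heatKer measurable_const hf).ennreal_ofReal
  have hh' : ∀ τ, Measurable fun z => h z τ :=
    fun τ => measurable_uncurry_comp hh measurable_id measurable_const
  have m1 : ∀ y, Measurable fun z => ENNReal.ofReal (heatKer r (y - z)) * h z (t - q - r) :=
    fun y => (hk r (by fun_prop)).mul (hh' _)
  unfold heatAvg
  simp_rw [← lintegral_const_mul _ (m1 _)]
  rw [lintegral_lintegral_swap]
  · congr 1
    ext z
    have m2 : Measurable fun y => ENNReal.ofReal (heatKer (q * r / (q + r))
          (y - ((r / (q + r)) • x + (q / (q + r)) • z))) * χ y :=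
      (hk _ (by fun_prop)).mul hχ
    rw [← lintegral_const_mul _ m2]
    congr 1
    ext y
    have h1 := heatKer_mul hq hr x y z
    have h2 := congrArg ENNReal.ofReal h1
    rw [ENNReal.ofReal_mul (heatKer_pos hq _).le,
      ENNReal.ofReal_mul (heatKer_pos (by positivity) _).le] at h2
    rw [sub_sub]
    calc _ = (ENNReal.ofReal (heatKer q (x - y)) * ENNReal.ofReal (heatKer r (y - z))) *
          (χ y * h z (t - (q + r))) := by ring
      _ = _ := by rw [h2]; ring
  · apply Measurable.aemeasurable
    have e1 : Measurable fun p : RSpace n × RSpace n => ENNReal.ofReal (heatKer q (x - p.1)) :=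
      hk q (by fun_prop)
    have e2 : Measurable fun p : RSpace n × RSpace n => ENNReal.ofReal (heatKer r (p.1 - p.2)) :=
      hk r (by fun_prop)
    exact (e1.mul (hχ.comp measurable_fst)).mul (e2.mul ((hh' _).comp measurable_snd))

theorem lintegral_heatKer_center {n : ℕ} {v : ℝ} (hv : 0 < v) (m : RSpace n) :
    ∫⁻ y, ENNReal.ofReal (heatKer v (y - m)) = 1 := by
  simp_rw [heatKer_sub_comm v _ m]
  exact lintegral_heatKer_sub hv m

theorem lintegral_heatKer_mul_heatAvg_one {n : ℕ} {h : RSpace n → ℝ → ℝ≥0∞}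
    (hh : Measurable fun p : RSpace n × ℝ => h p.1 p.2) {q r : ℝ} (hq : 0 < q) (hr : 0 < r)
    (x : RSpace n) (t : ℝ) :
    ∫⁻ y, ENNReal.ofReal (heatKer q (x - y)) * heatAvg h y (t - q) r = heatAvg h x t (q + r) := by
  have := lintegral_heatKer_mul_heatAvg hh (χ := fun _ => 1) measurable_const hq hr x t
  simp only [mul_one] at this
  rw [this, heatAvg]
  congr 1
  ext z
  rw [lintegral_heatKer_center (by positivity), mul_one]

/-- Tonelli followed by the shift σ = ρ + r. The intermediate point y stays in the formula, so that
a cutoff placed there can be treated by the same statement. -/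
theorem lintegral_lintegral_conv {α : Type*} [MeasurableSpace α] {μ : Measure α} [SFinite μ]
    {a b : ℝ → ℝ≥0∞} (ha : Measurable a) (hb : Measurable b) {k : ℝ → α → ℝ≥0∞}
    (hk : Measurable fun p : ℝ × α => k p.1 p.2) {H : α → ℝ → ℝ → ℝ≥0∞}
    (hH : Measurable fun p : (ℝ × ℝ) × α => H p.2 p.1.1 p.1.2) :
    ∫⁻ ρ, a ρ * ∫⁻ y, k ρ y * (∫⁻ r, b r * H y ρ r) ∂μ =
      ∫⁻ σ, ∫⁻ r, a (σ - r) * b r * ∫⁻ y, k (σ - r) y * H y (σ - r) r ∂μ := by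
  have mk : Measurable fun p : (ℝ × ℝ) × α => k p.1.1 p.2 * H p.2 p.1.1 p.1.2 := by
    have : Measurable fun p : (ℝ × ℝ) × α => k p.1.1 p.2 :=
      hk.comp (by fun_prop : Measurable fun p : (ℝ × ℝ) × α => (p.1.1, p.2))
    exact this.mul hH
  -- K is introduced opaquely, so that the spatial integral is handled as one function of (ρ, r).
  obtain ⟨K, hK⟩ : ∃ K : ℝ → ℝ → ℝ≥0∞, K = fun ρ r => ∫⁻ y, k ρ y * H y ρ r ∂μ := ⟨_, rfl⟩
  have mK : Measurable fun p : ℝ × ℝ => K p.1 p.2 := by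
    rw [hK]; exact mk.lintegral_prod_right'
  have e1 : ∀ ρ, ∫⁻ y, k ρ y * (∫⁻ r, b r * H y ρ r) ∂μ = ∫⁻ r, b r * K ρ r := by
    intro ρ
    have mH : ∀ y, Measurable fun r => b r * H y ρ r := by
      intro y
      have : Measurable fun r => H y ρ r :=
        hH.comp (by fun_prop : Measurable fun r : ℝ => ((ρ, r), y))
      exact hb.mul this
    simp_rw [← lintegral_const_mul _ (mH _)]
    rw [lintegral_lintegral_swap]
    · refine lintegral_congr fun r => ?_
      have : Measurable fun y => k ρ y * H y ρ r :=
        mk.comp (by fun_prop : Measurable fun y : α => ((ρ, r), y))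
      rw [hK]
      dsimp only
      rw [← lintegral_const_mul _ this]
      exact lintegral_congr fun y => by ring
    · have m1 : Measurable fun p : α × ℝ => k ρ p.1 :=
        hk.comp (by fun_prop : Measurable fun p : α × ℝ => (ρ, p.1))
      have m2 : Measurable fun p : α × ℝ => H p.1 ρ p.2 :=
        hH.comp (by fun_prop : Measurable fun p : α × ℝ => ((ρ, p.2), p.1))
      exact (m1.mul ((hb.comp measurable_snd).mul m2)).aemeasurable
  have mK1 : ∀ ρ, Measurable fun r => b r * K ρ r := fun ρ =>
    hb.mul (mK.comp (by fun_prop : Measurable fun r : ℝ => (ρ, r)))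
  simp_rw [e1, ← lintegral_const_mul _ (mK1 _)]
  have m3 : Measurable fun p : ℝ × ℝ => a p.1 * (b p.2 * K p.1 p.2) :=
    (ha.comp measurable_fst).mul ((hb.comp measurable_snd).mul mK)
  have m4 : Measurable fun p : ℝ × ℝ => a (p.1 - p.2) * b p.2 * K (p.1 - p.2) p.2 :=
    ((ha.comp (by fun_prop)).mul (hb.comp measurable_snd)).mul
      (mK.comp (by fun_prop : Measurable fun p : ℝ × ℝ => (p.1 - p.2, p.2)))
  have e2 : ∀ σ r, ∫⁻ y, k (σ - r) y * H y (σ - r) r ∂μ = K (σ - r) r := by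
    intro σ r; rw [hK]
  simp_rw [e2]
  rw [lintegral_lintegral_swap m3.aemeasurable,
    lintegral_lintegral_swap (f := fun σ r => a (σ - r) * b r * K (σ - r) r) m4.aemeasurable]
  refine lintegral_congr fun r => ?_
  rw [lintegral_sub_right_eq_self (fun ρ => a ρ * b r * K ρ r) r]
  simp_rw [mul_assoc]

/-- Fubini for a superposition of superpositions. -/
theorem lintegral_weighted_heatPot {n : ℕ} {a b : ℝ → ℝ≥0∞} (ha : Measurable a)
    (hb : Measurable b)
    {h : RSpace n → ℝ → ℝ≥0∞} (hh : Measurable fun p : RSpace n × ℝ => h p.1 p.2)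
    {χ : RSpace n → ℝ≥0∞} (hχ : Measurable χ) (x : RSpace n) (t : ℝ) :
    ∫⁻ ρ, a ρ * ∫⁻ y, ENNReal.ofReal (heatKer ρ (x - y)) * χ y * heatPot b h y (t - ρ) =
      ∫⁻ σ, ∫⁻ r, a (σ - r) * b r *
        ∫⁻ y, ENNReal.ofReal (heatKer (σ - r) (x - y)) * χ y * heatAvg h y (t - (σ - r)) r := by
  apply lintegral_lintegral_conv ha hb
    (k := fun ρ y => ENNReal.ofReal (heatKer ρ (x - y)) * χ y)
    (H := fun y ρ r => heatAvg h y (t - ρ) r)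
  · exact (measurable_heatKer (by fun_prop) (by fun_prop)).ennreal_ofReal.mul
      (hχ.comp measurable_snd)
  · exact measurable_heatAvg hh (by fun_prop) (by fun_prop) (by fun_prop)

/-- The semigroup law at each pair of lags. Both densities must vanish on (-∞,0], because the heat
kernels compose only at positive times. -/
theorem heatPot_heatPot {n : ℕ} {a b : ℝ → ℝ≥0∞} (ha : Measurable a) (hb : Measurable b)
    (ha0 : ∀ ρ ≤ 0, a ρ = 0) (hb0 : ∀ ρ ≤ 0, b ρ = 0)
    {h : RSpace n → ℝ → ℝ≥0∞} (hh : Measurable fun p : RSpace n × ℝ => h p.1 p.2)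
    (x : RSpace n) (t : ℝ) :
    heatPot a (heatPot b h) x t = heatPot (lconv a b) h x t := by
  have h1 := lintegral_weighted_heatPot ha hb hh (χ := fun _ => 1) measurable_const x t
  simp only [mul_one] at h1
  have : heatPot a (heatPot b h) x t = _ := h1
  rw [this, heatPot]
  congr 1
  ext σ
  have m : Measurable fun r => a (σ - r) * b r := (ha.comp (by fun_prop)).mul hb
  rw [lconv, ← lintegral_mul_const _ m]
  congr 1
  ext r
  rcases le_or_gt r 0 with hr | hr
  · simp [hb0 r hr]
  rcases le_or_gt (σ - r) 0 with hq | hq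
  · simp [ha0 _ hq]
  rw [lintegral_heatKer_mul_heatAvg_one hh hq hr, sub_add_cancel]

/-! ### Slow growth: finiteness of tails and of truncated operators -/

/-- The part of the `ℒ^{2s,s}`-norm seen by the kernel of the fractional heat operator away from
its singularity. -/
noncomputable def tailPot {n : ℕ} (s δ : ℝ) (h : RSpace n → ℝ → ℝ≥0∞) (x : RSpace n) (t : ℝ) :
    ℝ≥0∞ :=
  ∫⁻ σ, ∫⁻ z, if 0 < σ ∧ δ ≤ ‖x - z‖ ^ 2 + σ then
    ENNReal.ofReal (σ ^ (-((n : ℝ) / 2 + 1 + s)) * Real.exp (-‖x - z‖ ^ 2 / (8 * σ))) *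
      h z (t - σ) else 0

theorem measurable_tailPot_integrand {n : ℕ} (s δ : ℝ) {h : RSpace n → ℝ → ℝ≥0∞}
    (hh : Measurable fun p : RSpace n × ℝ => h p.1 p.2) (x : RSpace n) (t : ℝ) :
    Measurable fun p : ℝ × RSpace n => if 0 < p.1 ∧ δ ≤ ‖x - p.2‖ ^ 2 + p.1 then
    ENNReal.ofReal (p.1 ^ (-((n : ℝ) / 2 + 1 + s)) * Real.exp (-‖x - p.2‖ ^ 2 / (8 * p.1))) *
      h p.2 (t - p.1) else 0 := by
  have hS : MeasurableSet {p : ℝ × RSpace n | 0 < p.1 ∧ δ ≤ ‖x - p.2‖ ^ 2 + p.1} :=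
    (measurableSet_lt measurable_const measurable_fst).inter
      (measurableSet_le (f := fun _ => δ) (g := fun p : ℝ × RSpace n => ‖x - p.2‖ ^ 2 + p.1)
        measurable_const (by fun_prop))
  refine Measurable.ite hS ?_ measurable_const
  · apply Measurable.mul
    · fun_prop
    · exact measurable_uncurry_comp hh (by fun_prop) (by fun_prop)

theorem SlowlyIncreasing.lintegral_ne_top {n : ℕ} {s : ℝ} {u : RSpace n → ℝ → ℝ}
    (hu : SlowlyIncreasing s u) (hc : Continuous fun p : RSpace n × ℝ => u p.1 p.2) :
    ∫⁻ τ, ∫⁻ z, ENNReal.ofReal (growthWeight s z τ)⁻¹ * ENNReal.ofReal (u z τ) ≠ ∞ := by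
  have h1 := hu.2.lintegral_lt_top
  have h2 : ∀ p : RSpace n × ℝ, ENNReal.ofReal (growthWeight s p.1 p.2)⁻¹ *
      ENNReal.ofReal (u p.1 p.2) ≤ ENNReal.ofReal (|u p.1 p.2| /
        (1 + ‖p.1‖ ^ ((n : ℝ) + 2 + 2 * s) + |p.2| ^ ((n : ℝ) / 2 + 1 + s))) := by
    intro p
    have := growthWeight_pos s p.1 p.2
    rw [← ENNReal.ofReal_mul (by positivity), inv_mul_eq_div]
    apply ENNReal.ofReal_le_ofReal
    exact div_le_div_of_nonneg_right (le_abs_self _) this.le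
  have mw : Measurable fun p : RSpace n × ℝ => growthWeight s p.1 p.2 := by
    unfold growthWeight; fun_prop
  have h3 : Measurable fun p : RSpace n × ℝ => ENNReal.ofReal (growthWeight s p.1 p.2)⁻¹ *
      ENNReal.ofReal (u p.1 p.2) :=
    mw.inv.ennreal_ofReal.mul hc.measurable.ennreal_ofReal
  have h4 := lintegral_prod_symm _ h3.aemeasurable (μ := (volume : Measure (RSpace n)))
    (ν := (volume : Measure ℝ))
  dsimp only at h4
  rw [← h4]
  exact ((lintegral_mono h2).trans_lt h1).ne

/-- The kernel is dominated by the inverse weight at (z, t-σ), uniformly for (x,t) in a bounded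
cylinder, and the substitution τ = t - σ yields the weighted norm of u. The uniformity leads to the
locally uniform limit in `fracHeat_approx`. -/
theorem SlowlyIncreasing.tailPot_le {n : ℕ} {s : ℝ} (hs : 0 < s) {u : RSpace n → ℝ → ℝ}
    (hu : SlowlyIncreasing s u) (hc : Continuous fun p : RSpace n × ℝ => u p.1 p.2)
    {R δ : ℝ} (hR : 0 ≤ R) (hδ : 0 < δ) :
    ∃ C : ℝ, 0 ≤ C ∧ ∀ (x : RSpace n) (t : ℝ), ‖x‖ ≤ R → |t| ≤ R →
      tailPot s δ (fun z τ => ENNReal.ofReal (u z τ)) x t ≤ ENNReal.ofReal C := by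
  obtain ⟨C, hC0, hC⟩ := exists_gaussian_le_weight (n := n) hs hR hδ
  have hfin := hu.lintegral_ne_top hc
  set S := ∫⁻ τ, ∫⁻ z, ENNReal.ofReal (growthWeight s z τ)⁻¹ * ENNReal.ofReal (u z τ) with hS
  refine ⟨(ENNReal.ofReal C * S).toReal, ENNReal.toReal_nonneg, fun x t hx ht => ?_⟩
  rw [ENNReal.ofReal_toReal (ENNReal.mul_ne_top ENNReal.ofReal_ne_top hfin), hS,
    ← lintegral_sub_left_eq_self _ t, ← lintegral_const_mul' _ _ ENNReal.ofReal_ne_top]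
  refine lintegral_mono fun σ => ?_
  rw [← lintegral_const_mul' _ _ ENNReal.ofReal_ne_top]
  refine lintegral_mono fun z => ?_
  split_ifs with h
  · rw [← mul_assoc, ← ENNReal.ofReal_mul hC0.le]
    exact mul_le_mul' (ENNReal.ofReal_le_ofReal (hC x z t σ hx ht h.1 h.2)) le_rfl
  · exact zero_le

/-- At distance at least 1 half of the exponent is worth a factor 8σ, so the far part of a short lag
interval (0,ε) contributes O(ε). -/
theorem heatKer_mul_rpow_le_far {n : ℕ} {s : ℝ} {σ : ℝ} (hσ : 0 < σ) {z : RSpace n}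
    (hz : 1 ≤ ‖z‖) :
    heatKer σ z * σ ^ (-1 - s) ≤
      8 * σ * (σ ^ (-((n : ℝ) / 2 + 1 + s)) * Real.exp (-‖z‖ ^ 2 / (8 * σ))) := by
  unfold heatKer
  have h1 : (4 * Real.pi * σ) ^ (-((n : ℝ) / 2)) ≤ σ ^ (-((n : ℝ) / 2)) := by
    apply Real.rpow_le_rpow_of_nonpos hσ _ (by simp; positivity)
    nlinarith [Real.pi_gt_three]
  have h2 : Real.exp (-‖z‖ ^ 2 / (4 * σ)) ≤ 8 * σ * Real.exp (-‖z‖ ^ 2 / (8 * σ)) := by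
    have e : Real.exp (-‖z‖ ^ 2 / (4 * σ)) =
        Real.exp (-‖z‖ ^ 2 / (8 * σ)) * Real.exp (-‖z‖ ^ 2 / (8 * σ)) := by
      rw [← Real.exp_add]; congr 1; ring
    rw [e]
    gcongr
    have h3 : 1 / (8 * σ) ≤ ‖z‖ ^ 2 / (8 * σ) := by
      gcongr; nlinarith
    have h4 := Real.add_one_le_exp (‖z‖ ^ 2 / (8 * σ))
    have h5 : 1 / (8 * σ) ≤ Real.exp (‖z‖ ^ 2 / (8 * σ)) := by linarith
    rw [neg_div, Real.exp_neg]
    rw [div_le_iff₀ (by positivity)] at h5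
    rw [inv_le_iff_one_le_mul₀ (Real.exp_pos _)]
    linarith
  calc _ ≤ σ ^ (-((n : ℝ) / 2)) * (8 * σ * Real.exp (-‖z‖ ^ 2 / (8 * σ))) * σ ^ (-1 - s) := by
        gcongr
    _ = 8 * σ * ((σ ^ (-((n : ℝ) / 2)) * σ ^ (-1 - s)) * Real.exp (-‖z‖ ^ 2 / (8 * σ))) := by ring
    _ = _ := by rw [← Real.rpow_add hσ]; congr 3; ring

theorem heatPot_levyW_le {n : ℕ} {s : ℝ} (hs0 : 0 < s) (hs1 : s < 1) {ε : ℝ} (hε : 0 < ε)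
    (h : RSpace n → ℝ → ℝ≥0∞) (x : RSpace n) (t : ℝ) :
    heatPot (levyW s ε) h x t ≤
      ENNReal.ofReal (s / Real.Gamma (1 - s)) * tailPot s ε h x t := by
  have hG2 := Real.Gamma_pos_of_pos (sub_pos.2 hs1)
  unfold heatPot tailPot
  rw [← lintegral_const_mul' _ _ ENNReal.ofReal_ne_top]
  refine lintegral_mono fun σ => ?_
  rcases le_or_gt σ ε with h1 | h1
  · simp [levyW, not_lt.2 h1]
  have hσ : 0 < σ := hε.trans h1
  rw [levyW, if_pos h1, heatAvg, ← lintegral_const_mul' _ _ ENNReal.ofReal_ne_top,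
    ← lintegral_const_mul' _ _ ENNReal.ofReal_ne_top]
  refine lintegral_mono fun z => ?_
  have h2 : 0 < σ ∧ ε ≤ ‖x - z‖ ^ 2 + σ := ⟨hσ, by nlinarith [sq_nonneg ‖x - z‖]⟩
  dsimp only
  rw [if_pos h2, ← mul_assoc, ← mul_assoc, ← ENNReal.ofReal_mul (by positivity),
    ← ENNReal.ofReal_mul (by positivity)]
  refine mul_le_mul' (ENNReal.ofReal_le_ofReal ?_) le_rfl
  rw [mul_assoc, mul_comm (σ ^ (-1 - s))]
  exact mul_le_mul_of_nonneg_left (heatKer_mul_rpow_le hσ _) (by positivity)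

theorem SlowlyIncreasing.heatPot_levyW_ne_top {n : ℕ} {s : ℝ} (hs0 : 0 < s) (hs1 : s < 1)
    {u : RSpace n → ℝ → ℝ}
    (hu : SlowlyIncreasing s u) (hc : Continuous fun p : RSpace n × ℝ => u p.1 p.2)
    {ε : ℝ} (hε : 0 < ε) (x : RSpace n) (t : ℝ) :
    heatPot (levyW s ε) (fun z τ => ENNReal.ofReal (u z τ)) x t ≠ ∞ := by
  obtain ⟨C, _, hC⟩ := hu.tailPot_le hs0 hc (R := max ‖x‖ |t|) (by positivity) hε
  refine ne_top_of_le_ne_top ?_ (heatPot_levyW_le hs0 hs1 hε _ x t)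
  refine ENNReal.mul_ne_top ENNReal.ofReal_ne_top (ne_top_of_le_ne_top ENNReal.ofReal_ne_top
    (hC x t (le_max_left _ _) (le_max_right _ _)))

theorem measurable_toENNReal {n : ℕ} {u : RSpace n → ℝ → ℝ}
    (hc : Continuous fun p : RSpace n × ℝ => u p.1 p.2) :
    Measurable fun p : RSpace n × ℝ => (fun z τ => ENNReal.ofReal (u z τ)) p.1 p.2 :=
  hc.measurable.ennreal_ofReal

/-- Each truncated Lévy potential of u is finite, hence so is the heat average at almost every lag
beyond the truncation; the truncations 1/(k+1) exhaust (0,∞). Finiteness at every lag is not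
claimed, which fits the almost-everywhere condition in `HasFracHeatAt`. -/
theorem SlowlyIncreasing.ae_heatAvg_ne_top {n : ℕ} {s : ℝ} (hs0 : 0 < s) (hs1 : s < 1)
    {u : RSpace n → ℝ → ℝ}
    (hu : SlowlyIncreasing s u) (hc : Continuous fun p : RSpace n × ℝ => u p.1 p.2)
    (x : RSpace n) (t : ℝ) :
    ∀ᵐ σ, 0 < σ → heatAvg (fun z τ => ENNReal.ofReal (u z τ)) x t σ ≠ ∞ := by
  have hG2 := Real.Gamma_pos_of_pos (sub_pos.2 hs1)
  have hm := measurable_toENNReal hc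
  have h : ∀ k : ℕ, ∀ᵐ σ, 1 / ((k : ℝ) + 1) < σ →
      heatAvg (fun z τ => ENNReal.ofReal (u z τ)) x t σ ≠ ∞ := by
    intro k
    have hk : 0 < 1 / ((k : ℝ) + 1) := Nat.one_div_pos_of_nat
    have h1 := hu.heatPot_levyW_ne_top hs0 hs1 hc hk x t
    have m : Measurable fun σ => levyW s (1 / ((k : ℝ) + 1)) σ *
        heatAvg (fun z τ => ENNReal.ofReal (u z τ)) x t σ :=
      (measurable_levyW _ _).mul (measurable_heatAvg hm measurable_const measurable_const
        measurable_id)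
    filter_upwards [ae_lt_top m h1] with σ h2 h3 h4
    have h0 : 0 < σ := hk.trans h3
    rw [h4, levyW, if_pos h3, ENNReal.mul_top] at h2
    · exact lt_irrefl _ h2
    · have : 0 < s / Real.Gamma (1 - s) * σ ^ (-1 - s) := by positivity
      simpa using this
  filter_upwards [ae_all_iff.2 h] with σ h1 h2
  obtain ⟨k, hk⟩ := exists_nat_one_div_lt h2
  exact h1 k hk

/-! ### The fractional operator in semigroup form -/

/-- Evenness of the kernel turns the difference with the heat average into half a second difference,
which is what the Hölder class controls to an order above 2s even when first-order terms are too
large. -/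
theorem ofReal_abs_sub_heatAvg_le {n : ℕ} {u : RSpace n → ℝ → ℝ}
    (hc : Continuous fun p : RSpace n × ℝ => u p.1 p.2) (hpos : ∀ x t, 0 < u x t)
    (x : RSpace n) (t : ℝ) {σ : ℝ} (hσ : 0 < σ)
    (hfin : heatAvg (fun z τ => ENNReal.ofReal (u z τ)) x t σ ≠ ∞) :
    ENNReal.ofReal |u x t - (heatAvg (fun z τ => ENNReal.ofReal (u z τ)) x t σ).toReal| ≤
      ∫⁻ w, ENNReal.ofReal (heatKer σ w *
        (|u (x + w) (t - σ) + u (x - w) (t - σ) - 2 * u x t| / 2)) := by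
  have hcz : Continuous fun z => u z (t - σ) := hc.comp (continuous_id.prodMk continuous_const)
  have hk := fun w : RSpace n => (heatKer_pos hσ w).le
  have mk : Measurable fun w : RSpace n => heatKer σ w :=
    measurable_heatKer measurable_const measurable_id
  have e1 : heatAvg (fun z τ => ENNReal.ofReal (u z τ)) x t σ =
      ∫⁻ w, ENNReal.ofReal (heatKer σ w * u (x - w) (t - σ)) := by
    unfold heatAvg
    rw [← lintegral_sub_left_eq_self _ x]
    refine lintegral_congr fun w => ?_
    rw [sub_sub_cancel, ENNReal.ofReal_mul (hk w)]
  have m1 : Measurable fun w => heatKer σ w * u (x - w) (t - σ) :=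
    mk.mul (hcz.measurable.comp (by fun_prop))
  have i1 : Integrable fun w => heatKer σ w * u (x - w) (t - σ) := by
    refine ⟨m1.aestronglyMeasurable, ?_⟩
    rw [hasFiniteIntegral_iff_ofReal (ae_of_all _ fun w => mul_nonneg (hk w) (hpos _ _).le), ← e1]
    exact lt_top_iff_ne_top.2 hfin
  have i2 : Integrable fun w => heatKer σ w * u (x + w) (t - σ) := by
    have := i1.comp_neg
    simpa [heatKer_neg] using this
  have e2 : (heatAvg (fun z τ => ENNReal.ofReal (u z τ)) x t σ).toReal =
      ∫ w, heatKer σ w * u (x - w) (t - σ) := by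
    rw [e1, integral_eq_lintegral_of_nonneg_ae
      (ae_of_all _ fun w => mul_nonneg (hk w) (hpos _ _).le) m1.aestronglyMeasurable]
  have e3 : ∫ w, heatKer σ w * u (x - w) (t - σ) = ∫ w, heatKer σ w * u (x + w) (t - σ) := by
    rw [← integral_neg_eq_self]
    simp [heatKer_neg]
  have i0 := (integrable_heatKer (n := n) hσ).mul_const (u x t)
  have e4 : u x t - ∫ w, heatKer σ w * u (x - w) (t - σ) =
      ∫ w, -(heatKer σ w * ((u (x + w) (t - σ) + u (x - w) (t - σ) - 2 * u x t) / 2)) := by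
    have : ∀ w, -(heatKer σ w * ((u (x + w) (t - σ) + u (x - w) (t - σ) - 2 * u x t) / 2)) =
        heatKer σ w * u x t - ((heatKer σ w * u (x + w) (t - σ)) / 2 +
          (heatKer σ w * u (x - w) (t - σ)) / 2) := by
      intro w; ring
    have i3 : Integrable fun w => (heatKer σ w * u (x + w) (t - σ)) / 2 +
        (heatKer σ w * u (x - w) (t - σ)) / 2 := (i2.div_const 2).add (i1.div_const 2)
    simp_rw [this]
    rw [integral_sub i0 i3,
      integral_add (i2.div_const 2) (i1.div_const 2), integral_div, integral_div, ← e3,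
      integral_mul_const, integral_heatKer hσ]
    ring
  rw [e2, e4, ← Real.norm_eq_abs, ofReal_norm]
  refine (enorm_integral_le_lintegral_enorm _).trans (le_of_eq ?_)
  refine lintegral_congr fun w => ?_
  rw [← ofReal_norm, norm_neg, norm_mul, Real.norm_of_nonneg (hk w), norm_div, Real.norm_eq_abs,
    Real.norm_two]

theorem lintegral_Ioo_rpow {p ε : ℝ} (hp : -1 < p) (hε : 0 ≤ ε) :
    ∫⁻ σ in Ioo 0 ε, ENNReal.ofReal (σ ^ p) = ENNReal.ofReal (ε ^ (p + 1) / (p + 1)) := by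
  have hp1 : 0 < p + 1 := by linarith
  rw [lintegral_Ioo_of_hasDerivAt (g := fun ρ => ρ ^ (p + 1) / (p + 1)) hε]
  · simp [Real.zero_rpow hp1.ne']
  · intro r _
    exact ((Real.continuousAt_rpow_const _ _ (Or.inr hp1.le)).div_const _).continuousWithinAt
  · intro r hr
    refine ((Real.hasDerivAt_rpow_const (p := p + 1) (Or.inl hr.1.ne')).div_const
      (p + 1)).congr_deriv ?_
    rw [add_sub_cancel_right]
    field_simp
  · intro r hr
    have := hr.1
    positivity

/-- Local uniform absolute convergence, near the singularity, of the integral in time that defines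
the fractional heat operator. -/
theorem lintegral_small_time_le {n : ℕ} {s : ℝ} (hs0 : 0 < s) (hs1 : s < 1) {α : ℝ} (hα : s < α)
    {u : RSpace n → ℝ → ℝ} (hreg : ParabolicHolderLoc α u) (hu : SlowlyIncreasing s u)
    (hpos : ∀ x t, 0 < u x t) {R : ℝ} (hR : 0 ≤ R) :
    ∃ C θ : ℝ, 0 ≤ C ∧ 0 < θ ∧ ∀ (x : RSpace n) (t ε : ℝ), ‖x‖ ≤ R → |t| ≤ R → 0 < ε → ε ≤ 1 →
      ∫⁻ σ in Ioo 0 ε, ENNReal.ofReal (s / Real.Gamma (1 - s) * σ ^ (-1 - s) *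
        |u x t - (heatAvg (fun z τ => ENNReal.ofReal (u z τ)) x t σ).toReal|) ≤
        ENNReal.ofReal (C * ε ^ θ) := by
  have hG2 := Real.Gamma_pos_of_pos (sub_pos.2 hs1)
  have hc := hreg.continuous
  obtain ⟨β, hsβ, hβ1, hβ⟩ := hreg.second_diff hs0 hs1 hα
  obtain ⟨C, hC0, hC⟩ := hβ R
  obtain ⟨B, hB0, hB⟩ := hreg.bounded R
  obtain ⟨D, hD0, hD⟩ := hu.tailPot_le hs0 hc hR one_pos
  set K : ℝ := 8 * 2 ^ ((n : ℝ) / 2) with hK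
  set c : ℝ := s / Real.Gamma (1 - s) with hcdef
  have hc0 : 0 < c := by positivity
  -- C(1+K) comes from the second difference at distances below 1, and BK from the value u(x,t)
  -- integrated against the kernel beyond distance 1.
  set A : ℝ := C * (1 + K) + B * K with hA
  have hA0 : 0 ≤ A := by positivity
  refine ⟨c * (2 * A) / (β - s) + 8 * D * c, β - s, ?_, by linarith, ?_⟩
  · have : 0 < β - s := by linarith
    positivity
  intro x t ε hx ht hε0 hε1
  set U : RSpace n → ℝ → ℝ≥0∞ := fun z τ => ENNReal.ofReal (u z τ) with hU
  -- the tail at unit distance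
  set tl : ℝ → ℝ≥0∞ := fun σ => ∫⁻ z, if 0 < σ ∧ 1 ≤ ‖x - z‖ ^ 2 + σ then
    ENNReal.ofReal (σ ^ (-((n : ℝ) / 2 + 1 + s)) * Real.exp (-‖x - z‖ ^ 2 / (8 * σ))) *
      U z (t - σ) else 0 with htl
  have mtl : Measurable tl :=
    (measurable_tailPot_integrand s 1 (measurable_toENNReal hc) x t).lintegral_prod_right'
  have htail : ∫⁻ σ, tl σ ≤ ENNReal.ofReal D := hD x t hx ht
  have main : ∀ᵐ σ, σ ∈ Ioo 0 ε → ENNReal.ofReal (c * σ ^ (-1 - s) *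
        |u x t - (heatAvg U x t σ).toReal|) ≤
      ENNReal.ofReal (c * (2 * A)) * ENNReal.ofReal (σ ^ (β - 1 - s)) +
        ENNReal.ofReal (8 * ε * c) * tl σ := by
    filter_upwards [hu.ae_heatAvg_ne_top hs0 hs1 hc x t] with σ hfin hσ
    have hσ0 : 0 < σ := hσ.1
    have hσ1 : σ ≤ 1 := hσ.2.le.trans hε1
    have hσβ : σ ≤ σ ^ β := Real.self_le_rpow_of_le_one hσ0.le hσ1 hβ1
    set F : RSpace n → ℝ≥0∞ := fun w => if 1 ≤ ‖w‖ then
      ENNReal.ofReal (heatKer σ w) * U (x - w) (t - σ) else 0 with hF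
    have mk : ∀ r : ℝ, Measurable fun w : RSpace n => heatKer r w :=
      fun r => measurable_heatKer measurable_const measurable_id
    have mF : Measurable F :=
      Measurable.ite (measurableSet_le measurable_const (by fun_prop))
        ((mk σ).ennreal_ofReal.mul (measurable_uncurry_comp (measurable_toENNReal hc)
          (by fun_prop) measurable_const)) measurable_const
    -- For ‖w‖ < 1 this is the second difference estimate. For ‖w‖ ≥ 1 positivity bounds the second
    -- difference by the sum of its terms: the two outer values go into F, and u(x,t) is absorbed
    -- because the kernel there is at most Kσ times the kernel at time 2σ.
    have pt : ∀ w, ENNReal.ofReal (heatKer σ w *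
        (|u (x + w) (t - σ) + u (x - w) (t - σ) - 2 * u x t| / 2)) ≤
        ENNReal.ofReal (A * σ ^ β * (heatKer σ w + heatKer (2 * σ) w)) +
          (ENNReal.ofReal (1 / 2) * F w + ENNReal.ofReal (1 / 2) * F (-w)) := by
      intro w
      have hk1 := heatKer_pos hσ0 w
      have hk2 := heatKer_pos (by positivity : 0 < 2 * σ) w
      rcases lt_or_ge ‖w‖ 1 with hw | hw
      · refine le_trans (ENNReal.ofReal_le_ofReal ?_) le_self_add
        have h1 := hC x w t σ hx ht hw.le hσ0.le hσ1
        have h2 := rpow_mul_heatKer_le (hs0.trans hsβ).le hβ1 hσ0 w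
        rw [← hK] at h2
        have hsb : 0 ≤ σ ^ β := by positivity
        calc heatKer σ w * (|u (x + w) (t - σ) + u (x - w) (t - σ) - 2 * u x t| / 2)
            ≤ heatKer σ w * (C * (‖w‖ ^ (2 * β) + σ ^ β) / 2) := by gcongr
          _ = C / 2 * (‖w‖ ^ (2 * β) * heatKer σ w) + C / 2 * σ ^ β * heatKer σ w := by ring
          _ ≤ C / 2 * (σ ^ β * (heatKer σ w + K * heatKer (2 * σ) w)) +
              C / 2 * σ ^ β * heatKer σ w := by gcongr
          _ = σ ^ β * (C * heatKer σ w + C * K / 2 * heatKer (2 * σ) w) := by ring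
          _ ≤ σ ^ β * (A * heatKer σ w + A * heatKer (2 * σ) w) := by
              have hK0 : 0 < K := by positivity
              gcongr
              · rw [hA]; nlinarith [mul_nonneg hC0 hK0.le, mul_nonneg hB0 hK0.le]
              · rw [hA]; nlinarith [mul_nonneg hC0 hK0.le, mul_nonneg hB0 hK0.le]
          _ = _ := by ring
      · have hF1 : ENNReal.ofReal (1 / 2) * F w =
            ENNReal.ofReal (heatKer σ w * (u (x - w) (t - σ) / 2)) := by
          rw [hF]; dsimp only
          rw [if_pos hw, ← ENNReal.ofReal_mul hk1.le, ← ENNReal.ofReal_mul (by norm_num)]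
          congr 1; ring
        have hF2 : ENNReal.ofReal (1 / 2) * F (-w) =
            ENNReal.ofReal (heatKer σ w * (u (x + w) (t - σ) / 2)) := by
          rw [hF]; dsimp only
          rw [norm_neg, if_pos hw, heatKer_neg, ← ENNReal.ofReal_mul hk1.le,
            ← ENNReal.ofReal_mul (by norm_num), sub_neg_eq_add]
          congr 1; ring
        have hp1 := hpos (x - w) (t - σ)
        have hp2 := hpos (x + w) (t - σ)
        have hp0 := hpos x t
        rw [hF1, hF2, ← ENNReal.ofReal_add (by positivity) (by positivity),
          ← ENNReal.ofReal_add (by positivity) (by positivity)]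
        apply ENNReal.ofReal_le_ofReal
        have h1 : |u (x + w) (t - σ) + u (x - w) (t - σ) - 2 * u x t| ≤
            u (x + w) (t - σ) + u (x - w) (t - σ) + 2 * u x t := by
          rw [abs_le]; constructor <;> linarith
        have h3 := sq_mul_heatKer_le hσ0 w
        rw [← hK] at h3
        have h4 : heatKer σ w ≤ K * σ * heatKer (2 * σ) w := by
          refine le_trans ?_ h3
          nlinarith [mul_nonneg hk1.le (by nlinarith : 0 ≤ ‖w‖ ^ 2 - 1)]
        have h5 : u x t ≤ B := (le_abs_self _).trans (hB x t hx ht)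
        have hK0 : 0 < K := by positivity
        have h6 : heatKer σ w * u x t ≤ A * σ ^ β * (heatKer σ w + heatKer (2 * σ) w) := by
          calc heatKer σ w * u x t ≤ (K * σ * heatKer (2 * σ) w) * B := by gcongr
            _ ≤ (K * σ ^ β * heatKer (2 * σ) w) * B := by gcongr
            _ = B * K * σ ^ β * heatKer (2 * σ) w := by ring
            _ ≤ A * σ ^ β * (heatKer σ w + heatKer (2 * σ) w) := by
              gcongr
              · rw [hA]; nlinarith [mul_nonneg hC0 hK0.le]
              · linarith
        have := mul_le_mul_of_nonneg_left h1 hk1.le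
        linarith
    have hint : ∫⁻ w : RSpace n, ENNReal.ofReal (A * σ ^ β * (heatKer σ w + heatKer (2 * σ) w)) =
        ENNReal.ofReal (2 * A * σ ^ β) := by
      have hsb : 0 ≤ A * σ ^ β := by positivity
      have : ∀ w : RSpace n, ENNReal.ofReal (A * σ ^ β * (heatKer σ w + heatKer (2 * σ) w)) =
          ENNReal.ofReal (A * σ ^ β) * (ENNReal.ofReal (heatKer σ w) +
            ENNReal.ofReal (heatKer (2 * σ) w)) := by
        intro w
        rw [ENNReal.ofReal_mul hsb, ENNReal.ofReal_add (heatKer_pos hσ0 w).le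
          (heatKer_pos (by positivity) w).le]
      simp_rw [this]
      rw [lintegral_const_mul' _ _ ENNReal.ofReal_ne_top,
        lintegral_add_left (mk σ).ennreal_ofReal, lintegral_heatKer hσ0,
        lintegral_heatKer (by positivity), show (1 : ℝ≥0∞) + 1 = ENNReal.ofReal 2 by norm_num,
        ← ENNReal.ofReal_mul hsb]
      congr 1; ring
    have hFneg : ∫⁻ w, F (-w) = ∫⁻ w, F w := lintegral_neg_eq_self F
    have hFtl : ENNReal.ofReal (c * σ ^ (-1 - s)) * ∫⁻ w, F w ≤
        ENNReal.ofReal (8 * ε * c) * tl σ := by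
      rw [← lintegral_sub_left_eq_self F x, ← lintegral_const_mul' _ _ ENNReal.ofReal_ne_top,
        htl]
      dsimp only
      rw [← lintegral_const_mul' _ _ ENNReal.ofReal_ne_top]
      refine lintegral_mono fun z => ?_
      rw [hF]; dsimp only
      split_ifs with h1 h2
      · rw [sub_sub_cancel, ← mul_assoc, ← mul_assoc,
          ← ENNReal.ofReal_mul (p := c * σ ^ (-1 - s)) (by positivity),
          ← ENNReal.ofReal_mul (p := 8 * ε * c) (by positivity)]
        refine mul_le_mul' (ENNReal.ofReal_le_ofReal ?_) le_rfl
        have h3 := heatKer_mul_rpow_le_far (s := s) hσ0 h1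
        calc c * σ ^ (-1 - s) * heatKer σ (x - z) = c * (heatKer σ (x - z) * σ ^ (-1 - s)) := by
              ring
          _ ≤ c * (8 * ε * (σ ^ (-((n : ℝ) / 2 + 1 + s)) *
              Real.exp (-‖x - z‖ ^ 2 / (8 * σ)))) := by
              refine mul_le_mul_of_nonneg_left (h3.trans ?_) hc0.le
              gcongr
              exact hσ.2.le
          _ = _ := by ring
      · exfalso
        exact h2 ⟨hσ0, by nlinarith⟩
      · simp
      · simp
    have h1 := (ofReal_abs_sub_heatAvg_le hc hpos x t hσ0 (hfin hσ0)).trans (lintegral_mono pt)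
    have mA : Measurable fun w : RSpace n =>
        ENNReal.ofReal (A * σ ^ β * (heatKer σ w + heatKer (2 * σ) w)) :=
      (((mk σ).add (mk (2 * σ))).const_mul _).ennreal_ofReal
    rw [lintegral_add_left mA, lintegral_add_left (mF.const_mul _),
      lintegral_const_mul' _ _ ENNReal.ofReal_ne_top,
      lintegral_const_mul' _ _ ENNReal.ofReal_ne_top, hFneg, hint, ← add_mul,
      ← ENNReal.ofReal_add (by norm_num) (by norm_num), add_halves, ENNReal.ofReal_one,
      one_mul] at h1
    calc ENNReal.ofReal (c * σ ^ (-1 - s) * |u x t - (heatAvg U x t σ).toReal|)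
        = ENNReal.ofReal (c * σ ^ (-1 - s)) *
          ENNReal.ofReal |u x t - (heatAvg U x t σ).toReal| := ENNReal.ofReal_mul (by positivity)
      _ ≤ ENNReal.ofReal (c * σ ^ (-1 - s)) * (ENNReal.ofReal (2 * A * σ ^ β) + ∫⁻ w, F w) := by
          gcongr
      _ = ENNReal.ofReal (c * σ ^ (-1 - s)) * ENNReal.ofReal (2 * A * σ ^ β) +
          ENNReal.ofReal (c * σ ^ (-1 - s)) * ∫⁻ w, F w := by rw [mul_add]
      _ ≤ _ := by
          refine add_le_add ?_ hFtl
          rw [← ENNReal.ofReal_mul (by positivity), ← ENNReal.ofReal_mul (by positivity),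
            show β - 1 - s = (-1 - s) + β by ring, Real.rpow_add hσ0]
          apply ENNReal.ofReal_le_ofReal
          apply le_of_eq; ring
  have hβs : 0 < β - s := by linarith
  calc _ ≤ ∫⁻ σ in Ioo 0 ε, (ENNReal.ofReal (c * (2 * A)) * ENNReal.ofReal (σ ^ (β - 1 - s)) +
        ENNReal.ofReal (8 * ε * c) * tl σ) :=
        lintegral_mono_ae ((ae_restrict_iff' measurableSet_Ioo).2 main)
    _ = ENNReal.ofReal (c * (2 * A)) * ENNReal.ofReal (ε ^ (β - s) / (β - s)) +
        ENNReal.ofReal (8 * ε * c) * ∫⁻ σ in Ioo 0 ε, tl σ := by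
        rw [lintegral_add_right _ (mtl.const_mul _), lintegral_const_mul' _ _ ENNReal.ofReal_ne_top,
          lintegral_const_mul' _ _ ENNReal.ofReal_ne_top, lintegral_Ioo_rpow (by linarith) hε0.le,
          show β - 1 - s + 1 = β - s by ring]
    _ ≤ ENNReal.ofReal (c * (2 * A)) * ENNReal.ofReal (ε ^ (β - s) / (β - s)) +
        ENNReal.ofReal (8 * ε * c) * ENNReal.ofReal D := by
        gcongr
        exact (setLIntegral_le_lintegral _ _).trans htail
    _ ≤ _ := by
        rw [← ENNReal.ofReal_mul (by positivity), ← ENNReal.ofReal_mul (by positivity),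
          ← ENNReal.ofReal_add (by positivity) (by positivity)]
        apply ENNReal.ofReal_le_ofReal
        have : ε ≤ ε ^ (β - s) := Real.self_le_rpow_of_le_one hε0.le hε1 (by linarith)
        have h2 : 8 * ε * c * D ≤ 8 * ε ^ (β - s) * c * D := by gcongr
        calc _ ≤ c * (2 * A) * (ε ^ (β - s) / (β - s)) + 8 * ε ^ (β - s) * c * D := by gcongr
          _ = _ := by ring

/-- Removing shrinking balls is dominated convergence. The dimension is positive so that the centre
is a null set; it is the only point never recovered. -/
theorem hasPrincipalValue_integral {n : ℕ} (hn : 1 ≤ n) {F : RSpace n → ℝ} (hF : Integrable F)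
    (x : RSpace n) : HasPrincipalValue F x (∫ y, F y) := by
  have : NeZero n := ⟨by omega⟩
  refine ⟨fun δ _ => hF.integrableOn, ?_⟩
  have h : ∀ δ : ℝ, ∫ y in (Metric.ball x δ)ᶜ, F y = ∫ y, (Metric.ball x δ)ᶜ.indicator F y :=
    fun δ => (integral_indicator Metric.isOpen_ball.measurableSet.compl).symm
  simp_rw [h]
  apply tendsto_integral_filter_of_dominated_convergence (fun y => ‖F y‖)
  · exact Eventually.of_forall fun δ =>
      hF.aestronglyMeasurable.indicator Metric.isOpen_ball.measurableSet.compl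
  · exact Eventually.of_forall fun δ => ae_of_all _ fun y => norm_indicator_le_norm_self _ _
  · exact hF.norm
  · have hx : ∀ᵐ y : RSpace n, y ≠ x := by simp [ae_iff]
    filter_upwards [hx] with y hy
    apply tendsto_const_nhds.congr'
    have hd : 0 < dist y x := dist_pos.2 hy
    filter_upwards [Ioo_mem_nhdsGT hd] with δ hδ
    rw [indicator_of_mem]
    simp only [mem_compl_iff, Metric.mem_ball, not_lt]
    exact hδ.2.le

/-- The integrand in time of the fractional heat operator. -/
noncomputable def fracIntegrand {n : ℕ} (s : ℝ) (u : RSpace n → ℝ → ℝ) (x : RSpace n) (t σ : ℝ) :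
    ℝ :=
  s / Real.Gamma (1 - s) * σ ^ (-1 - s) *
    (u x t - (heatAvg (fun z τ => ENNReal.ofReal (u z τ)) x t σ).toReal)

/-- The fractional heat operator, written with the heat semigroup. -/
noncomputable def fracHeat {n : ℕ} (s : ℝ) (u : RSpace n → ℝ → ℝ) (x : RSpace n) (t : ℝ) : ℝ :=
  ∫ σ in Ioi 0, fracIntegrand s u x t σ

theorem measurable_fracIntegrand {n : ℕ} {s : ℝ} {u : RSpace n → ℝ → ℝ}
    (hc : Continuous fun p : RSpace n × ℝ => u p.1 p.2) (x : RSpace n) (t : ℝ) :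
    Measurable fun σ => fracIntegrand s u x t σ := by
  have m : Measurable fun σ => heatAvg (fun z τ => ENNReal.ofReal (u z τ)) x t σ :=
    measurable_heatAvg (measurable_toENNReal hc) measurable_const measurable_const measurable_id
  unfold fracIntegrand
  exact Measurable.mul (by fun_prop) (measurable_const.sub m.ennreal_toReal)

theorem integrableOn_levy_mul_heatAvg {n : ℕ} {s : ℝ} (hs0 : 0 < s) (hs1 : s < 1)
    {u : RSpace n → ℝ → ℝ} (hu : SlowlyIncreasing s u)
    (hc : Continuous fun p : RSpace n × ℝ => u p.1 p.2) (x : RSpace n) (t : ℝ) {ε : ℝ}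
    (hε : 0 < ε) :
    IntegrableOn (fun σ => s / Real.Gamma (1 - s) * σ ^ (-1 - s) *
      (heatAvg (fun z τ => ENNReal.ofReal (u z τ)) x t σ).toReal) (Ioi ε) ∧
    ∫ σ in Ioi ε, s / Real.Gamma (1 - s) * σ ^ (-1 - s) *
      (heatAvg (fun z τ => ENNReal.ofReal (u z τ)) x t σ).toReal =
      (heatPot (levyW s ε) (fun z τ => ENNReal.ofReal (u z τ)) x t).toReal := by
  have hG2 := Real.Gamma_pos_of_pos (sub_pos.2 hs1)
  have hV := hu.heatPot_levyW_ne_top hs0 hs1 hc hε x t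
  have mT : Measurable fun σ => heatAvg (fun z τ => ENNReal.ofReal (u z τ)) x t σ :=
    measurable_heatAvg (measurable_toENNReal hc) measurable_const measurable_const measurable_id
  have m : Measurable fun σ => levyW s ε σ *
      heatAvg (fun z τ => ENNReal.ofReal (u z τ)) x t σ := (measurable_levyW s ε).mul mT
  have e : ∀ σ ∈ Ioi ε, s / Real.Gamma (1 - s) * σ ^ (-1 - s) *
      (heatAvg (fun z τ => ENNReal.ofReal (u z τ)) x t σ).toReal =
      (levyW s ε σ * heatAvg (fun z τ => ENNReal.ofReal (u z τ)) x t σ).toReal := by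
    intro σ hσ
    have h0 : 0 < σ := hε.trans hσ
    rw [levyW, if_pos (mem_Ioi.1 hσ), ENNReal.toReal_mul, ENNReal.toReal_ofReal (by positivity)]
  have hle : ∫⁻ σ in Ioi ε, levyW s ε σ * heatAvg (fun z τ => ENNReal.ofReal (u z τ)) x t σ =
      heatPot (levyW s ε) (fun z τ => ENNReal.ofReal (u z τ)) x t := by
    rw [heatPot, ← lintegral_indicator measurableSet_Ioi]
    refine lintegral_congr fun σ => ?_
    by_cases h : σ ∈ Ioi ε
    · rw [indicator_of_mem h]
    · rw [indicator_of_notMem h, levyW, if_neg (fun h' => h (mem_Ioi.2 h')), zero_mul]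
  constructor
  · rw [integrableOn_congr_fun e measurableSet_Ioi]
    apply integrable_toReal_of_lintegral_ne_top m.aemeasurable
    rw [hle]; exact hV
  · rw [setIntegral_congr_fun measurableSet_Ioi e, integral_toReal m.aemeasurable, hle]
    refine ae_lt_top m ?_
    rw [hle]; exact hV

theorem integral_fracIntegrand_Ioi {n : ℕ} {s : ℝ} (hs0 : 0 < s) (hs1 : s < 1)
    {u : RSpace n → ℝ → ℝ} (hu : SlowlyIncreasing s u)
    (hc : Continuous fun p : RSpace n × ℝ => u p.1 p.2) (x : RSpace n) (t : ℝ) {ε : ℝ}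
    (hε : 0 < ε) :
    IntegrableOn (fracIntegrand s u x t) (Ioi ε) ∧
    ∫ σ in Ioi ε, fracIntegrand s u x t σ = levyMass s ε * u x t -
      (heatPot (levyW s ε) (fun z τ => ENNReal.ofReal (u z τ)) x t).toReal := by
  have hG2 := Real.Gamma_pos_of_pos (sub_pos.2 hs1)
  obtain ⟨h1, h2⟩ := integrableOn_levy_mul_heatAvg hs0 hs1 hu hc x t hε
  have h3 : IntegrableOn (fun σ : ℝ => s / Real.Gamma (1 - s) * σ ^ (-1 - s) * u x t) (Ioi ε) :=
    ((integrableOn_Ioi_rpow_of_lt (by linarith) hε).const_mul _).mul_const _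
  have e : fracIntegrand s u x t = fun σ => s / Real.Gamma (1 - s) * σ ^ (-1 - s) * u x t -
      s / Real.Gamma (1 - s) * σ ^ (-1 - s) *
        (heatAvg (fun z τ => ENNReal.ofReal (u z τ)) x t σ).toReal := by
    ext σ; unfold fracIntegrand; ring
  rw [e]
  refine ⟨h3.sub h1, ?_⟩
  rw [integral_sub h3 h1, h2, integral_mul_const, integral_const_mul,
    integral_Ioi_rpow_of_lt (by linarith) hε, levyMass]
  congr 2
  rw [show -1 - s + 1 = -s by ring]
  field_simp

/-- The truncations of the fractional heat operator converge locally uniformly. -/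
theorem fracHeat_approx {n : ℕ} {s : ℝ} (hs0 : 0 < s) (hs1 : s < 1) {α : ℝ} (hα : s < α)
    {u : RSpace n → ℝ → ℝ} (hreg : ParabolicHolderLoc α u) (hu : SlowlyIncreasing s u)
    (hpos : ∀ x t, 0 < u x t) {R : ℝ} (hR : 0 ≤ R) :
    ∃ C θ : ℝ, 0 ≤ C ∧ 0 < θ ∧ ∀ (x : RSpace n) (t : ℝ), ‖x‖ ≤ R → |t| ≤ R →
      IntegrableOn (fracIntegrand s u x t) (Ioi 0) ∧ ∀ ε, 0 < ε → ε ≤ 1 →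
      |levyMass s ε * u x t - (heatPot (levyW s ε) (fun z τ => ENNReal.ofReal (u z τ)) x t).toReal -
        fracHeat s u x t| ≤ C * ε ^ θ := by
  have hG2 := Real.Gamma_pos_of_pos (sub_pos.2 hs1)
  have hc := hreg.continuous
  obtain ⟨C, θ, hC0, hθ, hC⟩ := lintegral_small_time_le hs0 hs1 hα hreg hu hpos hR
  refine ⟨C, θ, hC0, hθ, fun x t hx ht => ?_⟩
  have mJ := measurable_fracIntegrand (s := s) hc x t
  have hJ : ∀ ε, 0 < ε → ε ≤ 1 →
      ∫⁻ σ in Ioo 0 ε, ‖fracIntegrand s u x t σ‖ₑ ≤ ENNReal.ofReal (C * ε ^ θ) := by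
    intro ε h0 h1
    refine le_trans (le_of_eq ?_) (hC x t ε hx ht h0 h1)
    refine setLIntegral_congr_fun measurableSet_Ioo fun σ hσ => ?_
    have : 0 < σ := hσ.1
    rw [← ofReal_norm, fracIntegrand, norm_mul, Real.norm_of_nonneg (by positivity),
      Real.norm_eq_abs]
  have hI : ∀ ε, 0 < ε → ε ≤ 1 → IntegrableOn (fracIntegrand s u x t) (Ioc 0 ε) := by
    intro ε h0 h1
    rw [integrableOn_Ioc_iff_integrableOn_Ioo]
    exact ⟨mJ.aestronglyMeasurable, (hJ ε h0 h1).trans_lt ENNReal.ofReal_lt_top⟩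
  have hsplit : ∀ ε : ℝ, 0 < ε → Ioc 0 ε ∪ Ioi ε = Ioi 0 := fun ε h => Ioc_union_Ioi_eq_Ioi h.le
  have hint : IntegrableOn (fracIntegrand s u x t) (Ioi 0) := by
    rw [← hsplit 1 one_pos]
    exact (hI 1 one_pos le_rfl).union (integral_fracIntegrand_Ioi hs0 hs1 hu hc x t one_pos).1
  refine ⟨hint, fun ε h0 h1 => ?_⟩
  obtain ⟨h2, h3⟩ := integral_fracIntegrand_Ioi hs0 hs1 hu hc x t h0
  -- The truncation error is exactly the integral over (0, ε].
  have h4 : fracHeat s u x t = (∫ σ in Ioc 0 ε, fracIntegrand s u x t σ) +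
      ∫ σ in Ioi ε, fracIntegrand s u x t σ := by
    rw [fracHeat, ← hsplit ε h0]
    exact setIntegral_union (Ioc_disjoint_Ioi le_rfl) measurableSet_Ioi (hI ε h0 h1) h2
  rw [h4, h3, sub_add_cancel_right, abs_neg, integral_Ioc_eq_integral_Ioo]
  have h5 := enorm_integral_le_lintegral_enorm (μ := volume.restrict (Ioo 0 ε))
    (fracIntegrand s u x t)
  have h6 := h5.trans (hJ ε h0 h1)
  rw [← ofReal_norm, Real.norm_eq_abs] at h6
  exact (ENNReal.ofReal_le_ofReal_iff (by positivity)).1 h6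

theorem masterConst_eq {n : ℕ} {s : ℝ} (hs0 : 0 < s) (hs1 : s < 1) :
    masterConst n s * (4 * Real.pi) ^ ((n : ℝ) / 2) = s / Real.Gamma (1 - s) := by
  have hG2 := Real.Gamma_pos_of_pos (sub_pos.2 hs1)
  have h1 : Real.Gamma (1 - s) = -s * Real.Gamma (-s) := by
    have := Real.Gamma_add_one (neg_ne_zero.2 hs0.ne')
    rw [← this]; congr 1; ring
  have h2 : |Real.Gamma (-s)| = Real.Gamma (1 - s) / s := by
    have h3 : Real.Gamma (-s) = -(Real.Gamma (1 - s) / s) := by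
      rw [h1]; field_simp
    rw [h3, abs_neg, abs_of_pos (by positivity)]
  unfold masterConst
  rw [h2]
  have : 0 < (4 * Real.pi) ^ ((n : ℝ) / 2) := by positivity
  field_simp

theorem frac_kernel_eq {n : ℕ} {s σ : ℝ} (hσ : 0 < σ) (a : ℝ) (z : RSpace n) :
    a / σ ^ ((n : ℝ) / 2 + 1 + s) * Real.exp (-‖z‖ ^ 2 / (4 * σ)) =
      (4 * Real.pi) ^ ((n : ℝ) / 2) * σ ^ (-1 - s) * (heatKer σ z * a) := by
  unfold heatKer
  rw [Real.mul_rpow (by positivity) hσ.le, Real.rpow_neg (by positivity) ((n : ℝ) / 2),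
    Real.rpow_neg hσ.le ((n : ℝ) / 2), show -1 - s = -(1 + s) by ring, Real.rpow_neg hσ.le,
    add_assoc, Real.rpow_add hσ]
  have h1 : 0 < (4 * Real.pi) ^ ((n : ℝ) / 2) := by positivity
  have h2 : 0 < σ ^ ((n : ℝ) / 2) := by positivity
  have h3 : 0 < σ ^ (1 + s) := by positivity
  field_simp

theorem integral_heatKer_mul_sub {n : ℕ} {u : RSpace n → ℝ → ℝ}
    (hc : Continuous fun p : RSpace n × ℝ => u p.1 p.2) (hpos : ∀ x t, 0 < u x t)
    (x : RSpace n) (t : ℝ) {σ : ℝ} (hσ : 0 < σ)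
    (hfin : heatAvg (fun z τ => ENNReal.ofReal (u z τ)) x t σ ≠ ∞) :
    Integrable (fun y => heatKer σ (x - y) * (u x t - u y (t - σ))) ∧
    ∫ y, heatKer σ (x - y) * (u x t - u y (t - σ)) =
      u x t - (heatAvg (fun z τ => ENNReal.ofReal (u z τ)) x t σ).toReal := by
  have hk := fun w : RSpace n => (heatKer_pos hσ w).le
  have hcz : Continuous fun z => u z (t - σ) := hc.comp (continuous_id.prodMk continuous_const)
  have m1 : Measurable fun y => heatKer σ (x - y) * u y (t - σ) :=
    (measurable_heatKer measurable_const (by fun_prop)).mul hcz.measurable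
  have e1 : heatAvg (fun z τ => ENNReal.ofReal (u z τ)) x t σ =
      ∫⁻ y, ENNReal.ofReal (heatKer σ (x - y) * u y (t - σ)) :=
    lintegral_congr fun y => (ENNReal.ofReal_mul (hk _)).symm
  have i1 : Integrable fun y => heatKer σ (x - y) * u y (t - σ) := by
    refine ⟨m1.aestronglyMeasurable, ?_⟩
    rw [hasFiniteIntegral_iff_ofReal (ae_of_all _ fun w => mul_nonneg (hk _) (hpos _ _).le), ← e1]
    exact lt_top_iff_ne_top.2 hfin
  have i0 : Integrable fun y => heatKer σ (x - y) * u x t :=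
    ((integrable_heatKer hσ).comp_sub_left x).mul_const _
  simp_rw [mul_sub]
  refine ⟨i0.sub i1, ?_⟩
  rw [integral_sub i0 i1, integral_mul_const, integral_sub_left_eq_self (heatKer σ) volume x,
    integral_heatKer hσ, one_mul, e1, integral_eq_lintegral_of_nonneg_ae
      (ae_of_all _ fun w => mul_nonneg (hk _) (hpos _ _).le) m1.aestronglyMeasurable]

/-- The principal value definition agrees with the semigroup formula. -/
theorem hasFracHeatAt_iff {n : ℕ} (hn : 1 ≤ n) {s : ℝ} (hs0 : 0 < s) (hs1 : s < 1) {α : ℝ}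
    (hα : s < α) {u : RSpace n → ℝ → ℝ} (hreg : ParabolicHolderLoc α u)
    (hu : SlowlyIncreasing s u) (hpos : ∀ x t, 0 < u x t) (x : RSpace n) (t L : ℝ) :
    HasFracHeatAt s u x t L ↔ fracHeat s u x t = L := by
  have hG2 := Real.Gamma_pos_of_pos (sub_pos.2 hs1)
  have hc := hreg.continuous
  obtain ⟨_, _, _, _, hC⟩ := fracHeat_approx hs0 hs1 hα hreg hu hpos
    (R := max ‖x‖ |t|) (by positivity)
  have hint := (hC x t (le_max_left _ _) (le_max_right _ _)).1
  set P : ℝ := (4 * Real.pi) ^ ((n : ℝ) / 2) with hP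
  have hP0 : 0 < P := by positivity
  set c := s / Real.Gamma (1 - s) with hcdef
  have hc0 : 0 < c := by positivity
  -- P comes from passing from the bare Gaussian to the normalised heat kernel; c is divided out
  -- because `fracIntegrand` already contains it.
  set I₀ : ℝ → ℝ := fun τ => P / c * fracIntegrand s u x t (t - τ) with hI₀
  have hpv : ∀ᵐ τ : ℝ ∂(volume.restrict (Iio t)),
      HasPrincipalValue (fun y : RSpace n =>
        (u x t - u y τ) / (t - τ) ^ ((n : ℝ) / 2 + 1 + s)
          * Real.exp (-‖x - y‖ ^ 2 / (4 * (t - τ)))) x (I₀ τ) := by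
    rw [ae_restrict_iff' measurableSet_Iio]
    have h1 := hu.ae_heatAvg_ne_top hs0 hs1 hc x t
    have hqmp : Measure.QuasiMeasurePreserving (fun τ : ℝ => t - τ) volume volume :=
      (Measure.measurePreserving_sub_left volume t).quasiMeasurePreserving
    filter_upwards [hqmp.ae h1] with τ h2 hτ
    have hσ : 0 < t - τ := sub_pos.2 hτ
    obtain ⟨h3, h4⟩ := integral_heatKer_mul_sub hc hpos x t hσ (h2 hσ)
    simp_rw [frac_kernel_eq hσ]
    rw [sub_sub_cancel] at h3 h4
    have h5 := hasPrincipalValue_integral hn (h3.const_mul (P * (t - τ) ^ (-1 - s))) x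
    convert h5 using 1
    rw [integral_const_mul, h4, hI₀]
    unfold fracIntegrand
    rw [← hcdef]
    field_simp
  have hmp : MeasurePreserving (fun τ : ℝ => t - τ) volume volume :=
    Measure.measurePreserving_sub_left volume t
  have hemb : MeasurableEmbedding (fun τ : ℝ => t - τ) :=
    (MeasurableEquiv.subLeft t).measurableEmbedding
  have hpre : (fun τ : ℝ => t - τ) ⁻¹' Ioi 0 = Iio t := by
    ext τ; simp
  have hI₀int : IntegrableOn I₀ (Iio t) := by
    have := (hmp.integrableOn_comp_preimage hemb (f := fracIntegrand s u x t) (s := Ioi 0)).2 hint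
    rw [hpre] at this
    exact this.const_mul _
  have hval : masterConst n s * ∫ τ in Iio t, I₀ τ = fracHeat s u x t := by
    rw [hI₀, integral_const_mul]
    have := hmp.setIntegral_preimage_emb hemb (fracIntegrand s u x t) (Ioi 0)
    rw [hpre] at this
    rw [this, ← fracHeat, ← mul_assoc, mul_div_assoc', masterConst_eq hs0 hs1, ← hcdef,
      div_self hc0.ne', one_mul]
  constructor
  -- Principal values are limits, hence unique: every admissible I agrees almost everywhere with I₀.
  · rintro ⟨I, h1, h2, h3⟩
    have : ∫ τ in Iio t, I τ = ∫ τ in Iio t, I₀ τ := by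
      apply integral_congr_ae
      filter_upwards [h1, hpv] with τ h4 h5
      exact tendsto_nhds_unique h4.2 h5.2
    rw [← hval, ← this, h3]
  · intro h
    exact ⟨I₀, hpv, hI₀int, by rw [hval, h]⟩

/-! ### The defect kernels as a space-time approximate identity -/

/-- The part away from the singularity of the potential with density `σ^{s-2}`. -/
noncomputable def farPot {n : ℕ} (s η : ℝ) (h : RSpace n → ℝ → ℝ≥0∞) (x : RSpace n) (t : ℝ) :
    ℝ≥0∞ :=
  ∫⁻ σ, ∫⁻ y, if 0 < σ ∧ (η ≤ σ ∨ η ≤ ‖x - y‖) then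
    ENNReal.ofReal (heatKer σ (x - y) * σ ^ (s - 2)) * h y (t - σ) else 0

/-- Two applications of the ‖z‖² exchange yield σ², enough to cancel the singularity of σ^{s-2}. -/
theorem heatKer_le_of_far {n : ℕ} {η σ : ℝ} (hη : 0 < η) (hσ : 0 < σ) {z : RSpace n}
    (hz : η ≤ ‖z‖) :
    heatKer σ z ≤ 2 * (8 * 2 ^ ((n : ℝ) / 2)) ^ 2 / η ^ 4 * σ ^ 2 * heatKer (4 * σ) z := by
  have h1 := sq_mul_heatKer_le hσ z
  have h2 := sq_mul_heatKer_le (by positivity : 0 < 2 * σ) z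
  rw [show 2 * (2 * σ) = 4 * σ by ring] at h2
  set K : ℝ := 8 * 2 ^ ((n : ℝ) / 2) with hK
  have hK0 : 0 < K := by positivity
  have hk := heatKer_pos hσ z
  have h3 : η ^ 4 * heatKer σ z ≤ 2 * K ^ 2 * σ ^ 2 * heatKer (4 * σ) z := by
    calc η ^ 4 * heatKer σ z ≤ ‖z‖ ^ 4 * heatKer σ z := by gcongr
      _ = ‖z‖ ^ 2 * (‖z‖ ^ 2 * heatKer σ z) := by ring
      _ ≤ ‖z‖ ^ 2 * (K * σ * heatKer (2 * σ) z) := by gcongr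
      _ = K * σ * (‖z‖ ^ 2 * heatKer (2 * σ) z) := by ring
      _ ≤ K * σ * (K * (2 * σ) * heatKer (4 * σ) z) := by gcongr
      _ = _ := by ring
  calc heatKer σ z = (η ^ 4 * heatKer σ z) / η ^ 4 := by field_simp
    _ ≤ (2 * K ^ 2 * σ ^ 2 * heatKer (4 * σ) z) / η ^ 4 := by gcongr
    _ = _ := by ring

/-- If η ≤ σ, then σ^{s-2} ≤ η^{s-2}. If ‖x-y‖ ≥ η, the gained σ² leaves σ^s ≤ N^s. Either way what
remains is a multiple of heat kernels of mass 1 over a time interval of length N. -/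
theorem farPot_ne_top_of_bounded {n : ℕ} {s : ℝ} (hs0 : 0 < s) (hs1 : s < 1) {η N : ℝ}
    (hη : 0 < η) (hN : 0 < N) {h : RSpace n → ℝ → ℝ≥0∞} {B : ℝ} (hB : 0 ≤ B) (x : RSpace n) (t : ℝ)
    (hb : ∀ y σ, h y (t - σ) ≤ ENNReal.ofReal B) (h0 : ∀ y σ, N ≤ σ → h y (t - σ) = 0) :
    farPot s η h x t ≠ ∞ := by
  set K : ℝ := 2 * (8 * 2 ^ ((n : ℝ) / 2)) ^ 2 / η ^ 4 with hK
  have hK0 : 0 < K := by positivity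
  set C : ℝ := η ^ (s - 2) + K * N ^ s with hC
  have hC0 : 0 < C := by positivity
  have hle : farPot s η h x t ≤ ∫⁻ σ in Ioo 0 N, ENNReal.ofReal (C * B) * 2 := by
    rw [← lintegral_indicator measurableSet_Ioo]
    refine lintegral_mono fun σ => ?_
    by_cases hσ : σ ∈ Ioo 0 N
    · rw [indicator_of_mem hσ]
      have hσ0 : 0 < σ := hσ.1
      have mk : ∀ r : ℝ, Measurable fun y : RSpace n => ENNReal.ofReal (heatKer r (x - y)) :=
        fun r => (measurable_heatKer measurable_const (by fun_prop)).ennreal_ofReal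
      have e : ENNReal.ofReal (C * B) * 2 = ∫⁻ y, ENNReal.ofReal (C * B) *
          (ENNReal.ofReal (heatKer σ (x - y)) + ENNReal.ofReal (heatKer (4 * σ) (x - y))) := by
        rw [lintegral_const_mul' _ _ ENNReal.ofReal_ne_top, lintegral_add_left (mk σ),
          lintegral_heatKer_sub hσ0, lintegral_heatKer_sub (by positivity), one_add_one_eq_two]
      rw [e]
      refine lintegral_mono fun y => ?_
      have hk1 := heatKer_pos hσ0 (x - y)
      have hk2 := heatKer_pos (by positivity : 0 < 4 * σ) (x - y)
      split_ifs with hc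
      · have key : heatKer σ (x - y) * σ ^ (s - 2) ≤
            C * (heatKer σ (x - y) + heatKer (4 * σ) (x - y)) := by
          have p1 : 0 ≤ η ^ (s - 2) := by positivity
          have p2 : 0 ≤ K * N ^ s := by positivity
          rcases hc.2 with h1 | h1
          · have h2 : σ ^ (s - 2) ≤ η ^ (s - 2) :=
              Real.rpow_le_rpow_of_nonpos hη h1 (by linarith)
            calc heatKer σ (x - y) * σ ^ (s - 2) ≤ heatKer σ (x - y) * η ^ (s - 2) := by gcongr
              _ ≤ _ := by
                rw [hC]; nlinarith [mul_nonneg p1 hk2.le, mul_nonneg p2 hk2.le,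
                  mul_nonneg p2 hk1.le]
          · have h2 := heatKer_le_of_far hη hσ0 h1
            have h3 : σ ^ 2 * σ ^ (s - 2) = σ ^ s := by
              rw [← Real.rpow_natCast, ← Real.rpow_add hσ0]; congr 1; push_cast; ring
            have h4 : σ ^ s ≤ N ^ s := Real.rpow_le_rpow hσ0.le hσ.2.le hs0.le
            calc heatKer σ (x - y) * σ ^ (s - 2)
                ≤ (K * σ ^ 2 * heatKer (4 * σ) (x - y)) * σ ^ (s - 2) := by gcongr
              _ = K * σ ^ s * heatKer (4 * σ) (x - y) := by rw [← h3]; ring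
              _ ≤ K * N ^ s * heatKer (4 * σ) (x - y) := by gcongr
              _ ≤ _ := by
                rw [hC]; nlinarith [mul_nonneg p1 hk2.le, mul_nonneg p2 hk1.le,
                  mul_nonneg p1 hk1.le]
        rw [← ENNReal.ofReal_add hk1.le hk2.le, ← ENNReal.ofReal_mul (by positivity)]
        calc _ ≤ ENNReal.ofReal (heatKer σ (x - y) * σ ^ (s - 2)) * ENNReal.ofReal B := by
              gcongr; exact hb y σ
          _ = ENNReal.ofReal (heatKer σ (x - y) * σ ^ (s - 2) * B) :=
              (ENNReal.ofReal_mul (by positivity)).symm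
          _ ≤ _ := by
              apply ENNReal.ofReal_le_ofReal
              calc _ ≤ C * (heatKer σ (x - y) + heatKer (4 * σ) (x - y)) * B := by gcongr
                _ = _ := by ring
      · exact zero_le
    · rw [indicator_of_notMem hσ]
      refine le_of_eq (lintegral_eq_zero_of_ae_eq_zero (ae_of_all _ fun y => ?_))
      dsimp only [Pi.zero_apply]
      split_ifs with hc
      · have : N ≤ σ := by
          by_contra h'
          exact hσ ⟨hc.1, not_le.1 h'⟩
        simp [h0 y σ this]
      · rfl
  refine ne_top_of_le_ne_top ?_ hle
  rw [setLIntegral_const, Real.volume_Ioo]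
  exact ENNReal.mul_ne_top (ENNReal.mul_ne_top ENNReal.ofReal_ne_top (by norm_num))
    ENNReal.ofReal_ne_top

/-- The truncated fractional derivative of a potential recovers its density. -/
theorem tendsto_heatPot_defectW {n : ℕ} {s : ℝ} (hs0 : 0 < s) (hs1 : s < 1)
    {h : RSpace n → ℝ → ℝ≥0∞} (hh : Measurable fun p : RSpace n × ℝ => h p.1 p.2)
    (x : RSpace n) (t : ℝ) {L : ℝ}
    (hnear : ∀ δ : ℝ, 0 < δ → ∃ η : ℝ, 0 < η ∧ ∀ (y : RSpace n) (σ : ℝ), ‖x - y‖ < η → 0 < σ →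
      σ < η → h y (t - σ) ≤ ENNReal.ofReal (L + δ) ∧ ENNReal.ofReal (L - δ) ≤ h y (t - σ))
    (hfar : ∀ η : ℝ, 0 < η → farPot s η h x t ≠ ∞) :
    Tendsto (fun ε => heatPot (defectW s ε) h x t) (𝓝[>] 0) (𝓝 (ENNReal.ofReal L)) := by
  have hC := stableConst_pos hs0 hs1
  set M : ℝ → ℝ≥0∞ := fun ε => ∫⁻ σ, (if σ < 1 then defectW s ε σ else 0) with hM
  have hM1 : Tendsto M (𝓝[>] 0) (𝓝 1) := tendsto_lintegral_defectW hs0 hs1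
  set e : ℝ → ℝ≥0∞ := fun ε => ENNReal.ofReal (stableConst s * ε ^ (1 - s)) with he
  have he0 : Tendsto e (𝓝[>] 0) (𝓝 0) := by
    have h1 : ContinuousAt (fun ε : ℝ => stableConst s * ε ^ (1 - s)) 0 :=
      (Real.continuousAt_rpow_const _ _ (Or.inr (by linarith))).const_mul _
    have h2 : Tendsto (fun ε : ℝ => ENNReal.ofReal (stableConst s * ε ^ (1 - s))) (𝓝[>] 0) _ :=
      (ENNReal.tendsto_ofReal h1.tendsto).mono_left nhdsWithin_le_nhds
    simpa [Real.zero_rpow (by linarith : (1 - s) ≠ 0)] using h2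
  -- the two basic inequalities
  have key : ∀ δ : ℝ, 0 < δ → ∃ F₁ F₂ : ℝ≥0∞, F₁ ≠ ∞ ∧ F₂ ≠ ∞ ∧ ∀ ε, 0 < ε →
      heatPot (defectW s ε) h x t ≤ ENNReal.ofReal (L + δ) * M ε + e ε * F₁ ∧
      ENNReal.ofReal (L - δ) * M ε ≤ heatPot (defectW s ε) h x t + e ε * F₂ := by
    intro δ hδ
    obtain ⟨η', hη', hn'⟩ := hnear δ hδ
    -- η ≤ 1 places the near region inside σ < 1, where M ε measures the mass of the defect.
    set η := min η' 1 with hη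
    have hη0 : 0 < η := by positivity
    have hη1 : η ≤ 1 := min_le_right _ _
    have hn : ∀ (y : RSpace n) (σ : ℝ), ‖x - y‖ < η → 0 < σ → σ < η →
        h y (t - σ) ≤ ENNReal.ofReal (L + δ) ∧ ENNReal.ofReal (L - δ) ≤ h y (t - σ) :=
      fun y σ h1 h2 h3 => hn' y σ (h1.trans_le (min_le_left _ _)) h2
        (h3.trans_le (min_le_left _ _))
    -- For the lower bound the constant L - δ is compared with h near (x,t); k carries the rest of
    -- (L-δ)·M ε, which lies away from the singularity and is killed by e ε.
    set k : RSpace n → ℝ → ℝ≥0∞ := fun _ τ => if t - τ < 1 then ENNReal.ofReal (L - δ) else 0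
      with hk
    have mk : Measurable fun p : RSpace n × ℝ => k p.1 p.2 :=
      Measurable.ite (measurableSet_lt (by fun_prop) measurable_const) measurable_const
        measurable_const
    have hkfar : farPot s η k x t ≠ ∞ := by
      rcases le_total 0 (L - δ) with h1 | h1
      · apply farPot_ne_top_of_bounded hs0 hs1 hη0 one_pos h1 x t
        · intro y σ
          rw [hk]; dsimp only
          split_ifs
          · exact le_rfl
          · exact zero_le
        · intro y σ hσ
          rw [hk]; dsimp only
          rw [sub_sub_cancel, if_neg (not_lt.2 hσ)]
      · apply farPot_ne_top_of_bounded hs0 hs1 hη0 one_pos le_rfl x t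
        · intro y σ
          rw [hk]; dsimp only
          split_ifs
          · exact ENNReal.ofReal_le_ofReal h1
          · exact zero_le
        · intro y σ hσ
          rw [hk]; dsimp only
          rw [sub_sub_cancel, if_neg (not_lt.2 hσ)]
    refine ⟨farPot s η h x t, farPot s η k x t, hfar η hη0, hkfar, fun ε hε => ?_⟩
    have mkr : Measurable fun p : ℝ × RSpace n => ENNReal.ofReal (heatKer p.1 (x - p.2)) :=
      (measurable_heatKer (by fun_prop) (by fun_prop)).ennreal_ofReal
    have hker : ∀ a : ℝ≥0∞, ∀ σ : ℝ, 0 < σ →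
        ∫⁻ y : RSpace n, a * ENNReal.ofReal (heatKer σ (x - y)) = a := by
      intro a σ hσ
      rw [lintegral_const_mul, lintegral_heatKer_sub hσ, mul_one]
      exact mkr.comp measurable_prodMk_left
    have hdfar : ∀ (σ : ℝ) (y : RSpace n) (a : ℝ≥0∞), 0 < σ →
        defectW s ε σ * (ENNReal.ofReal (heatKer σ (x - y)) * a) ≤
          e ε * (ENNReal.ofReal (heatKer σ (x - y) * σ ^ (s - 2)) * a) := by
      intro σ y a hσ
      have h1 := defectW_le hs0 hs1 hε hσ
      rw [ENNReal.ofReal_mul (heatKer_pos hσ _).le]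
      calc _ ≤ (ENNReal.ofReal (stableConst s * ε ^ (1 - s)) * ENNReal.ofReal (σ ^ (s - 2))) *
            (ENNReal.ofReal (heatKer σ (x - y)) * a) := by gcongr
        _ = _ := by rw [he]; ring
    have eP : heatPot (defectW s ε) h x t = ∫⁻ σ, ∫⁻ y,
        defectW s ε σ * (ENNReal.ofReal (heatKer σ (x - y)) * h y (t - σ)) := by
      unfold heatPot heatAvg
      refine lintegral_congr fun σ => ?_
      rw [lintegral_const_mul]
      exact (mkr.comp measurable_prodMk_left).mul
        (measurable_uncurry_comp hh measurable_id measurable_const)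
    have eM : ∀ a : ℝ≥0∞, a ≠ ∞ → a * M ε = ∫⁻ σ, ∫⁻ y : RSpace n,
        (if 0 < σ ∧ σ < 1 then a * defectW s ε σ * ENNReal.ofReal (heatKer σ (x - y)) else 0) := by
      intro a ha
      rw [hM]; dsimp only
      rw [← lintegral_const_mul' _ _ ha]
      refine lintegral_congr fun σ => ?_
      by_cases h1 : 0 < σ
      · by_cases h2 : σ < 1
        · simp only [h1, h2, and_self, if_true]
          rw [hker _ σ h1]
        · simp [h2]
      · have : defectW s ε σ = 0 := defectW_zero (not_lt.1 h1)
        simp [h1, this]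
    have efar : ∀ g : RSpace n → ℝ → ℝ≥0∞, e ε * farPot s η g x t = ∫⁻ σ, ∫⁻ y,
        e ε * (if 0 < σ ∧ (η ≤ σ ∨ η ≤ ‖x - y‖) then
          ENNReal.ofReal (heatKer σ (x - y) * σ ^ (s - 2)) * g y (t - σ) else 0) := by
      intro g
      unfold farPot
      rw [← lintegral_const_mul' _ _ ENNReal.ofReal_ne_top]
      refine lintegral_congr fun σ => ?_
      rw [← lintegral_const_mul' _ _ ENNReal.ofReal_ne_top]
    have hdouble : ∀ {f g k : ℝ → RSpace n → ℝ≥0∞},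
        (Measurable fun p : ℝ × RSpace n => g p.1 p.2) →
        (∀ σ y, f σ y ≤ g σ y + k σ y) →
        ∫⁻ σ, ∫⁻ y, f σ y ≤ (∫⁻ σ, ∫⁻ y, g σ y) + ∫⁻ σ, ∫⁻ y, k σ y := by
      intro f g k hg hle
      rw [← lintegral_add_left hg.lintegral_prod_right']
      refine lintegral_mono fun σ => ?_
      dsimp only
      have mg : Measurable fun y => g σ y := hg.comp measurable_prodMk_left
      rw [← lintegral_add_left mg]
      exact lintegral_mono fun y => hle σ y
    constructor
    · rw [eP, eM _ ENNReal.ofReal_ne_top, efar]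
      apply hdouble
      · apply Measurable.ite _ _ measurable_const
        · exact (measurableSet_lt measurable_const measurable_fst).inter
            (measurableSet_lt measurable_fst measurable_const)
        · exact (((measurable_defectW s ε).comp measurable_fst).const_mul _).mul mkr
      · intro σ y
        rcases le_or_gt σ 0 with h0 | h0
        · rw [defectW_zero h0, zero_mul]; exact zero_le
        by_cases h1 : η ≤ σ ∨ η ≤ ‖x - y‖
        · rw [if_pos (⟨h0, h1⟩ : 0 < σ ∧ (η ≤ σ ∨ η ≤ ‖x - y‖))]
          exact (hdfar σ y _ h0).trans le_add_self
        · push Not at h1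
          rw [if_pos ⟨h0, h1.1.trans_le hη1⟩]
          refine le_trans ?_ le_self_add
          calc defectW s ε σ * (ENNReal.ofReal (heatKer σ (x - y)) * h y (t - σ))
              ≤ defectW s ε σ * (ENNReal.ofReal (heatKer σ (x - y)) *
                ENNReal.ofReal (L + δ)) := by
                gcongr; exact (hn y σ h1.2 h0 h1.1).1
            _ = _ := by ring
    · rw [eP, eM _ ENNReal.ofReal_ne_top, efar]
      apply hdouble
      · exact ((measurable_defectW s ε).comp measurable_fst).mul
          (mkr.mul (measurable_uncurry_comp hh (by fun_prop) (by fun_prop)))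
      · intro σ y
        split_ifs with h1 h2 h2
        · refine le_trans ?_ le_add_self
          have h3 := hdfar σ y (k y (t - σ)) h1.1
          refine le_trans (le_of_eq ?_) h3
          rw [hk]; dsimp only
          rw [sub_sub_cancel, if_pos h1.2]
          ring
        · have h3 : σ < η ∧ ‖x - y‖ < η := by
            constructor <;> by_contra h' <;> push Not at h'
            · exact h2 ⟨h1.1, Or.inl h'⟩
            · exact h2 ⟨h1.1, Or.inr h'⟩
          refine le_trans ?_ le_self_add
          calc _ = defectW s ε σ * (ENNReal.ofReal (heatKer σ (x - y)) *
                ENNReal.ofReal (L - δ)) := by ring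
            _ ≤ _ := by gcongr; exact (hn y σ h3.2 h1.1 h3.1).2
        · exact zero_le
        · exact zero_le
  have hub : limsup (fun ε => heatPot (defectW s ε) h x t) (𝓝[>] 0) ≤ ENNReal.ofReal L := by
    have : ∀ δ : ℝ, 0 < δ → limsup (fun ε => heatPot (defectW s ε) h x t) (𝓝[>] 0) ≤
        ENNReal.ofReal (L + δ) := by
      intro δ hδ
      obtain ⟨F₁, F₂, hF₁, hF₂, hF⟩ := key δ hδ
      have h1 : Tendsto (fun ε => ENNReal.ofReal (L + δ) * M ε + e ε * F₁) (𝓝[>] 0)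
          (𝓝 (ENNReal.ofReal (L + δ) * 1 + 0 * F₁)) :=
        (ENNReal.Tendsto.const_mul hM1 (Or.inr ENNReal.ofReal_ne_top)).add
          (ENNReal.Tendsto.mul_const he0 (Or.inr hF₁))
      rw [mul_one, zero_mul, add_zero] at h1
      rw [← h1.limsup_eq]
      refine limsup_le_limsup ?_
      filter_upwards [self_mem_nhdsWithin] with ε hε using (hF ε hε).1
    have h2 : Tendsto (fun δ : ℝ => ENNReal.ofReal (L + δ)) (𝓝[>] 0) (𝓝 (ENNReal.ofReal L)) := by
      have : Tendsto (fun δ : ℝ => L + δ) (𝓝[>] 0) (𝓝 (L + 0)) :=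
        (tendsto_const_nhds.add tendsto_id).mono_left nhdsWithin_le_nhds
      rw [add_zero] at this
      exact ENNReal.tendsto_ofReal this
    refine ge_of_tendsto h2 ?_
    filter_upwards [self_mem_nhdsWithin] with δ hδ using this δ hδ
  have hlb : ENNReal.ofReal L ≤ liminf (fun ε => heatPot (defectW s ε) h x t) (𝓝[>] 0) := by
    have : ∀ δ : ℝ, 0 < δ → ENNReal.ofReal (L - δ) ≤
        liminf (fun ε => heatPot (defectW s ε) h x t) (𝓝[>] 0) := by
      intro δ hδ
      obtain ⟨F₁, F₂, hF₁, hF₂, hF⟩ := key δ hδ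
      have h1 : Tendsto (fun ε => ENNReal.ofReal (L - δ) * M ε - e ε * F₂) (𝓝[>] 0)
          (𝓝 (ENNReal.ofReal (L - δ) * 1 - 0 * F₂)) :=
        ENNReal.Tendsto.sub (ENNReal.Tendsto.const_mul hM1 (Or.inr ENNReal.ofReal_ne_top))
          (ENNReal.Tendsto.mul_const he0 (Or.inr hF₂)) (Or.inr (by simp))
      rw [mul_one, zero_mul, tsub_zero] at h1
      rw [← h1.liminf_eq]
      refine liminf_le_liminf ?_
      filter_upwards [self_mem_nhdsWithin] with ε hε
      exact tsub_le_iff_right.2 (hF ε hε).2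
    have h2 : Tendsto (fun δ : ℝ => ENNReal.ofReal (L - δ)) (𝓝[>] 0) (𝓝 (ENNReal.ofReal L)) := by
      have : Tendsto (fun δ : ℝ => L - δ) (𝓝[>] 0) (𝓝 (L - 0)) :=
        (tendsto_const_nhds.sub tendsto_id).mono_left nhdsWithin_le_nhds
      rw [sub_zero] at this
      exact ENNReal.tendsto_ofReal this
    refine le_of_tendsto h2 ?_
    filter_upwards [self_mem_nhdsWithin] with δ hδ using this δ hδ
  exact tendsto_of_le_liminf_of_limsup_le hlb hub

/-! ### The fundamental solution as a Riesz superposition of heat kernels -/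

theorem masterKernel_eq {n : ℕ} (s : ℝ) (z : RSpace n) {r : ℝ} (hr : 0 < r) :
    masterKernel s z r = r ^ (s - 1) / Real.Gamma s * heatKer r z := by
  have e1 : r ^ ((n : ℝ) / 2 + 1 - s) = (r ^ (s - 1))⁻¹ * r ^ ((n : ℝ) / 2) := by
    rw [← Real.rpow_neg hr.le, ← Real.rpow_add hr]; congr 1; ring
  have h1 : 0 < r ^ (s - 1) := by positivity
  have h2 : 0 < r ^ ((n : ℝ) / 2) := by positivity
  have h3 : 0 < (4 * Real.pi) ^ ((n : ℝ) / 2) := by positivity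
  unfold masterKernel heatKer
  rw [if_pos hr, e1, Real.mul_rpow (by positivity) hr.le, Real.rpow_neg (by positivity),
    Real.rpow_neg hr.le]
  field_simp

theorem masterKernel_nonneg {n : ℕ} {s : ℝ} (hs : 0 < s) (z : RSpace n) (r : ℝ) :
    0 ≤ masterKernel s z r := by
  have := Real.Gamma_pos_of_pos hs
  unfold masterKernel
  split_ifs <;> positivity

theorem measurable_masterKernel {n : ℕ} (s : ℝ) (x : RSpace n) (t : ℝ) :
    Measurable fun p : RSpace n × ℝ => masterKernel s (x - p.1) (t - p.2) := by
  have hS : MeasurableSet {p : RSpace n × ℝ | 0 < t - p.2} :=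
    measurableSet_lt measurable_const (by fun_prop)
  unfold masterKernel
  exact Measurable.ite hS (by fun_prop) measurable_const

theorem heatPot_eq_lintegral {n : ℕ} {a : ℝ → ℝ≥0∞} {h : RSpace n → ℝ → ℝ≥0∞}
    (hh : Measurable fun p : RSpace n × ℝ => h p.1 p.2) (x : RSpace n) (t : ℝ) :
    heatPot a h x t =
      ∫⁻ σ, ∫⁻ y, a σ * (ENNReal.ofReal (heatKer σ (x - y)) * h y (t - σ)) := by
  unfold heatPot heatAvg
  refine lintegral_congr fun σ => ?_
  rw [lintegral_const_mul]
  exact (measurable_heatKer measurable_const (by fun_prop)).ennreal_ofReal.mul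
    (measurable_uncurry_comp hh measurable_id measurable_const)

theorem lintegral_masterKernel_mul {n : ℕ} {s : ℝ} (hs : 0 < s) {g : RSpace n → ℝ → ℝ}
    (hg : Continuous fun p : RSpace n × ℝ => g p.1 p.2) (x : RSpace n) (t : ℝ) :
    ∫⁻ p : RSpace n × ℝ, ENNReal.ofReal (masterKernel s (x - p.1) (t - p.2) * g p.1 p.2) =
      heatPot (rieszW s) (fun y τ => ENNReal.ofReal (g y τ)) x t := by
  have mF : Measurable fun p : RSpace n × ℝ =>
      ENNReal.ofReal (masterKernel s (x - p.1) (t - p.2) * g p.1 p.2) :=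
    ((measurable_masterKernel s x t).mul hg.measurable).ennreal_ofReal
  rw [heatPot_eq_lintegral (measurable_toENNReal hg), Measure.volume_eq_prod,
    lintegral_prod_symm _ mF.aemeasurable,
    ← lintegral_sub_left_eq_self (fun τ => ∫⁻ y : RSpace n,
      ENNReal.ofReal (masterKernel s (x - y) (t - τ) * g y τ)) t]
  refine lintegral_congr fun σ => lintegral_congr fun y => ?_
  rw [sub_sub_cancel]
  rcases le_or_gt σ 0 with h | h
  · rw [rieszW_zero h, zero_mul, masterKernel, if_neg (not_lt.2 h)]
    simp
  · have := Real.Gamma_pos_of_pos hs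
    have hk := heatKer_pos h (x - y)
    rw [masterKernel_eq s _ h, rieszW, if_pos h, ENNReal.ofReal_mul (by positivity),
      ENNReal.ofReal_mul (by positivity), mul_assoc]

/-- The integral equation, written with the heat semigroup. -/
theorem integral_masterKernel_iff {n : ℕ} {s : ℝ} (hs : 0 < s) {g : RSpace n → ℝ → ℝ}
    (hg : Continuous fun p : RSpace n × ℝ => g p.1 p.2) (hg0 : ∀ y τ, 0 ≤ g y τ) (x : RSpace n)
    (t : ℝ) {w : ℝ} (hw : 0 ≤ w) :
    (Integrable (fun p : RSpace n × ℝ => masterKernel s (x - p.1) (t - p.2) * g p.1 p.2) ∧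
      w = ∫ τ : ℝ, ∫ y : RSpace n, masterKernel s (x - y) (t - τ) * g y τ) ↔
    ENNReal.ofReal w = heatPot (rieszW s) (fun y τ => ENNReal.ofReal (g y τ)) x t := by
  have mF : Measurable fun p : RSpace n × ℝ =>
      masterKernel s (x - p.1) (t - p.2) * g p.1 p.2 :=
    (measurable_masterKernel s x t).mul hg.measurable
  have h0 : ∀ p : RSpace n × ℝ, 0 ≤ masterKernel s (x - p.1) (t - p.2) * g p.1 p.2 :=
    fun p => mul_nonneg (masterKernel_nonneg hs _ _) (hg0 _ _)
  have hI : Integrable (fun p : RSpace n × ℝ =>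
      masterKernel s (x - p.1) (t - p.2) * g p.1 p.2) →
      ∫ τ : ℝ, ∫ y : RSpace n, masterKernel s (x - y) (t - τ) * g y τ =
      ∫ p : RSpace n × ℝ, masterKernel s (x - p.1) (t - p.2) * g p.1 p.2 := by
    intro hi
    rw [Measure.volume_eq_prod] at hi ⊢
    exact (integral_prod_symm _ hi).symm
  rw [← lintegral_masterKernel_mul hs hg]
  constructor
  · rintro ⟨hi, he⟩
    rw [he, hI hi, ofReal_integral_eq_lintegral_ofReal hi (ae_of_all _ h0)]
  · intro he
    have hi : Integrable (fun p : RSpace n × ℝ =>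
        masterKernel s (x - p.1) (t - p.2) * g p.1 p.2) := by
      refine ⟨mF.aestronglyMeasurable, ?_⟩
      rw [hasFiniteIntegral_iff_ofReal (ae_of_all _ h0), ← he]
      exact ENNReal.ofReal_lt_top
    refine ⟨hi, ?_⟩
    rw [hI hi, integral_eq_lintegral_of_nonneg_ae (ae_of_all _ h0) mF.aestronglyMeasurable, ← he,
      ENNReal.toReal_ofReal hw]

/-! ### From the integral equation to the fractional equation -/

theorem lconv_comm (a b : ℝ → ℝ≥0∞) (σ : ℝ) : lconv a b σ = lconv b a σ := by
  unfold lconv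
  rw [← lintegral_sub_left_eq_self (fun r => a (σ - r) * b r) σ]
  refine lintegral_congr fun r => ?_
  rw [sub_sub_cancel, mul_comm]

/-- The exponents at times σ and σ+1 differ by ‖z‖²/(4σ(σ+1)) ≥ b/σ when ‖z‖ ≥ η and σ < η, and
exp(-b/σ) beats every negative power of σ. -/
theorem heatKer_mul_rpow_le_shift {n : ℕ} {s η : ℝ} (hs1 : s < 1) (hη : 0 < η) :
    ∃ C : ℝ, 0 ≤ C ∧ ∀ (σ : ℝ) (z : RSpace n), 0 < σ → σ < η → η ≤ ‖z‖ →
      heatKer σ z * σ ^ (s - 2) ≤ C * ((σ + 1) ^ (s - 1) * heatKer (σ + 1) z) := by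
  set b : ℝ := η ^ 2 / (4 * (η + 1)) with hb
  have hb0 : 0 < b := by positivity
  set p : ℝ := (n : ℝ) / 2 + 2 - s with hp
  have hp0 : 0 ≤ p := by
    have : (0 : ℝ) ≤ n := n.cast_nonneg
    rw [hp]; linarith
  obtain ⟨K, hK0, hK⟩ : ∃ K : ℝ, 0 ≤ K ∧ ∀ σ : ℝ, 0 < σ →
      σ ^ (-p) * Real.exp (-(b / σ)) ≤ K := by
    have h1 : Tendsto (fun y : ℝ => y ^ p * Real.exp (-b * y)) atTop (𝓝 0) :=
      tendsto_rpow_mul_exp_neg_mul_atTop_nhds_zero p b hb0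
    obtain ⟨A, hA⟩ := (h1.eventually (gt_mem_nhds one_pos)).exists_forall_of_atTop
    refine ⟨max 1 ((max A 0) ^ p), by positivity, fun σ hσ => ?_⟩
    have e1 : σ ^ (-p) * Real.exp (-(b / σ)) = (σ⁻¹) ^ p * Real.exp (-b * σ⁻¹) := by
      rw [Real.inv_rpow hσ.le, Real.rpow_neg hσ.le]; congr 2; ring
    rw [e1]
    rcases le_total A σ⁻¹ with h | h
    · exact (hA _ h).le.trans (le_max_left _ _)
    · refine le_trans ?_ (le_max_right _ _)
      have h2 : Real.exp (-b * σ⁻¹) ≤ 1 := by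
        rw [Real.exp_le_one_iff]
        have : 0 < b * σ⁻¹ := by positivity
        linarith
      calc (σ⁻¹) ^ p * Real.exp (-b * σ⁻¹) ≤ (σ⁻¹) ^ p * 1 := by gcongr
        _ ≤ _ := by
          rw [mul_one]
          exact Real.rpow_le_rpow (by positivity) (h.trans (le_max_left _ _)) hp0
  refine ⟨K * (η + 1) ^ ((n : ℝ) / 2 + 1 - s), by positivity, fun σ z hσ hση hz => ?_⟩
  have e2 : heatKer σ z * σ ^ (s - 2) = (4 * Real.pi) ^ (-((n : ℝ) / 2)) *
      Real.exp (-‖z‖ ^ 2 / (4 * (σ + 1))) *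
      (σ ^ (-p) * Real.exp (-(‖z‖ ^ 2 / (4 * (σ + 1)) / σ))) := by
    have e3 : σ ^ (-p) = σ ^ (-((n : ℝ) / 2)) * σ ^ (s - 2) := by
      rw [← Real.rpow_add hσ]; congr 1; rw [hp]; ring
    have e4 : Real.exp (-‖z‖ ^ 2 / (4 * σ)) = Real.exp (-‖z‖ ^ 2 / (4 * (σ + 1))) *
        Real.exp (-(‖z‖ ^ 2 / (4 * (σ + 1)) / σ)) := by
      rw [← Real.exp_add]; congr 1; field_simp; ring
    rw [heatKer, Real.mul_rpow (by positivity) hσ.le, e3, e4]; ring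
  have e5 : (σ + 1) ^ (s - 1) * heatKer (σ + 1) z = (4 * Real.pi) ^ (-((n : ℝ) / 2)) *
      Real.exp (-‖z‖ ^ 2 / (4 * (σ + 1))) * ((σ + 1) ^ ((n : ℝ) / 2 + 1 - s))⁻¹ := by
    rw [heatKer, Real.mul_rpow (by positivity) (by positivity : (0 : ℝ) ≤ σ + 1),
      ← Real.rpow_neg (by positivity),
      show -((n : ℝ) / 2 + 1 - s) = -((n : ℝ) / 2) + (s - 1) by ring,
      Real.rpow_add (by positivity)]
    ring
  have h6 : b ≤ ‖z‖ ^ 2 / (4 * (σ + 1)) := by rw [hb]; gcongr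
  have h7 : σ ^ (-p) * Real.exp (-(‖z‖ ^ 2 / (4 * (σ + 1)) / σ)) ≤ K := by
    refine le_trans ?_ (hK σ hσ)
    gcongr
  have h8 : (σ + 1) ^ ((n : ℝ) / 2 + 1 - s) ≤ (η + 1) ^ ((n : ℝ) / 2 + 1 - s) := by
    apply Real.rpow_le_rpow (by positivity) (by linarith)
    have : (0 : ℝ) ≤ n := n.cast_nonneg
    linarith
  have h9 : 1 ≤ (η + 1) ^ ((n : ℝ) / 2 + 1 - s) * ((σ + 1) ^ ((n : ℝ) / 2 + 1 - s))⁻¹ := by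
    rw [← div_eq_mul_inv, one_le_div (by positivity)]; exact h8
  rw [e2, e5]
  set A := (4 * Real.pi) ^ (-((n : ℝ) / 2)) * Real.exp (-‖z‖ ^ 2 / (4 * (σ + 1))) with hA
  have hA0 : 0 ≤ A := by positivity
  calc _ ≤ A * K := by gcongr
    _ ≤ A * K * ((η + 1) ^ ((n : ℝ) / 2 + 1 - s) * ((σ + 1) ^ ((n : ℝ) / 2 + 1 - s))⁻¹) :=
        le_mul_of_one_le_right (by positivity) h9
    _ = _ := by ring

/-- For σ ≥ η the kernel is below 1/η times the Riesz kernel. For σ < η, hence ‖x-y‖ ≥ η, the point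
(y, t-σ) is seen from the later point (x, t+1) with lag σ+1, where the Riesz kernel is not small.
This is why finiteness is assumed at all points. -/
theorem farPot_ne_top_of_riesz {n : ℕ} {s : ℝ} (hs0 : 0 < s) (hs1 : s < 1) {η : ℝ} (hη : 0 < η)
    {h : RSpace n → ℝ → ℝ≥0∞} (hh : Measurable fun p : RSpace n × ℝ => h p.1 p.2)
    (hfin : ∀ x t, heatPot (rieszW s) h x t ≠ ∞) (x : RSpace n) (t : ℝ) :
    farPot s η h x t ≠ ∞ := by
  have hΓ := Real.Gamma_pos_of_pos hs0
  obtain ⟨C, hC0, hC⟩ := heatKer_mul_rpow_le_shift (n := n) hs1 hη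
  set c₁ := ENNReal.ofReal (Real.Gamma s / η) with hc₁
  set c₂ := ENNReal.ofReal (Real.Gamma s * C) with hc₂
  have hle : farPot s η h x t ≤ c₁ * heatPot (rieszW s) h x t +
      c₂ * heatPot (rieszW s) h x (t + 1) := by
    have e2 : heatPot (rieszW s) h x (t + 1) = ∫⁻ σ, ∫⁻ y, rieszW s (σ + 1) *
        (ENNReal.ofReal (heatKer (σ + 1) (x - y)) * h y (t - σ)) := by
      rw [heatPot_eq_lintegral hh, ← lintegral_add_right_eq_self _ (1 : ℝ)]
      simp only [add_sub_add_right_eq_sub]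
    have m1 : Measurable fun p : ℝ × RSpace n => rieszW s p.1 *
        (ENNReal.ofReal (heatKer p.1 (x - p.2)) * h p.2 (t - p.1)) :=
      ((measurable_rieszW s).comp measurable_fst).mul
        ((measurable_heatKer (by fun_prop) (by fun_prop)).ennreal_ofReal.mul
          (measurable_uncurry_comp hh (by fun_prop) (by fun_prop)))
    have m1' : ∀ σ, Measurable fun y => c₁ * (rieszW s σ *
        (ENNReal.ofReal (heatKer σ (x - y)) * h y (t - σ))) :=
      fun σ => (m1.comp measurable_prodMk_left).const_mul c₁
    have m2 : Measurable fun σ => ∫⁻ y, c₁ * (rieszW s σ *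
        (ENNReal.ofReal (heatKer σ (x - y)) * h y (t - σ))) :=
      Measurable.lintegral_prod_right' (f := fun p : ℝ × RSpace n => c₁ * (rieszW s p.1 *
        (ENNReal.ofReal (heatKer p.1 (x - p.2)) * h p.2 (t - p.1)))) (m1.const_mul c₁)
    rw [heatPot_eq_lintegral hh, e2, ← lintegral_const_mul' _ _ ENNReal.ofReal_ne_top,
      ← lintegral_const_mul' _ _ ENNReal.ofReal_ne_top]
    simp_rw [← lintegral_const_mul' _ _ (ENNReal.ofReal_ne_top (r := Real.Gamma s / η)),
      ← lintegral_const_mul' _ _ (ENNReal.ofReal_ne_top (r := Real.Gamma s * C))]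
    rw [← lintegral_add_left m2]
    refine lintegral_mono fun σ => ?_
    dsimp only
    rw [← lintegral_add_left (m1' σ)]
    refine lintegral_mono fun y => ?_
    dsimp only
    split_ifs with hc
    · obtain ⟨hσ, hc⟩ := hc
      have hk := heatKer_pos hσ (x - y)
      by_cases h1 : η ≤ σ
      · refine le_trans ?_ le_self_add
        rw [rieszW, if_pos hσ, ← mul_assoc, ← mul_assoc, ← ENNReal.ofReal_mul (by positivity),
          ← ENNReal.ofReal_mul (by positivity)]
        refine mul_le_mul' (ENNReal.ofReal_le_ofReal ?_) le_rfl
        have e3 : σ ^ (s - 2) = σ ^ (s - 1) / σ := by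
          rw [← Real.rpow_sub_one hσ.ne']; congr 1; ring
        rw [e3]
        calc heatKer σ (x - y) * (σ ^ (s - 1) / σ) ≤ heatKer σ (x - y) * (σ ^ (s - 1) / η) := by
              gcongr
          _ = _ := by field_simp
      · refine le_trans ?_ le_add_self
        have hσ1 : 0 < σ + 1 := by linarith
        have hk1 := heatKer_pos hσ1 (x - y)
        rw [rieszW, if_pos hσ1, ← mul_assoc, ← mul_assoc, ← ENNReal.ofReal_mul (by positivity),
          ← ENNReal.ofReal_mul (by positivity)]
        refine mul_le_mul' (ENNReal.ofReal_le_ofReal ?_) le_rfl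
        refine (hC σ (x - y) hσ (not_le.1 h1) (hc.resolve_left h1)).trans (le_of_eq ?_)
        field_simp
    · exact zero_le
  exact ne_top_of_le_ne_top (ENNReal.add_ne_top.2
    ⟨ENNReal.mul_ne_top ENNReal.ofReal_ne_top (hfin _ _),
      ENNReal.mul_ne_top ENNReal.ofReal_ne_top (hfin _ _)⟩) hle

theorem near_of_continuous {n : ℕ} {g : RSpace n → ℝ → ℝ}
    (hg : Continuous fun p : RSpace n × ℝ => g p.1 p.2) (x : RSpace n) (t : ℝ) {δ : ℝ}
    (hδ : 0 < δ) : ∃ η : ℝ, 0 < η ∧ ∀ (y : RSpace n) (σ : ℝ), ‖x - y‖ < η → 0 < σ →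
      σ < η → |g y (t - σ) - g x t| < δ := by
  obtain ⟨η, hη, h⟩ := Metric.continuousAt_iff.1 (hg.continuousAt (x := (x, t))) δ hδ
  refine ⟨η, hη, fun y σ hy h0 hσ => ?_⟩
  have := @h (y, t - σ) (by
    rw [Prod.dist_eq, max_lt_iff, dist_eq_norm, norm_sub_rev, Real.dist_eq]
    refine ⟨hy, ?_⟩
    rw [show (y, t - σ).2 - (x, t).2 = -σ by simp, abs_neg, abs_of_pos h0]
    exact hσ)
  rwa [Real.dist_eq] at this

/-- A fractional heat potential with continuous density solves the fractional heat equation. -/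
theorem fracHeat_eq_of_potential {n : ℕ} {s : ℝ} (hs0 : 0 < s) (hs1 : s < 1) {α : ℝ} (hα : s < α)
    {u : RSpace n → ℝ → ℝ} (hreg : ParabolicHolderLoc α u) (hu : SlowlyIncreasing s u)
    (hpos : ∀ x t, 0 < u x t) {g : RSpace n → ℝ → ℝ}
    (hg : Continuous fun p : RSpace n × ℝ => g p.1 p.2) (hg0 : ∀ y τ, 0 ≤ g y τ)
    (heq : ∀ x t, ENNReal.ofReal (u x t) =
      heatPot (rieszW s) (fun y τ => ENNReal.ofReal (g y τ)) x t) (x : RSpace n) (t : ℝ) :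
    fracHeat s u x t = g x t := by
  have hc : Continuous fun p : RSpace n × ℝ => u p.1 p.2 := hreg.continuous
  have mG := measurable_toENNReal hg
  set G : RSpace n → ℝ → ℝ≥0∞ := fun y τ => ENNReal.ofReal (g y τ) with hG
  obtain ⟨C, θ, -, hθ, happ⟩ := fracHeat_approx hs0 hs1 hα hreg hu hpos
    (R := max ‖x‖ |t|) (by positivity)
  have happ := (happ x t (le_max_left _ _) (le_max_right _ _)).2
  have hU : (fun z τ => ENNReal.ofReal (u z τ)) = heatPot (rieszW s) G := by
    funext z τ; exact heq z τ
  have hD : Tendsto (fun ε => heatPot (defectW s ε) G x t) (𝓝[>] 0)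
      (𝓝 (ENNReal.ofReal (g x t))) := by
    apply tendsto_heatPot_defectW hs0 hs1 mG
    · intro δ hδ
      obtain ⟨η, hη, h⟩ := near_of_continuous hg x t hδ
      refine ⟨η, hη, fun y σ h1 h2 h3 => ?_⟩
      have := abs_lt.1 (h y σ h1 h2 h3)
      exact ⟨ENNReal.ofReal_le_ofReal (by linarith), ENNReal.ofReal_le_ofReal (by linarith)⟩
    · exact fun η hη => farPot_ne_top_of_riesz hs0 hs1 hη mG
        (fun x t => by rw [← heq]; exact ENNReal.ofReal_ne_top) x t
  have hD' : Tendsto (fun ε => (heatPot (defectW s ε) G x t).toReal) (𝓝[>] 0) (𝓝 (g x t)) := by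
    have := (ENNReal.tendsto_toReal ENNReal.ofReal_ne_top).comp hD
    rwa [ENNReal.toReal_ofReal (hg0 x t)] at this
  have hF : Tendsto (fun ε => (heatPot (defectW s ε) G x t).toReal) (𝓝[>] 0)
      (𝓝 (fracHeat s u x t)) := by
    rw [tendsto_iff_dist_tendsto_zero]
    have h0 : Tendsto (fun ε : ℝ => C * ε ^ θ) (𝓝[>] 0) (𝓝 0) := by
      have h1 : ContinuousAt (fun ε : ℝ => C * ε ^ θ) 0 :=
        (Real.continuousAt_rpow_const _ _ (Or.inr hθ.le)).const_mul _
      have h2 : Tendsto (fun ε : ℝ => C * ε ^ θ) (𝓝[>] 0) _ :=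
        h1.tendsto.mono_left nhdsWithin_le_nhds
      simpa [Real.zero_rpow hθ.ne'] using h2
    refine squeeze_zero' (Eventually.of_forall fun _ => dist_nonneg) ?_ h0
    filter_upwards [Ioo_mem_nhdsGT (one_pos : (0 : ℝ) < 1)] with ε hε
    rw [Real.dist_eq]
    refine le_trans (le_of_eq ?_) (happ ε hε.1 hε.2.le)
    -- Since u is the Riesz potential of G, the half-line identity says that the truncated operator
    -- applied to u is the defect potential of G.
    have e1 : ENNReal.ofReal (levyMass s ε) * ENNReal.ofReal (u x t) =
        heatPot (levyW s ε) (fun z τ => ENNReal.ofReal (u z τ)) x t +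
          heatPot (defectW s ε) G x t := by
      rw [heq x t, ← heatPot_const_mul (measurable_rieszW s) mG,
        show (fun σ => ENNReal.ofReal (levyMass s ε) * rieszW s σ) = fun σ =>
          lconv (levyW s ε) (rieszW s) σ + defectW s ε σ from funext fun σ => by
            rw [levyMass_mul_riesz hs0 hs1 hε.1, lconv_comm],
        heatPot_add (measurable_lconv (measurable_levyW s ε) (measurable_rieszW s)) mG, hU,
        heatPot_heatPot (measurable_levyW s ε) (measurable_rieszW s)
          (fun ρ h => levyW_zero hε.1.le h) (fun ρ h => rieszW_zero h) mG]
    have hVt := hu.heatPot_levyW_ne_top hs0 hs1 hc hε.1 x t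
    have hDt : heatPot (defectW s ε) G x t ≠ ∞ := by
      refine ne_top_of_le_ne_top ?_ (e1 ▸ le_add_self)
      exact ENNReal.mul_ne_top ENNReal.ofReal_ne_top ENNReal.ofReal_ne_top
    have e2 := congrArg ENNReal.toReal e1
    rw [ENNReal.toReal_add hVt hDt, ENNReal.toReal_mul, ENNReal.toReal_ofReal (hpos x t).le,
      ENNReal.toReal_ofReal (levyMass_nonneg hs1 hε.1.le)] at e2
    rw [e2]; congr 1; ring
  exact tendsto_nhds_unique hF hD'

/-! ### Cutoffs and their commutation with heat averages -/

/-- Cutoff functions that are almost invariant under the heat semigroup. -/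
theorem exists_heat_cutoff (n : ℕ) : ∃ K : ℝ, 0 ≤ K ∧ ∀ R : ℝ, 1 ≤ R → ∃ χ : RSpace n → ℝ,
    Continuous χ ∧ (∀ y, 0 ≤ χ y) ∧ (∀ y, χ y ≤ 1) ∧ (∀ y, ‖y‖ ≤ R → χ y = 1) ∧
    (∀ y, 2 * R ≤ ‖y‖ → χ y = 0) ∧ ∀ (v : ℝ) (m z : RSpace n), 0 < v →
      |(∫ y, heatKer v (y - m) * χ y) - χ z| ≤ K / R * (‖m - z‖ + v) := by
  let b : ContDiffBump (0 : RSpace n) := ⟨1, 2, one_pos, one_lt_two⟩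
  have hb2 : ContDiff ℝ 2 b := b.contDiff
  obtain ⟨C₁, hC₁⟩ := ContDiff.lipschitzWith_of_hasCompactSupport b.hasCompactSupport hb2
    (by norm_num)
  obtain ⟨C₂, hC₂⟩ := ContDiff.lipschitzWith_of_hasCompactSupport
    (b.hasCompactSupport.fderiv (𝕜 := ℝ)) (hb2.fderiv_right (m := 1) (by norm_num)) (by norm_num)
  -- C₁ and C₂ are Lipschitz constants of a fixed bump and of its derivative. Dilation by R gives
  -- first differences of size C₁/R and second differences of size 2C₂/R², which is at most 2C₂/R
  -- because R ≥ 1.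
  refine ⟨max (C₁ : ℝ) (2 * C₂ * (4 * 2 ^ ((n : ℝ) / 2))), by positivity, fun R hR => ?_⟩
  have hR0 : 0 < R := by linarith
  refine ⟨fun y => b (R⁻¹ • y), b.continuous.comp (by fun_prop), fun y => b.nonneg,
    fun y => b.le_one, fun y hy => b.one_of_mem_closedBall ?_, fun y hy => b.zero_of_le_dist ?_,
    fun v m z hv => ?_⟩
  · rw [mem_closedBall_zero_iff, norm_smul, Real.norm_of_nonneg (by positivity)]
    change R⁻¹ * ‖y‖ ≤ 1
    rw [inv_mul_le_iff₀ hR0]; linarith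
  · rw [dist_zero_right, norm_smul, Real.norm_of_nonneg (by positivity)]
    change 2 ≤ R⁻¹ * ‖y‖
    rw [le_inv_mul_iff₀ hR0]; linarith
  · have h := abs_integral_heatKer_sub_le (χ := fun y => b (R⁻¹ • y))
      (b.continuous.comp (by fun_prop)) (fun y => b.nonneg) (fun y => b.le_one)
      (L₁ := C₁ / R) (L₂ := 2 * C₂ / R) ?_ ?_ hv m z (by positivity)
    · refine h.trans ?_
      have h1 : (C₁ : ℝ) / R * ‖m - z‖ ≤
          max (C₁ : ℝ) (2 * C₂ * (4 * 2 ^ ((n : ℝ) / 2))) / R * ‖m - z‖ := by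
        gcongr; exact le_max_left _ _
      have h2 : 2 * (C₂ : ℝ) * (4 * 2 ^ ((n : ℝ) / 2)) / R * v ≤
          max (C₁ : ℝ) (2 * C₂ * (4 * 2 ^ ((n : ℝ) / 2))) / R * v := by
        gcongr; exact le_max_right _ _
      calc _ = (C₁ : ℝ) / R * ‖m - z‖ + 2 * (C₂ : ℝ) * (4 * 2 ^ ((n : ℝ) / 2)) / R * v := by ring
        _ ≤ _ := by rw [mul_add]; exact add_le_add h1 h2
    · intro y z
      have := hC₁.dist_le_mul (R⁻¹ • y) (R⁻¹ • z)
      rw [Real.dist_eq, dist_eq_norm, ← smul_sub, norm_smul,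
        Real.norm_of_nonneg (by positivity)] at this
      refine this.trans (le_of_eq (by ring))
    · intro y w
      have := norm_second_diff_le (hb2.differentiable (by norm_num)) (R⁻¹ • y) (R⁻¹ • w)
        (C₂ * (2 * ‖R⁻¹ • w‖)) (fun w' hw' => ?_)
      · rw [smul_eq_mul, Real.norm_eq_abs, norm_smul, Real.norm_of_nonneg (by positivity)] at this
        rw [smul_add, smul_sub]
        refine this.trans ?_
        have h3 : R⁻¹ ^ 2 ≤ R⁻¹ := by
          have : R⁻¹ ≤ 1 := inv_le_one_of_one_le₀ hR
          have h0 : 0 < R⁻¹ := by positivity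
          nlinarith
        calc (C₂ : ℝ) * (2 * (R⁻¹ * ‖w‖)) * (R⁻¹ * ‖w‖) = 2 * C₂ * ‖w‖ ^ 2 * R⁻¹ ^ 2 := by ring
          _ ≤ 2 * C₂ * ‖w‖ ^ 2 * R⁻¹ := by gcongr
          _ = _ := by ring
      · have := hC₂.dist_le_mul (R⁻¹ • y + w') (R⁻¹ • y - w')
        rw [dist_eq_norm, dist_eq_norm, add_sub_sub_cancel, ← two_smul ℝ, norm_smul,
          Real.norm_two] at this
        exact this.trans (by gcongr)

/-- The error made when a cutoff function is moved through the heat semigroup. -/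
noncomputable def cutErr (K σ r d : ℝ) : ℝ := min 1 (K * (r * (1 + d / σ)))

/-- The centre of the bridge law lies at distance (r/σ)‖x-z‖ from z, with σ = q + r, and its time
parameter qr/σ is at most r. Hence the error K r(1 + ‖x-z‖/σ). The bound 1 holds because both
quantities lie in [0,1]. -/
theorem abs_heatKer_cutoff_sub_le {n : ℕ} {K : ℝ} {χ : RSpace n → ℝ} (hK : 0 ≤ K)
    (hc : Continuous χ)
    (h0 : ∀ y, 0 ≤ χ y) (h1 : ∀ y, χ y ≤ 1)
    (hχ : ∀ (v : ℝ) (m z : RSpace n), 0 < v →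
      |(∫ y, heatKer v (y - m) * χ y) - χ z| ≤ K * (‖m - z‖ + v))
    {q r : ℝ} (hq : 0 < q) (hr : 0 < r) (x z : RSpace n) :
    (∫⁻ y, ENNReal.ofReal (heatKer (q * r / (q + r))
      (y - ((r / (q + r)) • x + (q / (q + r)) • z))) * ENNReal.ofReal (χ y)) ≤
        ENNReal.ofReal (χ z) + ENNReal.ofReal (cutErr K (q + r) r ‖x - z‖) ∧
    ENNReal.ofReal (χ z) ≤ (∫⁻ y, ENNReal.ofReal (heatKer (q * r / (q + r))
      (y - ((r / (q + r)) • x + (q / (q + r)) • z))) * ENNReal.ofReal (χ y)) +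
        ENNReal.ofReal (cutErr K (q + r) r ‖x - z‖) := by
  set v := q * r / (q + r) with hv
  set m := (r / (q + r)) • x + (q / (q + r)) • z with hm
  have hv0 : 0 < v := by positivity
  have hvr : v ≤ r := by
    rw [hv, div_le_iff₀ (by positivity)]; nlinarith
  have hmz : ‖m - z‖ = r / (q + r) * ‖x - z‖ := by
    have : m - z = (r / (q + r)) • (x - z) := by
      have e : z = (r / (q + r)) • z + (q / (q + r)) • z := by
        rw [← add_smul]
        have : r / (q + r) + q / (q + r) = 1 := by field_simp; ring
        rw [this, one_smul]
      rw [hm]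
      nth_rewrite 2 [e]
      rw [smul_sub]; abel
    rw [this, norm_smul, Real.norm_of_nonneg (by positivity)]
  have i0 : Integrable fun y : RSpace n => heatKer v (y - m) :=
    (integrable_heatKer hv0).comp_sub_right m
  have i1 : Integrable fun y => heatKer v (y - m) * χ y :=
    i0.mul_bdd (c := 1) hc.aestronglyMeasurable
      (ae_of_all _ fun y => by rw [Real.norm_of_nonneg (h0 y)]; exact h1 y)
  have hk : ∀ y, 0 ≤ heatKer v (y - m) := fun y => (heatKer_pos hv0 _).le
  have eM : (∫⁻ y, ENNReal.ofReal (heatKer v (y - m)) * ENNReal.ofReal (χ y)) =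
      ENNReal.ofReal (∫ y, heatKer v (y - m) * χ y) := by
    rw [ofReal_integral_eq_lintegral_ofReal i1
      (ae_of_all _ fun y => mul_nonneg (hk y) (h0 y))]
    exact lintegral_congr fun y => (ENNReal.ofReal_mul (hk y)).symm
  have hM0 : 0 ≤ ∫ y, heatKer v (y - m) * χ y :=
    integral_nonneg fun y => mul_nonneg (hk y) (h0 y)
  have hM1 : ∫ y, heatKer v (y - m) * χ y ≤ 1 := by
    have : ∫ y, heatKer v (y - m) * χ y ≤ ∫ y, heatKer v (y - m) :=
      integral_mono i1 i0 fun y => mul_le_of_le_one_right (hk y) (h1 y)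
    rwa [integral_sub_right_eq_self (fun y => heatKer v y), integral_heatKer hv0] at this
  have hE : |(∫ y, heatKer v (y - m) * χ y) - χ z| ≤ cutErr K (q + r) r ‖x - z‖ := by
    apply le_min
    · rw [abs_le]; constructor <;> linarith [h0 z, h1 z]
    · refine (hχ v m z hv0).trans ?_
      rw [hmz]
      apply mul_le_mul_of_nonneg_left _ hK
      calc r / (q + r) * ‖x - z‖ + v ≤ r / (q + r) * ‖x - z‖ + r := by gcongr
        _ = _ := by ring
  have hE0 : 0 ≤ cutErr K (q + r) r ‖x - z‖ := (abs_nonneg _).trans hE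
  rw [abs_le] at hE
  rw [eM, ← ENNReal.ofReal_add (h0 z) hE0, ← ENNReal.ofReal_add hM0 hE0]
  exact ⟨ENNReal.ofReal_le_ofReal (by linarith), ENNReal.ofReal_le_ofReal (by linarith)⟩

/-- The total error made when a cutoff function is moved through a superposition of heat
averages. -/
noncomputable def errPot {n : ℕ} (a b : ℝ → ℝ≥0∞) (K : ℝ) (h : RSpace n → ℝ → ℝ≥0∞)
    (x : RSpace n) (t : ℝ) : ℝ≥0∞ :=
  ∫⁻ σ, ∫⁻ r, a (σ - r) * b r *
    ∫⁻ z, ENNReal.ofReal (heatKer σ (x - z)) *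
      (h z (t - σ) * ENNReal.ofReal (cutErr K σ r ‖x - z‖))

theorem measurable_errPot_integrand {n : ℕ} {a b : ℝ → ℝ≥0∞} (ha : Measurable a)
    (hb : Measurable b) (K : ℝ) {h : RSpace n → ℝ → ℝ≥0∞}
    (hh : Measurable fun p : RSpace n × ℝ => h p.1 p.2) (x : RSpace n) (t : ℝ) :
    Measurable fun p : ℝ × ℝ => a (p.1 - p.2) * b p.2 *
      ∫⁻ z, ENNReal.ofReal (heatKer p.1 (x - z)) *
        (h z (t - p.1) * ENNReal.ofReal (cutErr K p.1 p.2 ‖x - z‖)) := by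
  have m1 : Measurable fun q : (ℝ × ℝ) × RSpace n => ENNReal.ofReal (heatKer q.1.1 (x - q.2)) *
      (h q.2 (t - q.1.1) * ENNReal.ofReal (cutErr K q.1.1 q.1.2 ‖x - q.2‖)) := by
    refine (measurable_heatKer (by fun_prop) (by fun_prop)).ennreal_ofReal.mul
      ((measurable_uncurry_comp hh (by fun_prop) (by fun_prop)).mul ?_)
    unfold cutErr
    fun_prop
  have m2 : Measurable fun p : ℝ × ℝ => ∫⁻ z, ENNReal.ofReal (heatKer p.1 (x - z)) *
        (h z (t - p.1) * ENNReal.ofReal (cutErr K p.1 p.2 ‖x - z‖)) :=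
    Measurable.lintegral_prod_right' m1
  exact ((ha.comp (by fun_prop : Measurable fun p : ℝ × ℝ => p.1 - p.2)).mul
    (hb.comp measurable_snd)).mul m2

/-- Moving a cutoff function through a superposition of heat averages. -/
theorem cutoff_comparison {n : ℕ} {a b : ℝ → ℝ≥0∞} (ha : Measurable a) (hb : Measurable b)
    (ha0 : ∀ ρ ≤ 0, a ρ = 0) (hb0 : ∀ ρ ≤ 0, b ρ = 0)
    {h : RSpace n → ℝ → ℝ≥0∞} (hh : Measurable fun p : RSpace n × ℝ => h p.1 p.2)
    {K : ℝ} {χ : RSpace n → ℝ} (hK : 0 ≤ K) (hc : Continuous χ)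
    (h0 : ∀ y, 0 ≤ χ y) (h1 : ∀ y, χ y ≤ 1)
    (hχ : ∀ (v : ℝ) (m z : RSpace n), 0 < v →
      |(∫ y, heatKer v (y - m) * χ y) - χ z| ≤ K * (‖m - z‖ + v))
    (x : RSpace n) (t : ℝ) :
    heatPot a (fun y τ => ENNReal.ofReal (χ y) * heatPot b h y τ) x t ≤
      heatPot (lconv a b) (fun y τ => ENNReal.ofReal (χ y) * h y τ) x t + errPot a b K h x t ∧
    heatPot (lconv a b) (fun y τ => ENNReal.ofReal (χ y) * h y τ) x t ≤
      heatPot a (fun y τ => ENNReal.ofReal (χ y) * heatPot b h y τ) x t +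
        errPot a b K h x t := by
  have mχ : Measurable fun y => ENNReal.ofReal (χ y) := hc.measurable.ennreal_ofReal
  have mE := measurable_errPot_integrand ha hb K hh x t
  have mE1 : Measurable fun σ => ∫⁻ r, a (σ - r) * b r *
      ∫⁻ z, ENNReal.ofReal (heatKer σ (x - z)) *
        (h z (t - σ) * ENNReal.ofReal (cutErr K σ r ‖x - z‖)) :=
    Measurable.lintegral_prod_right' mE
  have mE2 : ∀ σ, Measurable fun r => a (σ - r) * b r *
      ∫⁻ z, ENNReal.ofReal (heatKer σ (x - z)) *
        (h z (t - σ) * ENNReal.ofReal (cutErr K σ r ‖x - z‖)) :=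
    fun σ => mE.comp measurable_prodMk_left
  have eY : heatPot a (fun y τ => ENNReal.ofReal (χ y) * heatPot b h y τ) x t =
      ∫⁻ σ, ∫⁻ r, a (σ - r) * b r * ∫⁻ y, ENNReal.ofReal (heatKer (σ - r) (x - y)) *
        ENNReal.ofReal (χ y) * heatAvg h y (t - (σ - r)) r := by
    rw [← lintegral_weighted_heatPot ha hb hh mχ]
    unfold heatPot heatAvg
    simp only [mul_assoc]
  have eF : heatPot (lconv a b) (fun y τ => ENNReal.ofReal (χ y) * h y τ) x t =
      ∫⁻ σ, ∫⁻ r, a (σ - r) * b r * ∫⁻ z, ENNReal.ofReal (heatKer σ (x - z)) *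
        (ENNReal.ofReal (χ z) * h z (t - σ)) := by
    unfold heatPot lconv heatAvg
    refine lintegral_congr fun σ => ?_
    rw [lintegral_mul_const]
    exact (ha.comp (by fun_prop)).mul hb
  -- For each total lag σ and last lag r, the cutoff at the intermediate point y is replaced by the
  -- cutoff at the endpoint z.
  have key : ∀ σ r : ℝ,
      (a (σ - r) * b r * ∫⁻ y, ENNReal.ofReal (heatKer (σ - r) (x - y)) *
        ENNReal.ofReal (χ y) * heatAvg h y (t - (σ - r)) r) ≤
      (a (σ - r) * b r * ∫⁻ z, ENNReal.ofReal (heatKer σ (x - z)) *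
        (ENNReal.ofReal (χ z) * h z (t - σ))) + (a (σ - r) * b r *
      ∫⁻ z, ENNReal.ofReal (heatKer σ (x - z)) *
        (h z (t - σ) * ENNReal.ofReal (cutErr K σ r ‖x - z‖))) ∧
      (a (σ - r) * b r * ∫⁻ z, ENNReal.ofReal (heatKer σ (x - z)) *
        (ENNReal.ofReal (χ z) * h z (t - σ))) ≤
      (a (σ - r) * b r * ∫⁻ y, ENNReal.ofReal (heatKer (σ - r) (x - y)) *
        ENNReal.ofReal (χ y) * heatAvg h y (t - (σ - r)) r) + (a (σ - r) * b r *
      ∫⁻ z, ENNReal.ofReal (heatKer σ (x - z)) *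
        (h z (t - σ) * ENNReal.ofReal (cutErr K σ r ‖x - z‖))) := by
    intro σ r
    rcases le_or_gt r 0 with hr | hr
    · simp [hb0 r hr]
    rcases le_or_gt (σ - r) 0 with hq | hq
    · simp [ha0 _ hq]
    rw [lintegral_heatKer_mul_heatAvg hh mχ hq hr, sub_add_cancel, ← mul_add, ← mul_add]
    have mk : Measurable fun z : RSpace n => ENNReal.ofReal (heatKer σ (x - z)) *
        (h z (t - σ) * ENNReal.ofReal (cutErr K σ r ‖x - z‖)) := by
      refine (measurable_heatKer (by fun_prop) (by fun_prop)).ennreal_ofReal.mul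
        ((measurable_uncurry_comp hh (by fun_prop) (by fun_prop)).mul ?_)
      unfold cutErr
      fun_prop
    rw [← lintegral_add_right _ mk, ← lintegral_add_right _ mk]
    have hb := fun z => abs_heatKer_cutoff_sub_le hK hc h0 h1 hχ hq hr x z
    simp only [sub_add_cancel] at hb
    constructor
    · refine mul_le_mul' le_rfl (lintegral_mono fun z => ?_)
      dsimp only
      calc _ ≤ ENNReal.ofReal (heatKer σ (x - z)) * h z (t - σ) * (ENNReal.ofReal (χ z) +
            ENNReal.ofReal (cutErr K σ r ‖x - z‖)) := mul_le_mul' le_rfl (hb z).1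
        _ = _ := by ring
    · refine mul_le_mul' le_rfl (lintegral_mono fun z => ?_)
      dsimp only
      calc _ = ENNReal.ofReal (heatKer σ (x - z)) * h z (t - σ) * ENNReal.ofReal (χ z) := by ring
        _ ≤ _ := mul_le_mul' le_rfl (hb z).2
        _ = _ := by ring
  rw [eY, eF]
  unfold errPot
  constructor
  · rw [← lintegral_add_right _ mE1]
    refine lintegral_mono fun σ => ?_
    dsimp only
    rw [← lintegral_add_right _ (mE2 σ)]
    exact lintegral_mono fun r => (key σ r).1
  · rw [← lintegral_add_right _ mE1]
    refine lintegral_mono fun σ => ?_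
    dsimp only
    rw [← lintegral_add_right _ (mE2 σ)]
    exact lintegral_mono fun r => (key σ r).2

theorem errPot_mono {n : ℕ} {a b b' : ℝ → ℝ≥0∞} (hb : ∀ r, b r ≤ b' r) (K : ℝ)
    (h : RSpace n → ℝ → ℝ≥0∞) (x : RSpace n) (t : ℝ) :
    errPot a b K h x t ≤ errPot a b' K h x t :=
  lintegral_mono fun _ => lintegral_mono fun r =>
    mul_le_mul' (mul_le_mul' le_rfl (hb r)) le_rfl

theorem tendsto_heatPot {n : ℕ} {a : ℕ → ℝ → ℝ≥0∞} {A : ℝ → ℝ≥0∞}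
    {h : ℕ → RSpace n → ℝ → ℝ≥0∞} {H : RSpace n → ℝ → ℝ≥0∞} (ma : ∀ k, Measurable (a k))
    (mh : ∀ k, Measurable fun p : RSpace n × ℝ => h k p.1 p.2)
    (ha : ∀ σ, Monotone fun k => a k σ) (hh : ∀ y τ, Monotone fun k => h k y τ)
    (hA : ∀ σ, ∀ᶠ k in atTop, a k σ = A σ) (hH : ∀ y τ, ∀ᶠ k in atTop, h k y τ = H y τ)
    (hfin : ∀ σ, A σ ≠ ∞) (x : RSpace n) (t : ℝ) :
    Tendsto (fun k => heatPot (a k) (h k) x t) atTop (𝓝 (heatPot A H x t)) := by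
  have hav : ∀ σ, Tendsto (fun k => heatAvg (h k) x t σ) atTop (𝓝 (heatAvg H x t σ)) := by
    intro σ
    apply lintegral_tendsto_of_tendsto_of_monotone
    · exact fun k => ((measurable_heatKer measurable_const
        (by fun_prop)).ennreal_ofReal.mul
        (measurable_uncurry_comp (mh k) measurable_id measurable_const)).aemeasurable
    · exact ae_of_all _ fun y i j hij => mul_le_mul' le_rfl (hh _ _ hij)
    · exact ae_of_all _ fun y => tendsto_const_nhds.congr' ((hH y (t - σ)).mono fun k hk => by
        dsimp only; rw [hk])
  apply lintegral_tendsto_of_tendsto_of_monotone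
  · exact fun k => ((ma k).mul (measurable_heatAvg (mh k) measurable_const measurable_const
      measurable_id)).aemeasurable
  · exact ae_of_all _ fun σ i j hij => mul_le_mul' (ha _ hij)
      (lintegral_mono fun y => mul_le_mul' le_rfl (hh _ _ hij))
  · refine ae_of_all _ fun σ => ?_
    refine (ENNReal.Tendsto.const_mul (hav σ) (Or.inr (hfin σ))).congr' ?_
    exact (hA σ).mono fun k hk => by dsimp only; rw [hk]

theorem tendsto_heatPot_zero {n : ℕ} {a : ℝ → ℝ≥0∞} (ha : Measurable a) (hfin : ∀ σ, a σ ≠ ∞)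
    {h : RSpace n → ℝ → ℝ≥0∞} {hk : ℕ → RSpace n → ℝ → ℝ≥0∞}
    (mh : Measurable fun p : RSpace n × ℝ => h p.1 p.2)
    (mhk : ∀ k, Measurable fun p : RSpace n × ℝ => hk k p.1 p.2)
    (hle : ∀ k y τ, hk k y τ ≤ h y τ) (x : RSpace n) (t : ℝ) (hpot : heatPot a h x t ≠ ∞)
    (hlim : ∀ y τ, Tendsto (fun k => hk k y τ) atTop (𝓝 0)) :
    Tendsto (fun k => heatPot a (hk k) x t) atTop (𝓝 0) := by
  have mker : ∀ {g : RSpace n → ℝ → ℝ≥0∞}, (Measurable fun p : RSpace n × ℝ => g p.1 p.2) →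
      ∀ σ, Measurable fun y => ENNReal.ofReal (heatKer σ (x - y)) * g y (t - σ) :=
    fun hg σ => (measurable_heatKer measurable_const (by fun_prop)).ennreal_ofReal.mul
      (measurable_uncurry_comp hg measurable_id measurable_const)
  have mav : ∀ {g : RSpace n → ℝ → ℝ≥0∞}, (Measurable fun p : RSpace n × ℝ => g p.1 p.2) →
      Measurable fun σ => a σ * heatAvg g x t σ :=
    fun hg => ha.mul (measurable_heatAvg hg measurable_const measurable_const measurable_id)
  have hz : (∫⁻ _ : ℝ, (0 : ℝ≥0∞)) = 0 := lintegral_zero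
  rw [← hz]
  refine tendsto_lintegral_of_dominated_convergence (fun σ => a σ * heatAvg h x t σ)
    (fun k => mav (mhk k)) (fun k => ae_of_all _ fun σ => mul_le_mul' le_rfl
      (lintegral_mono fun y => mul_le_mul' le_rfl (hle k _ _))) hpot ?_
  filter_upwards [ae_lt_top (mav mh) hpot] with σ hσ
  rcases eq_or_ne (a σ) 0 with h0 | h0
  · simp [h0]
  have hav : heatAvg h x t σ ≠ ∞ := fun h' => by
    rw [h', ENNReal.mul_top h0] at hσ; exact lt_irrefl _ hσ
  have h1 : Tendsto (fun k => heatAvg (hk k) x t σ) atTop (𝓝 0) := by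
    have hz : (∫⁻ _ : RSpace n, (0 : ℝ≥0∞)) = 0 := lintegral_zero
    rw [← hz]
    refine tendsto_lintegral_of_dominated_convergence _ (fun k => mker (mhk k) σ)
      (fun k => ae_of_all _ fun y => mul_le_mul' le_rfl (hle k _ _)) hav ?_
    refine ae_of_all _ fun y => ?_
    have := ENNReal.Tendsto.const_mul (a := ENNReal.ofReal (heatKer σ (x - y)))
      (hlim y (t - σ)) (Or.inr ENNReal.ofReal_ne_top)
    rwa [mul_zero] at this
  have := ENNReal.Tendsto.const_mul (a := a σ) h1 (Or.inr (hfin σ))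
  rwa [mul_zero] at this

/-- For ‖z‖ ≥ 1 the factor 1 + ‖z‖/σ is at most ‖z‖²(1 + 1/σ); exchanging ‖z‖² for σ removes the
singularity and leaves a multiple of the tail kernel. -/
theorem heatKer_mul_one_add_le {n : ℕ} {s N σ : ℝ} (hs : 0 < s) (hσ : 0 < σ) (hσN : σ < N)
    {z : RSpace n} (hz : 1 ≤ ‖z‖) :
    heatKer σ z * (1 + ‖z‖ / σ) ≤ 8 * 2 ^ ((n : ℝ) / 2) * (N + 1) * N ^ (1 + s) *
      (σ ^ (-((n : ℝ) / 2 + 1 + s)) * Real.exp (-‖z‖ ^ 2 / (8 * σ))) := by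
  have hk := heatKer_pos hσ z
  have hk2 := heatKer_pos (by linarith : 0 < 2 * σ) z
  have hN : 0 < N := hσ.trans hσN
  have h1 := sq_mul_heatKer_le hσ z
  have h2 : 1 + ‖z‖ / σ ≤ ‖z‖ ^ 2 * (1 + 1 / σ) := by
    have e : ‖z‖ ≤ ‖z‖ ^ 2 := by nlinarith
    have e1 : 1 ≤ ‖z‖ ^ 2 := by nlinarith
    have e2 : ‖z‖ / σ ≤ ‖z‖ ^ 2 / σ := by gcongr
    calc _ ≤ ‖z‖ ^ 2 + ‖z‖ ^ 2 / σ := add_le_add e1 e2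
      _ = _ := by ring
  have h3 : heatKer (2 * σ) z ≤ N ^ (1 + s) *
      (σ ^ (-((n : ℝ) / 2 + 1 + s)) * Real.exp (-‖z‖ ^ 2 / (8 * σ))) := by
    have e1 : (4 * Real.pi * (2 * σ)) ^ (-((n : ℝ) / 2)) ≤ σ ^ (-((n : ℝ) / 2)) := by
      apply Real.rpow_le_rpow_of_nonpos hσ
      · nlinarith [Real.pi_gt_three]
      · have : (0 : ℝ) ≤ n := n.cast_nonneg
        linarith
    have e2 : σ ^ (-((n : ℝ) / 2)) = σ ^ (1 + s) * σ ^ (-((n : ℝ) / 2 + 1 + s)) := by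
      rw [← Real.rpow_add hσ]; congr 1; ring
    have e3 : σ ^ (1 + s) ≤ N ^ (1 + s) := Real.rpow_le_rpow hσ.le hσN.le (by linarith)
    unfold heatKer
    rw [show 4 * (2 * σ) = 8 * σ by ring]
    calc _ ≤ σ ^ (-((n : ℝ) / 2)) * Real.exp (-‖z‖ ^ 2 / (8 * σ)) := by gcongr
      _ = σ ^ (1 + s) * (σ ^ (-((n : ℝ) / 2 + 1 + s)) * Real.exp (-‖z‖ ^ 2 / (8 * σ))) := by
        rw [e2]; ring
      _ ≤ _ := by gcongr
  calc heatKer σ z * (1 + ‖z‖ / σ) ≤ heatKer σ z * (‖z‖ ^ 2 * (1 + 1 / σ)) := by gcongr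
    _ = (‖z‖ ^ 2 * heatKer σ z) * (1 + 1 / σ) := by ring
    _ ≤ (8 * 2 ^ ((n : ℝ) / 2) * σ * heatKer (2 * σ) z) * (1 + 1 / σ) := by gcongr
    _ = 8 * 2 ^ ((n : ℝ) / 2) * (σ + 1) * heatKer (2 * σ) z := by field_simp
    _ ≤ 8 * 2 ^ ((n : ℝ) / 2) * (N + 1) * (N ^ (1 + s) *
      (σ ^ (-((n : ℝ) / 2 + 1 + s)) * Real.exp (-‖z‖ ^ 2 / (8 * σ)))) := by gcongr
    _ = _ := by ring

/-- Within distance 1 of x the function is bounded and the weight ‖x-z‖/σ costs σ^{-1/2}, which is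
integrable at 0; beyond distance 1 the integrand is dominated by the tail kernel. -/
theorem SlowlyIncreasing.lintegral_near_ne_top {n : ℕ} {s : ℝ} (hs : 0 < s) {α : ℝ}
    {u : RSpace n → ℝ → ℝ} (hreg : ParabolicHolderLoc α u) (hu : SlowlyIncreasing s u)
    {N : ℝ} (x : RSpace n) (t : ℝ) :
    ∫⁻ σ in Ioo 0 N, ∫⁻ z, ENNReal.ofReal (heatKer σ (x - z)) *
      (ENNReal.ofReal (u z (t - σ)) * ENNReal.ofReal (1 + ‖x - z‖ / σ)) ≠ ∞ := by
  have hc : Continuous fun p : RSpace n × ℝ => u p.1 p.2 := hreg.continuous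
  obtain ⟨C, -, hC⟩ := hu.tailPot_le hs hc (R := max ‖x‖ |t|) (by positivity) one_pos
  have hC := hC x t (le_max_left _ _) (le_max_right _ _)
  obtain ⟨B, hB0, hB⟩ := hreg.bounded (‖x‖ + 1 + |t| + |N|)
  set c : ℝ := 8 * 2 ^ ((n : ℝ) / 2) with hcdef
  have hc0 : 0 < c := by positivity
  set c' : ℝ := c * (N + 1) * N ^ (1 + s) with hc'
  set T : ℝ → RSpace n → ℝ≥0∞ := fun σ z => if 0 < σ ∧ 1 ≤ ‖x - z‖ ^ 2 + σ then
    ENNReal.ofReal (σ ^ (-((n : ℝ) / 2 + 1 + s)) * Real.exp (-‖x - z‖ ^ 2 / (8 * σ))) *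
      ENNReal.ofReal (u z (t - σ)) else 0 with hT
  have mT : Measurable fun p : ℝ × RSpace n => T p.1 p.2 :=
    measurable_tailPot_integrand s 1 (h := fun z τ => ENNReal.ofReal (u z τ))
      (measurable_toENNReal hc) x t
  have hle : ∀ σ ∈ Ioo 0 N, ∫⁻ z, ENNReal.ofReal (heatKer σ (x - z)) *
      (ENNReal.ofReal (u z (t - σ)) * ENNReal.ofReal (1 + ‖x - z‖ / σ)) ≤
      ENNReal.ofReal (B * (1 + (1 + c) * σ ^ (-(1 / 2) : ℝ))) +
        ENNReal.ofReal c' * ∫⁻ z, T σ z := by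
    intro σ hσ
    have hσ0 := hσ.1
    have hN : 0 < N := hσ0.trans hσ.2
    have hmT : Measurable fun z => T σ z := mT.comp measurable_prodMk_left
    set p : ℝ := σ ^ (-(1 / 2) : ℝ) with hp
    have hp0 : 0 < p := by positivity
    have mk1 : Measurable fun z : RSpace n => ENNReal.ofReal (heatKer σ (x - z)) :=
      (measurable_heatKer measurable_const (by fun_prop)).ennreal_ofReal
    have mk2 : Measurable fun z : RSpace n => ENNReal.ofReal (heatKer (2 * σ) (x - z)) :=
      (measurable_heatKer measurable_const (by fun_prop)).ennreal_ofReal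
    have e1 : ENNReal.ofReal (B * (1 + (1 + c) * p)) =
        ∫⁻ z : RSpace n, (ENNReal.ofReal (B * (1 + p)) * ENNReal.ofReal (heatKer σ (x - z)) +
          ENNReal.ofReal (B * (p * c)) * ENNReal.ofReal (heatKer (2 * σ) (x - z))) := by
      rw [lintegral_add_left (mk1.const_mul _), lintegral_const_mul _ mk1,
        lintegral_const_mul _ mk2, lintegral_heatKer_sub hσ0, lintegral_heatKer_sub (by linarith),
        mul_one, mul_one, ← ENNReal.ofReal_add (by positivity) (by positivity)]
      congr 1; ring
    rw [e1, ← lintegral_const_mul _ hmT, ← lintegral_add_right _ (hmT.const_mul _)]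
    refine lintegral_mono fun z => ?_
    dsimp only
    have hk1 := heatKer_pos hσ0 (x - z)
    have hk2 := heatKer_pos (by linarith : 0 < 2 * σ) (x - z)
    have hd : 0 ≤ 1 + ‖x - z‖ / σ := by positivity
    rcases lt_or_ge ‖x - z‖ 1 with h1 | h1
    · refine le_trans ?_ le_self_add
      have hub : u z (t - σ) ≤ B := by
        refine (le_abs_self _).trans (hB z (t - σ) ?_ ?_)
        · have : ‖z‖ ≤ ‖x‖ + ‖x - z‖ := by
            calc ‖z‖ = ‖x - (x - z)‖ := by rw [sub_sub_cancel]
              _ ≤ _ := norm_sub_le _ _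
          linarith [abs_nonneg t, abs_nonneg N]
        · have h2 := abs_sub t σ
          rw [abs_of_pos hσ0] at h2
          linarith [norm_nonneg x, le_abs_self N, hσ.2]
      have h3 := rpow_mul_heatKer_le (by norm_num : (0 : ℝ) ≤ 1 / 2) (by norm_num) hσ0 (x - z)
      rw [show (2 : ℝ) * (1 / 2) = 1 by norm_num, Real.rpow_one] at h3
      have h4 : σ ^ (1 / 2 : ℝ) / σ = p := by
        rw [hp, ← Real.rpow_sub_one hσ0.ne']; norm_num
      have h5 : heatKer σ (x - z) * (1 + ‖x - z‖ / σ) ≤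
          (1 + p) * heatKer σ (x - z) + p * c * heatKer (2 * σ) (x - z) := by
        calc _ = heatKer σ (x - z) + (‖x - z‖ * heatKer σ (x - z)) / σ := by ring
          _ ≤ heatKer σ (x - z) + (σ ^ (1 / 2 : ℝ) * (heatKer σ (x - z) +
              c * heatKer (2 * σ) (x - z))) / σ := by gcongr
          _ = heatKer σ (x - z) + (σ ^ (1 / 2 : ℝ) / σ) * (heatKer σ (x - z) +
              c * heatKer (2 * σ) (x - z)) := by ring
          _ = _ := by rw [h4]; ring
      have e2 : ENNReal.ofReal (B * (1 + p)) * ENNReal.ofReal (heatKer σ (x - z)) +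
          ENNReal.ofReal (B * (p * c)) * ENNReal.ofReal (heatKer (2 * σ) (x - z)) =
          ENNReal.ofReal (B * (1 + p) * heatKer σ (x - z) +
            B * (p * c) * heatKer (2 * σ) (x - z)) := by
        rw [← ENNReal.ofReal_mul (by positivity), ← ENNReal.ofReal_mul (by positivity),
          ← ENNReal.ofReal_add (by positivity) (by positivity)]
      rw [e2]
      calc _ ≤ ENNReal.ofReal (heatKer σ (x - z)) *
            (ENNReal.ofReal B * ENNReal.ofReal (1 + ‖x - z‖ / σ)) :=
            mul_le_mul' le_rfl (mul_le_mul' (ENNReal.ofReal_le_ofReal hub) le_rfl)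
        _ = ENNReal.ofReal (heatKer σ (x - z) * (B * (1 + ‖x - z‖ / σ))) := by
            rw [← ENNReal.ofReal_mul hB0, ← ENNReal.ofReal_mul hk1.le]
        _ ≤ _ := by
            apply ENNReal.ofReal_le_ofReal
            calc _ = B * (heatKer σ (x - z) * (1 + ‖x - z‖ / σ)) := by ring
              _ ≤ B * ((1 + p) * heatKer σ (x - z) + p * c * heatKer (2 * σ) (x - z)) := by gcongr
              _ = _ := by ring
    · refine le_trans ?_ le_add_self
      have h2 : 0 < σ ∧ 1 ≤ ‖x - z‖ ^ 2 + σ := ⟨hσ0, by nlinarith⟩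
      rw [hT]; dsimp only
      have hc0' : 0 ≤ c' := by positivity
      rw [if_pos h2, ← mul_assoc (ENNReal.ofReal c'), ← ENNReal.ofReal_mul hc0']
      calc ENNReal.ofReal (heatKer σ (x - z)) *
            (ENNReal.ofReal (u z (t - σ)) * ENNReal.ofReal (1 + ‖x - z‖ / σ))
          = ENNReal.ofReal (heatKer σ (x - z)) * ENNReal.ofReal (1 + ‖x - z‖ / σ) *
            ENNReal.ofReal (u z (t - σ)) := by ring
        _ = ENNReal.ofReal (heatKer σ (x - z) * (1 + ‖x - z‖ / σ)) *
            ENNReal.ofReal (u z (t - σ)) := by rw [← ENNReal.ofReal_mul hk1.le]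
        _ ≤ _ := mul_le_mul' (ENNReal.ofReal_le_ofReal
            (heatKer_mul_one_add_le hs hσ0 hσ.2 h1)) le_rfl
  refine ne_top_of_le_ne_top ?_ (setLIntegral_mono' measurableSet_Ioo hle)
  have mT1 : Measurable fun σ => ∫⁻ z, T σ z := Measurable.lintegral_prod_right' mT
  rw [lintegral_add_right _ (mT1.const_mul _)]
  refine ENNReal.add_ne_top.2 ⟨?_, ?_⟩
  · have e : ∀ σ : ℝ, σ ∈ Ioo 0 N → ENNReal.ofReal (B * (1 + (1 + c) * σ ^ (-(1 / 2) : ℝ))) =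
        ENNReal.ofReal B * 1 +
          ENNReal.ofReal (B * (1 + c)) * ENNReal.ofReal (σ ^ (-(1 / 2) : ℝ)) := by
      intro σ hσ
      have := hσ.1
      rw [← ENNReal.ofReal_mul (by positivity), mul_one,
        ← ENNReal.ofReal_add hB0 (by positivity)]
      congr 1; ring
    rw [setLIntegral_congr_fun measurableSet_Ioo e, lintegral_add_left measurable_const,
      lintegral_const_mul' _ _ ENNReal.ofReal_ne_top, lintegral_const_mul' _ _ ENNReal.ofReal_ne_top,
      setLIntegral_const, Real.volume_Ioo]
    refine ENNReal.add_ne_top.2 ⟨?_, ?_⟩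
    · rw [one_mul]; exact ENNReal.mul_ne_top ENNReal.ofReal_ne_top ENNReal.ofReal_ne_top
    · refine ENNReal.mul_ne_top ENNReal.ofReal_ne_top ?_
      rcases le_total 0 N with h | h
      · rw [lintegral_Ioo_rpow (by norm_num) h]; exact ENNReal.ofReal_ne_top
      · rw [Ioo_eq_empty (not_lt.2 h)]; simp
  · rw [lintegral_const_mul' _ _ ENNReal.ofReal_ne_top]
    refine ENNReal.mul_ne_top ENNReal.ofReal_ne_top
      (ne_top_of_le_ne_top ENNReal.ofReal_ne_top (le_trans (setLIntegral_le_lintegral _ _) hC))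

/-- Past 2N one has σ - N ≥ σ/2, so the exit density decays like σ^{-1-s}; its singularity at N is
left out. -/
theorem exitW_le_levyW {s N σ : ℝ} (hs0 : 0 < s) (hs1 : s < 1) (hN : 0 < N) (hσ : 2 * N ≤ σ) :
    exitW s N σ ≤ ENNReal.ofReal (stableConst s * (N ^ s * 2 ^ s) * (Real.Gamma (1 - s) / s)) *
      levyW s N σ := by
  have hC := stableConst_pos hs0 hs1
  have hΓ := Real.Gamma_pos_of_pos (by linarith : 0 < 1 - s)
  have hσ0 : 0 < σ := by linarith
  rw [exitW, if_pos (by linarith), levyW, if_pos (by linarith), ← ENNReal.ofReal_mul (by positivity)]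
  apply ENNReal.ofReal_le_ofReal
  have h1 : (σ / 2) ^ s ≤ (σ - N) ^ s := Real.rpow_le_rpow (by positivity) (by linarith) hs0.le
  have h2 : σ ^ (-1 - s) = (σ * σ ^ s)⁻¹ := by
    rw [mul_inv, ← Real.rpow_neg hσ0.le, ← Real.rpow_neg_one, ← Real.rpow_add hσ0]; rfl
  calc stableConst s * (N ^ s / (σ * (σ - N) ^ s)) ≤
        stableConst s * (N ^ s / (σ * (σ / 2) ^ s)) := by gcongr
    _ = _ := by
      rw [h2, Real.div_rpow hσ0.le (by norm_num)]
      have : 0 < σ ^ s := by positivity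
      field_simp

theorem SlowlyIncreasing.heatPot_exitW_far_ne_top {n : ℕ} {s : ℝ} (hs0 : 0 < s) (hs1 : s < 1)
    {u : RSpace n → ℝ → ℝ}
    (hu : SlowlyIncreasing s u) (hc : Continuous fun p : RSpace n × ℝ => u p.1 p.2)
    {N : ℝ} (hN : 0 < N) (x : RSpace n) (t : ℝ) :
    heatPot (fun σ => if 2 * N ≤ σ then exitW s N σ else 0) (fun z τ => ENNReal.ofReal (u z τ)) x t
      ≠ ∞ := by
  set c := ENNReal.ofReal (stableConst s * (N ^ s * 2 ^ s) * (Real.Gamma (1 - s) / s)) with hcc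
  have h : heatPot (fun σ => if 2 * N ≤ σ then exitW s N σ else 0)
      (fun z τ => ENNReal.ofReal (u z τ)) x t ≤
      heatPot (fun σ => c * levyW s N σ) (fun z τ => ENNReal.ofReal (u z τ)) x t := by
    refine heatPot_mono (fun σ => ?_) (fun _ _ => le_rfl) x t
    split_ifs with h
    · exact exitW_le_levyW hs0 hs1 hN h
    · exact zero_le
  refine ne_top_of_le_ne_top ?_ h
  rw [heatPot_const_mul (measurable_levyW s N) (measurable_toENNReal hc)]
  exact ENNReal.mul_ne_top ENNReal.ofReal_ne_top (hu.heatPot_levyW_ne_top hs0 hs1 hc hN x t)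

/-- The untruncated Lévy density has infinite mass, but the cutoff error is linear in r, and
r·r^{-1-s} = r^{-s} convolved with the Riesz density has total mass independent of σ. This treats σ
< 2N, including the exit singularity at σ = N. For σ ≥ 2N the convolution is the exit density, and r
≤ σ makes the error independent of r. -/
theorem errPot_le {n : ℕ} {s : ℝ} (hs0 : 0 < s) (hs1 : s < 1) {N : ℝ} (hN : 0 < N) {K : ℝ}
    (hK : 0 ≤ K) {h : RSpace n → ℝ → ℝ≥0∞}
    (x : RSpace n) (t : ℝ) :
    errPot (rieszTrunc s N) (levyW s 0) K h x t ≤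
      ENNReal.ofReal (K * s) * (∫⁻ σ in Ioo 0 (2 * N), ∫⁻ z, ENNReal.ofReal (heatKer σ (x - z)) *
        (h z (t - σ) * ENNReal.ofReal (1 + ‖x - z‖ / σ))) +
      heatPot (fun σ => if 2 * N ≤ σ then exitW s N σ else 0)
        (fun z τ => h z τ * ENNReal.ofReal (min 1 (K * (t - τ + ‖x - z‖)))) x t := by
  have hΓ := Real.Gamma_pos_of_pos (by linarith : 0 < 1 - s)
  set Q : ℝ → ℝ≥0∞ := fun σ => ∫⁻ z, ENNReal.ofReal (heatKer σ (x - z)) *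
        (h z (t - σ) * ENNReal.ofReal (1 + ‖x - z‖ / σ)) with hQ
  have ma := measurable_rieszTrunc s N
  have mb := measurable_levyW s 0
  have hsplit : errPot (rieszTrunc s N) (levyW s 0) K h x t =
      (∫⁻ σ in Ioo 0 (2 * N), ∫⁻ r, rieszTrunc s N (σ - r) * levyW s 0 r *
        ∫⁻ z, ENNReal.ofReal (heatKer σ (x - z)) *
          (h z (t - σ) * ENNReal.ofReal (cutErr K σ r ‖x - z‖))) +
      ∫⁻ σ in (Ioo 0 (2 * N))ᶜ, ∫⁻ r, rieszTrunc s N (σ - r) * levyW s 0 r *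
        ∫⁻ z, ENNReal.ofReal (heatKer σ (x - z)) *
          (h z (t - σ) * ENNReal.ofReal (cutErr K σ r ‖x - z‖)) :=
    (lintegral_add_compl _ measurableSet_Ioo).symm
  rw [hsplit]
  refine add_le_add ?_ ?_
  · rw [← lintegral_const_mul' _ _ ENNReal.ofReal_ne_top]
    refine setLIntegral_mono' measurableSet_Ioo fun σ hσ => ?_
    have hσ0 := hσ.1
    have h1 : ∀ r, rieszTrunc s N (σ - r) * levyW s 0 r *
        (∫⁻ z, ENNReal.ofReal (heatKer σ (x - z)) *
          (h z (t - σ) * ENNReal.ofReal (cutErr K σ r ‖x - z‖))) ≤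
        rieszW s (σ - r) * rieszW (1 - s) r * (ENNReal.ofReal (K * s) * Q σ) := by
      intro r
      rcases le_or_gt r 0 with hr | hr
      · rw [levyW_zero le_rfl hr, mul_zero, zero_mul]; exact zero_le
      have e1 : rieszTrunc s N (σ - r) ≤ rieszW s (σ - r) := by
        unfold rieszTrunc rieszW
        split_ifs with h1 h2 h2
        · exact le_rfl
        · exact absurd h1.1 h2
        · exact zero_le
        · exact le_rfl
      have e2 : levyW s 0 r * ENNReal.ofReal (K * r) = rieszW (1 - s) r * ENNReal.ofReal (K * s) := by
        rw [levyW, if_pos hr, rieszW, if_pos hr, ← ENNReal.ofReal_mul (by positivity),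
          ← ENNReal.ofReal_mul (by positivity)]
        congr 1
        rw [show (1 - s - 1 : ℝ) = -1 - s + 1 by ring, Real.rpow_add_one hr.ne']
        ring
      have e3 : (∫⁻ z, ENNReal.ofReal (heatKer σ (x - z)) *
          (h z (t - σ) * ENNReal.ofReal (cutErr K σ r ‖x - z‖))) ≤ ENNReal.ofReal (K * r) * Q σ := by
        rw [hQ]; dsimp only
        rw [← lintegral_const_mul' _ _ ENNReal.ofReal_ne_top]
        refine lintegral_mono fun z => ?_
        dsimp only
        have : ENNReal.ofReal (cutErr K σ r ‖x - z‖) ≤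
            ENNReal.ofReal (K * r) * ENNReal.ofReal (1 + ‖x - z‖ / σ) := by
          rw [← ENNReal.ofReal_mul (by positivity)]
          exact ENNReal.ofReal_le_ofReal ((min_le_right _ _).trans (le_of_eq (by ring)))
        calc _ ≤ ENNReal.ofReal (heatKer σ (x - z)) * (h z (t - σ) *
              (ENNReal.ofReal (K * r) * ENNReal.ofReal (1 + ‖x - z‖ / σ))) :=
              mul_le_mul' le_rfl (mul_le_mul' le_rfl this)
          _ = _ := by ring
      calc _ ≤ rieszW s (σ - r) * levyW s 0 r * (ENNReal.ofReal (K * r) * Q σ) :=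
            mul_le_mul' (mul_le_mul' e1 le_rfl) e3
        _ = rieszW s (σ - r) * (levyW s 0 r * ENNReal.ofReal (K * r)) * Q σ := by ring
        _ = _ := by rw [e2]; ring
    refine (lintegral_mono h1).trans (le_of_eq ?_)
    have m1 : Measurable fun r => rieszW s (σ - r) * rieszW (1 - s) r :=
      ((measurable_rieszW s).comp (by fun_prop)).mul (measurable_rieszW (1 - s))
    rw [lintegral_mul_const _ m1, lintegral_beta hs0 hs1 hσ0, one_mul]
  · unfold heatPot
    refine le_trans ?_ (setLIntegral_le_lintegral (Ioo 0 (2 * N))ᶜ _)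
    refine setLIntegral_mono' measurableSet_Ioo.compl fun σ hσ => ?_
    rcases le_or_gt σ 0 with hσ0 | hσ0
    · refine le_trans (le_of_eq ?_) zero_le
      refine lintegral_eq_zero_of_ae_eq_zero (ae_of_all _ fun r => ?_)
      rcases le_or_gt r 0 with hr | hr
      · simp [levyW_zero le_rfl hr]
      · simp [rieszTrunc_zero (by linarith : σ - r ≤ 0)]
    have h2N : 2 * N ≤ σ := by
      by_contra h'
      exact hσ ⟨hσ0, not_le.1 h'⟩
    dsimp only
    rw [if_pos h2N, ← lconv_trunc_levy hs0 hs1 hN (by linarith : N < σ) (by linarith : 0 < σ - N)]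
    unfold lconv
    have m1 : Measurable fun r => rieszTrunc s N (σ - r) * levyW s 0 r :=
      (ma.comp (by fun_prop)).mul mb
    rw [← lintegral_mul_const _ m1]
    refine lintegral_mono fun r => ?_
    dsimp only
    rcases le_or_gt σ r with hr | hr
    · rw [rieszTrunc_zero (by linarith), zero_mul, zero_mul]; exact zero_le
    refine mul_le_mul' le_rfl (lintegral_mono fun z => mul_le_mul' le_rfl
      (mul_le_mul' le_rfl (ENNReal.ofReal_le_ofReal (min_le_min le_rfl ?_))))
    rw [sub_sub_cancel]
    apply mul_le_mul_of_nonneg_left _ hK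
    have hd := norm_nonneg (x - z)
    have : r * (1 + ‖x - z‖ / σ) ≤ σ * (1 + ‖x - z‖ / σ) := by gcongr
    refine this.trans (le_of_eq ?_)
    field_simp

/-- The short-lag part is proportional to K/(k+1). The long-lag part tends to 0 by dominated
convergence, the bound 1 in `cutErr` supplying the majorant: the exit potential of u past 2N. -/
theorem SlowlyIncreasing.tendsto_errPot {n : ℕ} {s : ℝ} (hs0 : 0 < s) (hs1 : s < 1) {α : ℝ}
    {u : RSpace n → ℝ → ℝ} (hreg : ParabolicHolderLoc α u) (hu : SlowlyIncreasing s u)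
    {N : ℝ} (hN : 0 < N) {K : ℝ} (hK : 0 ≤ K) (x : RSpace n) (t : ℝ) :
    Tendsto (fun k : ℕ => errPot (rieszTrunc s N) (levyW s 0) (K / ((k : ℝ) + 1))
      (fun z τ => ENNReal.ofReal (u z τ)) x t) atTop (𝓝 0) := by
  have hc : Continuous fun p : RSpace n × ℝ => u p.1 p.2 := hreg.continuous
  have mU := measurable_toENNReal hc
  have hKk : Tendsto (fun k : ℕ => K / ((k : ℝ) + 1)) atTop (𝓝 0) := by
    have := (tendsto_one_div_add_atTop_nhds_zero_nat (𝕜 := ℝ)).const_mul K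
    simpa [div_eq_mul_inv] using this
  have mexit : Measurable fun σ => if 2 * N ≤ σ then exitW s N σ else 0 :=
    Measurable.ite measurableSet_Ici (measurable_exitW s N) measurable_const
  have hexit : ∀ σ, (if 2 * N ≤ σ then exitW s N σ else 0) ≠ ∞ := by
    intro σ
    unfold exitW
    split_ifs <;> simp
  have h2 := tendsto_heatPot_zero mexit hexit mU
    (hk := fun k z τ => ENNReal.ofReal (u z τ) *
      ENNReal.ofReal (min 1 (K / ((k : ℝ) + 1) * (t - τ + ‖x - z‖))))
    (fun k => mU.mul (by fun_prop)) (fun k z τ => by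
      refine mul_le_of_le_one_right zero_le ?_
      rw [← ENNReal.ofReal_one]
      exact ENNReal.ofReal_le_ofReal (min_le_left _ _)) x t
    (hu.heatPot_exitW_far_ne_top hs0 hs1 hc hN x t) (fun z τ => by
      have h3 : Tendsto (fun k : ℕ => min 1 (K / ((k : ℝ) + 1) * (t - τ + ‖x - z‖))) atTop
          (𝓝 (min 1 (0 * (t - τ + ‖x - z‖)))) := tendsto_const_nhds.min (hKk.mul_const _)
      have h4 := ENNReal.Tendsto.const_mul (a := ENNReal.ofReal (u z τ))
        (ENNReal.tendsto_ofReal h3) (Or.inr ENNReal.ofReal_ne_top)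
      simpa using h4)
  have h1 := ENNReal.Tendsto.mul_const (b := ∫⁻ σ in Ioo 0 (2 * N), ∫⁻ z,
      ENNReal.ofReal (heatKer σ (x - z)) *
      (ENNReal.ofReal (u z (t - σ)) * ENNReal.ofReal (1 + ‖x - z‖ / σ)))
    (ENNReal.tendsto_ofReal (hKk.mul_const s))
    (Or.inr (hu.lintegral_near_ne_top hs0 hreg x t))
  have h3 := h1.add h2
  rw [zero_mul, ENNReal.ofReal_zero, zero_mul, add_zero] at h3
  exact tendsto_of_tendsto_of_tendsto_of_le_of_le tendsto_const_nhds h3 (fun _ => zero_le)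
    fun k => errPot_le hs0 hs1 hN (by positivity) x t

/-! ### Representation of a solution on a time slab -/

theorem heatPot_mono_on {n : ℕ} {a b : ℝ → ℝ≥0∞} {h k : RSpace n → ℝ → ℝ≥0∞} {x : RSpace n}
    {t : ℝ} (hab : ∀ᵐ σ, a σ ≤ b σ) (hhk : ∀ σ, a σ ≠ 0 → ∀ y, h y (t - σ) ≤ k y (t - σ)) :
    heatPot a h x t ≤ heatPot b k x t := by
  refine lintegral_mono_ae (hab.mono fun σ hσ => ?_)
  rcases eq_or_ne (a σ) 0 with h0 | h0
  · rw [h0, zero_mul]; exact zero_le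
  · exact mul_le_mul' hσ (lintegral_mono fun y => mul_le_mul' le_rfl (hhk σ h0 y))

theorem heatPot_add_right {n : ℕ} {a : ℝ → ℝ≥0∞} (ha : Measurable a)
    {h k : RSpace n → ℝ → ℝ≥0∞} (hh : Measurable fun p : RSpace n × ℝ => h p.1 p.2)
    (x : RSpace n) (t : ℝ) :
    heatPot a (fun y τ => h y τ + k y τ) x t = heatPot a h x t + heatPot a k x t := by
  have m0 : Measurable fun σ => a σ * heatAvg h x t σ :=
    ha.mul (measurable_heatAvg hh measurable_const measurable_const measurable_id)
  unfold heatPot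
  rw [← lintegral_add_left m0]
  refine lintegral_congr fun σ => ?_
  rw [← mul_add]
  congr 1
  have m : Measurable fun y => ENNReal.ofReal (heatKer σ (x - y)) * h y (t - σ) :=
    (measurable_heatKer measurable_const (by fun_prop)).ennreal_ofReal.mul
      (measurable_uncurry_comp hh measurable_id measurable_const)
  unfold heatAvg
  rw [← lintegral_add_left m]
  simp only [mul_add]

theorem heatPot_const {n : ℕ} {a : ℝ → ℝ≥0∞} (ha : Measurable a) (ha0 : ∀ ρ ≤ 0, a ρ = 0)
    (c : ℝ≥0∞) (x : RSpace n) (t : ℝ) : heatPot a (fun _ _ => c) x t = (∫⁻ σ, a σ) * c := by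
  rw [← lintegral_mul_const _ ha]
  refine lintegral_congr fun σ => ?_
  rcases le_or_gt σ 0 with h | h
  · rw [ha0 σ h, zero_mul, zero_mul]
  · unfold heatAvg
    have m : Measurable fun y => ENNReal.ofReal (heatKer σ (x - y)) :=
      (measurable_heatKer measurable_const (by fun_prop)).ennreal_ofReal
    rw [lintegral_mul_const _ m, lintegral_heatKer_sub h, one_mul]

theorem heatPot_const_mul_right {n : ℕ} {a : ℝ → ℝ≥0∞} {h : RSpace n → ℝ → ℝ≥0∞} {c : ℝ≥0∞}
    (hc : c ≠ ∞) (x : RSpace n) (t : ℝ) :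
    heatPot a (fun y τ => c * h y τ) x t = c * heatPot a h x t := by
  unfold heatPot heatAvg
  rw [← lintegral_const_mul' _ _ hc]
  refine lintegral_congr fun σ => ?_
  rw [mul_left_comm c, ← lintegral_const_mul' _ _ hc]
  simp only [mul_left_comm c]

theorem exitW_ne_top (s N σ : ℝ) : exitW s N σ ≠ ∞ := by
  unfold exitW
  split_ifs <;> simp

theorem rieszTrunc_ne_top (s N σ : ℝ) : rieszTrunc s N σ ≠ ∞ := by
  unfold rieszTrunc
  split_ifs <;> simp

/-- Representation of a solution on a time slab, tested with a cutoff function. -/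
theorem cutoff_representation {n : ℕ} {s : ℝ} (hs0 : 0 < s) (hs1 : s < 1) {α : ℝ}
    (hα : s < α) {u : RSpace n → ℝ → ℝ} (hreg : ParabolicHolderLoc α u)
    (hu : SlowlyIncreasing s u) (hpos : ∀ x t, 0 < u x t) {g : RSpace n → ℝ → ℝ}
    (hg : Continuous fun p : RSpace n × ℝ => g p.1 p.2) (hg0 : ∀ y τ, 0 ≤ g y τ)
    (hfrac : ∀ x t, fracHeat s u x t = g x t) {N : ℝ} (hN : 0 < N) (x : RSpace n) (t : ℝ)
    {K P : ℝ} {χ : RSpace n → ℝ} (hK : 0 ≤ K) (hc : Continuous χ)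
    (h0 : ∀ y, 0 ≤ χ y) (h1 : ∀ y, χ y ≤ 1) (hP : 0 ≤ P) (hsupp : ∀ y, P ≤ ‖y‖ → χ y = 0)
    (hx : χ x = 1)
    (hχ : ∀ (v : ℝ) (m z : RSpace n), 0 < v →
      |(∫ y, heatKer v (y - m) * χ y) - χ z| ≤ K * (‖m - z‖ + v)) :
    ENNReal.ofReal (u x t) ≤
      heatPot (rieszTrunc s N) (fun y τ => ENNReal.ofReal (χ y) * ENNReal.ofReal (g y τ)) x t +
      heatPot (exitW s N) (fun y τ => ENNReal.ofReal (χ y) * ENNReal.ofReal (u y τ)) x t +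
      errPot (rieszTrunc s N) (levyW s 0) K (fun y τ => ENNReal.ofReal (u y τ)) x t ∧
    heatPot (rieszTrunc s N) (fun y τ => ENNReal.ofReal (χ y) * ENNReal.ofReal (g y τ)) x t +
      heatPot (exitW s N) (fun y τ => ENNReal.ofReal (χ y) * ENNReal.ofReal (u y τ)) x t ≤
      ENNReal.ofReal (u x t) +
      errPot (rieszTrunc s N) (levyW s 0) K (fun y τ => ENNReal.ofReal (u y τ)) x t := by
  have hcu : Continuous fun p : RSpace n × ℝ => u p.1 p.2 := hreg.continuous
  have mχ : Measurable fun p : RSpace n × ℝ => ENNReal.ofReal (χ p.1) :=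
    (hc.measurable.comp measurable_fst).ennreal_ofReal
  have mU := measurable_toENNReal hcu
  have mG := measurable_toENNReal hg
  set U : RSpace n → ℝ → ℝ≥0∞ := fun y τ => ENNReal.ofReal (u y τ) with hU
  set G : RSpace n → ℝ → ℝ≥0∞ := fun y τ => ENNReal.ofReal (g y τ) with hG
  set XU : RSpace n → ℝ → ℝ≥0∞ := fun y τ => ENNReal.ofReal (χ y) * U y τ with hXU
  set XG : RSpace n → ℝ → ℝ≥0∞ := fun y τ => ENNReal.ofReal (χ y) * G y τ with hXG
  have mXU : Measurable fun p : RSpace n × ℝ => XU p.1 p.2 := mχ.mul mU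
  have mXG : Measurable fun p : RSpace n × ℝ => XG p.1 p.2 := mχ.mul mG
  have mT := measurable_rieszTrunc s N
  have hT0 : ∀ ρ ≤ 0, rieszTrunc s N ρ = 0 := fun ρ h => rieszTrunc_zero h
  set Err := errPot (rieszTrunc s N) (levyW s 0) K U x t with hErr
  set PG := heatPot (rieszTrunc s N) XG x t with hPG
  set KX := heatPot (exitW s N) XU x t with hKX
  -- An infinite error makes both inequalities trivial; a finite one permits the cancellation of F
  -- below.
  rcases eq_or_ne Err ∞ with hE | hE
  · rw [hE, add_top, add_top]; exact ⟨le_top, le_top⟩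
  obtain ⟨B, hB0, hB⟩ := hreg.bounded (P + |t| + N)
  have hXUB : ∀ y σ, 0 < σ → σ < N → XU y (t - σ) ≤ ENNReal.ofReal B := by
    intro y σ hσ hσN
    rcases le_or_gt P ‖y‖ with hy | hy
    · rw [hXU]; dsimp only
      rw [hsupp y hy, ENNReal.ofReal_zero, zero_mul]; exact zero_le
    · rw [hXU]; dsimp only
      rw [hU]; dsimp only
      rw [← ENNReal.ofReal_mul (h0 y)]
      apply ENNReal.ofReal_le_ofReal
      have h2 := abs_sub t σ
      rw [abs_of_pos hσ] at h2
      have h3 := hB y (t - σ) (by linarith [abs_nonneg t]) (by linarith)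
      exact (mul_le_of_le_one_left (hpos _ _).le (h1 y)).trans ((le_abs_self _).trans h3)
  obtain ⟨C, θ, hC0, hθ, happ⟩ := fracHeat_approx hs0 hs1 hα hreg hu hpos
    (R := P + |t| + N) (by positivity)
  set m : ℝ≥0∞ := ∫⁻ σ, rieszTrunc s N σ with hm
  have hmtop : m ≠ ∞ := by
    rw [hm, lintegral_rieszTrunc hs0 hN.le]; exact ENNReal.ofReal_ne_top
  set A := heatPot (rieszTrunc s N) XU x t with hA
  have hTne : ∀ σ, rieszTrunc s N σ ≠ 0 → 0 < σ ∧ σ < N := by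
    intro σ hσ
    by_contra h'
    exact hσ (if_neg h')
  have hAtop : A ≠ ∞ := by
    have : A ≤ m * ENNReal.ofReal B := by
      rw [hm, ← heatPot_const mT hT0 _ x t]
      exact heatPot_mono_on (ae_of_all _ fun _ => le_rfl) fun σ hσ y =>
        hXUB y σ (hTne σ hσ).1 (hTne σ hσ).2
    exact ne_top_of_le_ne_top (ENNReal.mul_ne_top hmtop ENNReal.ofReal_ne_top) this
  -- D ε will tend to u(x,t), Kε ε collects the jumps past N and will be compared with the exit
  -- potential, and ω ε is the error of truncating the operator at ε.
  set D : ℝ → ℝ≥0∞ := fun ε =>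
    heatPot (fun σ => if σ < N then defectW s ε σ else 0) XU x t with hD
  set Kε : ℝ → ℝ≥0∞ := fun ε => heatPot (fun σ => if N ≤ σ then
    lconv (rieszTrunc s N) (levyW s ε) σ else 0) XU x t with hKε
  set ω : ℝ → ℝ≥0∞ := fun ε => m * ENNReal.ofReal (C * ε ^ θ) with hω
  have main : ∀ ε : ℝ, 0 < ε → ε ≤ 1 →
      D ε ≤ PG + Kε ε + Err + ω ε ∧ PG + Kε ε ≤ D ε + Err + ω ε := by
    intro ε hε hε1
    have mL := measurable_levyW s ε
    have hlm := levyMass_nonneg hs1 hε.le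
    set V := heatPot (levyW s ε) U with hV
    have mV : Measurable fun p : RSpace n × ℝ => V p.1 p.2 :=
      measurable_heatPot mL mU measurable_fst measurable_snd
    set XV : RSpace n → ℝ → ℝ≥0∞ := fun y τ => ENNReal.ofReal (χ y) * V y τ with hXV
    have mXV : Measurable fun p : RSpace n × ℝ => XV p.1 p.2 := mχ.mul mV
    set Y := heatPot (rieszTrunc s N) XV x t with hY
    set F := heatPot (lconv (rieszTrunc s N) (levyW s ε)) XU x t with hF
    -- The equation truncated at ε, multiplied by χ. The approximation is uniform here because χ has
    -- bounded support and only lags in (0,N) occur.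
    have hpt : ∀ σ, rieszTrunc s N σ ≠ 0 → ∀ y,
        ENNReal.ofReal (levyMass s ε) * XU y (t - σ) ≤
          XV y (t - σ) + XG y (t - σ) + ENNReal.ofReal (C * ε ^ θ) ∧
        XV y (t - σ) + XG y (t - σ) ≤
          ENNReal.ofReal (levyMass s ε) * XU y (t - σ) + ENNReal.ofReal (C * ε ^ θ) := by
      intro σ hσ y
      obtain ⟨hσ0, hσN⟩ := hTne σ hσ
      rw [hXU, hXV, hXG]; dsimp only
      rcases le_or_gt P ‖y‖ with hy | hy
      · rw [hsupp y hy]; simp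
      have h2 := abs_sub t σ
      rw [abs_of_pos hσ0] at h2
      have h3 := (happ y (t - σ) (by linarith [abs_nonneg t]) (by linarith)).2 ε hε hε1
      rw [hfrac] at h3
      have hVt : V y (t - σ) ≠ ∞ := hu.heatPot_levyW_ne_top hs0 hs1 hcu hε y (t - σ)
      set v := (V y (t - σ)).toReal with hv
      have hv0 : 0 ≤ v := ENNReal.toReal_nonneg
      have hup := (hpos y (t - σ)).le
      have hgp := hg0 y (t - σ)
      have hω0 : 0 ≤ C * ε ^ θ := by positivity
      rw [← ENNReal.ofReal_toReal hVt, ← hv]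
      rw [hU, hG]; dsimp only
      rw [← ENNReal.ofReal_mul (h0 y), ← ENNReal.ofReal_mul (h0 y), ← ENNReal.ofReal_mul (h0 y),
        ← ENNReal.ofReal_mul hlm,
        ← ENNReal.ofReal_add (mul_nonneg (h0 y) hv0) (mul_nonneg (h0 y) hgp),
        ← ENNReal.ofReal_add (add_nonneg (mul_nonneg (h0 y) hv0) (mul_nonneg (h0 y) hgp)) hω0,
        ← ENNReal.ofReal_add (mul_nonneg hlm (mul_nonneg (h0 y) hup)) hω0]
      obtain ⟨h4, h5⟩ := abs_le.1 h3
      have h6 := h0 y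
      have h7 := h1 y
      have h8 : χ y * (C * ε ^ θ) ≤ C * ε ^ θ := mul_le_of_le_one_left hω0 h7
      have h9 := mul_le_mul_of_nonneg_left h4 h6
      have h10 := mul_le_mul_of_nonneg_left h5 h6
      constructor <;> apply ENNReal.ofReal_le_ofReal <;> nlinarith
    have i1 : ENNReal.ofReal (levyMass s ε) * A ≤ Y + PG + ω ε := by
      have := heatPot_mono_on (a := rieszTrunc s N) (x := x)
        (h := fun y τ => ENNReal.ofReal (levyMass s ε) * XU y τ)
        (k := fun y τ => (XV y τ + XG y τ) + ENNReal.ofReal (C * ε ^ θ))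
        (ae_of_all _ fun _ => le_rfl) (fun σ hσ y => (hpt σ hσ y).1)
      rwa [heatPot_const_mul_right ENNReal.ofReal_ne_top, heatPot_add_right mT (mXV.add mXG),
        heatPot_add_right mT mXV, heatPot_const mT hT0] at this
    have i2 : Y + PG ≤ ENNReal.ofReal (levyMass s ε) * A + ω ε := by
      have := heatPot_mono_on (a := rieszTrunc s N) (x := x)
        (h := fun y τ => XV y τ + XG y τ)
        (k := fun y τ => ENNReal.ofReal (levyMass s ε) * XU y τ + ENNReal.ofReal (C * ε ^ θ))
        (ae_of_all _ fun _ => le_rfl) (fun σ hσ y => (hpt σ hσ y).2)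
      rwa [heatPot_add_right mT mXV, heatPot_add_right mT (mXU.const_mul _),
        heatPot_const_mul_right ENNReal.ofReal_ne_top, heatPot_const mT hT0] at this
    have mc := measurable_lconv mT mL
    -- The half-line mass balance applied to χu; combined with i1, i2 and the cutoff comparison of Y
    -- with F it gives both inequalities once the finite F is cancelled.
    have i3 : ENNReal.ofReal (levyMass s ε) * A + Kε ε = F + D ε := by
      rw [hA, ← heatPot_const_mul mT mXU, hKε, hD, hF]; dsimp only
      rw [← heatPot_add (mT.const_mul _) mXU, ← heatPot_add mc mXU]
      congr 1
      funext σ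
      exact levyMass_mul_trunc hs0 hs1 hε σ
    have hcmp := cutoff_comparison mT mL hT0 (fun r hr => levyW_zero hε.le hr) mU hK hc h0 h1 hχ x t
    have hErrε : errPot (rieszTrunc s N) (levyW s ε) K U x t ≤ Err :=
      errPot_mono (fun r => levyW_anti hε.le r) K U x t
    have i4 : Y ≤ F + Err := hcmp.1.trans (add_le_add le_rfl hErrε)
    have i5 : F ≤ Y + Err := hcmp.2.trans (add_le_add le_rfl hErrε)
    have hωtop : ω ε ≠ ∞ := ENNReal.mul_ne_top hmtop ENNReal.ofReal_ne_top
    have hYtop : Y ≠ ∞ := ne_top_of_le_ne_top (ENNReal.add_ne_top.2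
      ⟨ENNReal.mul_ne_top ENNReal.ofReal_ne_top hAtop, hωtop⟩) (le_self_add.trans i2)
    have hFtop : F ≠ ∞ := ne_top_of_le_ne_top (ENNReal.add_ne_top.2 ⟨hYtop, hE⟩) i5
    constructor
    · refine (ENNReal.add_le_add_iff_left hFtop).1 ?_
      calc F + D ε = ENNReal.ofReal (levyMass s ε) * A + Kε ε := i3.symm
        _ ≤ (F + Err) + PG + ω ε + Kε ε := by
          refine add_le_add (i1.trans ?_) le_rfl
          exact add_le_add (add_le_add i4 le_rfl) le_rfl
        _ = _ := by ring
    · refine (ENNReal.add_le_add_iff_left hFtop).1 ?_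
      calc F + (PG + Kε ε) ≤ (Y + Err) + (PG + Kε ε) := add_le_add i5 le_rfl
        _ = (Y + PG) + Kε ε + Err := by ring
        _ ≤ (ENNReal.ofReal (levyMass s ε) * A + ω ε) + Kε ε + Err := by
          exact add_le_add (add_le_add i2 le_rfl) le_rfl
        _ = (ENNReal.ofReal (levyMass s ε) * A + Kε ε) + (Err + ω ε) := by ring
        _ = _ := by rw [i3]; ring
  have hDlim : Tendsto D (𝓝[>] 0) (𝓝 (ENNReal.ofReal (u x t))) := by
    -- Restricting the defect to σ < N is the same as restricting χu to the slab, where it is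
    -- bounded, so the approximate identity result applies.
    set h : RSpace n → ℝ → ℝ≥0∞ := fun y τ => if 0 < t - τ ∧ t - τ < N then XU y τ else 0 with hh
    have hS : MeasurableSet {p : RSpace n × ℝ | 0 < t - p.2 ∧ t - p.2 < N} :=
      (measurableSet_lt measurable_const (measurable_snd.const_sub t)).inter
        (measurableSet_lt (measurable_snd.const_sub t) measurable_const)
    have mh : Measurable fun p : RSpace n × ℝ => h p.1 p.2 :=
      Measurable.ite hS mXU measurable_const
    have eD : D = fun ε => heatPot (defectW s ε) h x t := by
      funext ε
      refine lintegral_congr fun σ => ?_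
      rcases le_or_gt σ 0 with hσ | hσ
      · simp [defectW_zero hσ]
      dsimp only
      by_cases hσN : σ < N
      · rw [if_pos hσN]
        congr 1
        refine lintegral_congr fun y => ?_
        rw [hh]; dsimp only
        rw [sub_sub_cancel, if_pos ⟨hσ, hσN⟩]
      · rw [if_neg hσN, zero_mul, eq_comm, mul_eq_zero]
        right
        refine lintegral_eq_zero_of_ae_eq_zero (ae_of_all _ fun y => ?_)
        rw [hh]; dsimp only [Pi.zero_apply]
        rw [sub_sub_cancel, if_neg fun h => hσN h.2, mul_zero]
    rw [eD]
    apply tendsto_heatPot_defectW hs0 hs1 mh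
    · intro δ hδ
      have hcont : Continuous fun p : RSpace n × ℝ => (fun y τ => χ y * u y τ) p.1 p.2 :=
        (hc.comp continuous_fst).mul hcu
      obtain ⟨η, hη, hη'⟩ := near_of_continuous (g := fun y τ => χ y * u y τ) hcont x t hδ
      refine ⟨min η N, by positivity, fun y σ h2 h3 h4 => ?_⟩
      have h5 := abs_lt.1 (hη' y σ (h2.trans_le (min_le_left _ _)) h3
        (h4.trans_le (min_le_left _ _)))
      rw [hx, one_mul] at h5
      have h6 : h y (t - σ) = ENNReal.ofReal (χ y * u y (t - σ)) := by
        rw [hh]; dsimp only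
        rw [sub_sub_cancel, if_pos ⟨h3, h4.trans_le (min_le_right _ _)⟩, ENNReal.ofReal_mul (h0 y)]
      rw [h6]
      exact ⟨ENNReal.ofReal_le_ofReal (by linarith), ENNReal.ofReal_le_ofReal (by linarith)⟩
    · intro η hη
      apply farPot_ne_top_of_bounded hs0 hs1 hη hN hB0 x t
      · intro y σ
        rw [hh]; dsimp only
        rw [sub_sub_cancel]
        split_ifs with h2
        · exact hXUB y σ h2.1 h2.2
        · exact zero_le
      · intro y σ hσ
        rw [hh]; dsimp only
        rw [sub_sub_cancel, if_neg fun h => not_lt.2 hσ h.2]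
  set e : ℕ → ℝ := fun k => 1 / ((k : ℝ) + 1) with he
  have he0 : ∀ k, 0 < e k := fun k => by rw [he]; positivity
  have he1 : ∀ k, e k ≤ 1 := fun k => by
    rw [he]; dsimp only
    rw [div_le_one (by positivity)]
    linarith [(k.cast_nonneg : (0 : ℝ) ≤ k)]
  have helim : Tendsto e atTop (𝓝[>] 0) :=
    tendsto_nhdsWithin_iff.2 ⟨tendsto_one_div_add_atTop_nhds_zero_nat,
      Eventually.of_forall fun k => he0 k⟩
  have hDk := hDlim.comp helim
  have hωlim : Tendsto (fun k => ω (e k)) atTop (𝓝 0) := by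
    have h2 : ContinuousAt (fun ε : ℝ => C * ε ^ θ) 0 :=
      (Real.continuousAt_rpow_const _ _ (Or.inr hθ.le)).const_mul _
    have h3 : Tendsto (fun k => C * (e k) ^ θ) atTop (𝓝 0) := by
      have := h2.tendsto.comp (helim.mono_right nhdsWithin_le_nhds)
      simpa [Real.zero_rpow hθ.ne', Function.comp_def] using this
    have h4 := ENNReal.Tendsto.const_mul (a := m) (ENNReal.tendsto_ofReal h3) (Or.inr hmtop)
    simpa using h4
  constructor
  · have hle : ∀ k, D (e k) ≤ PG + KX + Err + ω (e k) := by
      intro k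
      refine (main _ (he0 k) (he1 k)).1.trans ?_
      refine add_le_add (add_le_add (add_le_add le_rfl ?_) le_rfl) le_rfl
      refine heatPot_mono_on ?_ fun _ _ _ => le_rfl
      -- At σ = N the exit density is set to 0 while the convolution need not vanish, so this single
      -- lag is discarded.
      filter_upwards [compl_mem_ae_iff.2 (measure_singleton N)] with σ hσ
      split_ifs with h2
      · exact lconv_trunc_levy_le hs0 hs1 (he0 k).le hN (lt_of_le_of_ne h2 (Ne.symm hσ))
      · exact zero_le
    have hlim : Tendsto (fun k => PG + KX + Err + ω (e k)) atTop (𝓝 (PG + KX + Err + 0)) :=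
      tendsto_const_nhds.add hωlim
    rw [add_zero] at hlim
    exact le_of_tendsto_of_tendsto' hDk hlim hle
  -- The convolution equals the exit density only when ε < σ - N. The lower bound is taken on that
  -- region, which increases to σ > N.
  · set b : ℕ → ℝ → ℝ≥0∞ := fun k σ => if N + e k < σ then exitW s N σ else 0 with hb
    have hle : ∀ k, PG + heatPot (b k) XU x t ≤ D (e k) + Err + ω (e k) := by
      intro k
      refine le_trans (add_le_add le_rfl ?_) (main _ (he0 k) (he1 k)).2
      refine heatPot_mono (fun σ => ?_) (fun _ _ => le_rfl) x t
      rw [hb]; dsimp only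
      split_ifs with h2 h3 h3
      · exact (lconv_trunc_levy hs0 hs1 hN (by linarith [he0 k]) (by linarith)).ge
      · linarith [he0 k]
      · exact zero_le
      · exact le_rfl
    have hbl : Tendsto (fun k => heatPot (b k) XU x t) atTop (𝓝 KX) := by
      apply tendsto_heatPot
      · exact fun k => Measurable.ite measurableSet_Ioi (measurable_exitW s N) measurable_const
      · exact fun _ => mXU
      · intro σ i j hij
        have hji : e j ≤ e i := by
          rw [he]; dsimp only
          gcongr
        rw [hb]; dsimp only
        split_ifs with h2 h3 h3
        · exact le_rfl
        · linarith
        · exact zero_le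
        · exact le_rfl
      · exact fun _ _ _ _ _ => le_rfl
      · intro σ
        by_cases h2 : N < σ
        · have h3 : ∀ᶠ k in atTop, e k < σ - N :=
            (helim.mono_right nhdsWithin_le_nhds).eventually (gt_mem_nhds (by linarith))
          exact h3.mono fun k hk => if_pos (by linarith)
        · refine Eventually.of_forall fun k => ?_
          rw [hb]; dsimp only
          rw [if_neg (by linarith [he0 k]), exitW, if_neg h2]
      · exact fun _ _ => Eventually.of_forall fun _ => rfl
      · exact exitW_ne_top s N
    have hlim : Tendsto (fun k => D (e k) + Err + ω (e k)) atTop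
        (𝓝 (ENNReal.ofReal (u x t) + Err + 0)) := (hDk.add tendsto_const_nhds).add hωlim
    rw [add_zero] at hlim
    exact le_of_tendsto_of_tendsto' (tendsto_const_nhds.add hbl) hlim hle

/-- Representation of a solution through its values before time `t - N`. -/
theorem slab_representation {n : ℕ} {s : ℝ} (hs0 : 0 < s) (hs1 : s < 1) {α : ℝ}
    (hα : s < α) {u : RSpace n → ℝ → ℝ} (hreg : ParabolicHolderLoc α u)
    (hu : SlowlyIncreasing s u) (hpos : ∀ x t, 0 < u x t) {g : RSpace n → ℝ → ℝ}
    (hg : Continuous fun p : RSpace n × ℝ => g p.1 p.2) (hg0 : ∀ y τ, 0 ≤ g y τ)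
    (hfrac : ∀ x t, fracHeat s u x t = g x t) {N : ℝ} (hN : 0 < N) (x : RSpace n) (t : ℝ) :
    ENNReal.ofReal (u x t) =
      heatPot (rieszTrunc s N) (fun y τ => ENNReal.ofReal (g y τ)) x t +
      heatPot (exitW s N) (fun y τ => ENNReal.ofReal (u y τ)) x t := by
  have hcu : Continuous fun p : RSpace n × ℝ => u p.1 p.2 := hreg.continuous
  have mT := measurable_rieszTrunc s N
  have mX := measurable_exitW s N
  obtain ⟨K, hK, hcut⟩ := exists_heat_cutoff n
  -- This radius is at least 1, puts x and the ball of radius k where χ = 1, and exceeds k+1, so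
  -- that K/r ≤ K/(k+1).
  set r : ℕ → ℝ := fun k => (k : ℝ) + (‖x‖ + 1) with hr
  have hErr : Tendsto (fun k : ℕ => errPot (rieszTrunc s N) (levyW s 0) (K / ((k : ℝ) + 1))
      (fun z τ => ENNReal.ofReal (u z τ)) x t) atTop (𝓝 0) :=
    hu.tendsto_errPot hs0 hs1 hreg hN hK x t
  have hk : ∀ k : ℕ, ∃ χ : RSpace n → ℝ, (∀ y, χ y ≤ 1) ∧
      (∀ y, ‖y‖ ≤ k → χ y = 1) ∧
      ENNReal.ofReal (u x t) ≤
      heatPot (rieszTrunc s N) (fun y τ => ENNReal.ofReal (χ y) * ENNReal.ofReal (g y τ)) x t +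
      heatPot (exitW s N) (fun y τ => ENNReal.ofReal (χ y) * ENNReal.ofReal (u y τ)) x t +
      errPot (rieszTrunc s N) (levyW s 0) (K / ((k : ℝ) + 1))
        (fun y τ => ENNReal.ofReal (u y τ)) x t ∧
    heatPot (rieszTrunc s N) (fun y τ => ENNReal.ofReal (χ y) * ENNReal.ofReal (g y τ)) x t +
      heatPot (exitW s N) (fun y τ => ENNReal.ofReal (χ y) * ENNReal.ofReal (u y τ)) x t ≤
      ENNReal.ofReal (u x t) +
      errPot (rieszTrunc s N) (levyW s 0) (K / ((k : ℝ) + 1))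
        (fun y τ => ENNReal.ofReal (u y τ)) x t := by
    intro k
    have hk0 : (0 : ℝ) ≤ k := k.cast_nonneg
    have hx0 := norm_nonneg x
    obtain ⟨χ, hc, h0, h1, hone, hsupp, hχ⟩ := hcut (r k) (by rw [hr]; dsimp only; linarith)
    refine ⟨χ, h1, fun y hy => hone y (by rw [hr]; dsimp only; linarith), ?_⟩
    refine cutoff_representation hs0 hs1 hα hreg hu hpos hg hg0 hfrac hN x t (P := 2 * r k)
      (by positivity) hc h0 h1 (by rw [hr]; positivity) hsupp
      (hone x (by rw [hr]; dsimp only; linarith)) fun v m z hv => (hχ v m z hv).trans ?_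
    gcongr
    rw [hr]; dsimp only; linarith
  choose χ hχ1 hχone hup hlow using hk
  apply le_antisymm
  · have hlim : Tendsto (fun k : ℕ =>
        heatPot (rieszTrunc s N) (fun y τ => ENNReal.ofReal (g y τ)) x t +
        heatPot (exitW s N) (fun y τ => ENNReal.ofReal (u y τ)) x t +
        errPot (rieszTrunc s N) (levyW s 0) (K / ((k : ℝ) + 1))
        (fun y τ => ENNReal.ofReal (u y τ)) x t) atTop _ := tendsto_const_nhds.add hErr
    rw [add_zero] at hlim
    refine le_of_tendsto_of_tendsto' tendsto_const_nhds hlim fun k => (hup k).trans ?_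
    have hle : ∀ (w : RSpace n → ℝ → ℝ) y τ,
        ENNReal.ofReal (χ k y) * ENNReal.ofReal (w y τ) ≤ ENNReal.ofReal (w y τ) := by
      intro w y τ
      refine mul_le_of_le_one_left zero_le ?_
      rw [← ENNReal.ofReal_one]
      exact ENNReal.ofReal_le_ofReal (hχ1 k y)
    exact add_le_add (add_le_add (heatPot_mono (fun _ => le_rfl) (hle g) x t)
      (heatPot_mono (fun _ => le_rfl) (hle u) x t)) le_rfl
  -- The cutoffs are not known to increase with k; they are replaced from below by indicators of
  -- balls, to which monotone convergence applies.
  · have hball : ∀ {a : ℝ → ℝ≥0∞} {w : RSpace n → ℝ → ℝ}, Measurable a → (∀ σ, a σ ≠ ∞) →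
        (Continuous fun p : RSpace n × ℝ => w p.1 p.2) →
        Tendsto (fun k : ℕ => heatPot a
          (fun y τ => if ‖y‖ ≤ k then ENNReal.ofReal (w y τ) else 0) x t) atTop
          (𝓝 (heatPot a (fun y τ => ENNReal.ofReal (w y τ)) x t)) := by
      intro a w ha hfin hw
      apply tendsto_heatPot (fun _ => ha)
      · intro k
        have hS : MeasurableSet {p : RSpace n × ℝ | ‖p.1‖ ≤ k} :=
          measurableSet_le measurable_fst.norm measurable_const
        exact Measurable.ite hS (measurable_toENNReal hw) measurable_const
      · exact fun _ _ _ _ => le_rfl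
      · intro y τ i j hij
        have : (i : ℝ) ≤ j := Nat.cast_le.2 hij
        dsimp only
        split_ifs with h2 h3 h3
        · exact le_rfl
        · exact absurd (h2.trans this) h3
        · exact zero_le
        · exact le_rfl
      · exact fun _ => Eventually.of_forall fun _ => rfl
      · intro y τ
        obtain ⟨k₀, hk₀⟩ := exists_nat_ge ‖y‖
        filter_upwards [eventually_ge_atTop k₀] with k hk
        exact if_pos (hk₀.trans (Nat.cast_le.2 hk))
      · exact hfin
    have hlim : Tendsto (fun k : ℕ => ENNReal.ofReal (u x t) +
        errPot (rieszTrunc s N) (levyW s 0) (K / ((k : ℝ) + 1))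
        (fun y τ => ENNReal.ofReal (u y τ)) x t) atTop _ := tendsto_const_nhds.add hErr
    rw [add_zero] at hlim
    refine le_of_tendsto_of_tendsto' ((hball mT (rieszTrunc_ne_top s N) hg).add
      (hball mX (exitW_ne_top s N) hcu)) hlim fun k => le_trans ?_ (hlow k)
    have hle : ∀ (w : RSpace n → ℝ → ℝ) y τ, (if ‖y‖ ≤ k then ENNReal.ofReal (w y τ) else 0) ≤
        ENNReal.ofReal (χ k y) * ENNReal.ofReal (w y τ) := by
      intro w y τ
      split_ifs with h2
      · rw [hχone k y h2, ENNReal.ofReal_one, one_mul]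
      · exact zero_le
    exact add_le_add (heatPot_mono (fun _ => le_rfl) (hle g) x t)
      (heatPot_mono (fun _ => le_rfl) (hle u) x t)

/-! ### Forward Harnack inequality and growth in paraboloids -/

/-- Convexity gives ‖x'-z‖²/(σ+h) ≤ ‖x'-x‖²/h + ‖x-z‖²/σ, the gap being a perfect square. The
prefactor costs ((σ+h)/σ)^{n/2}, which tends to 1 uniformly over σ > N as N → ∞. -/
theorem heatKer_le_shift {n : ℕ} {N h σ : ℝ} (hN : 0 < N) (hh : 0 < h) (hσ : N < σ)
    (x x' z : RSpace n) :
    heatKer σ (x - z) ≤ (1 + h / N) ^ ((n : ℝ) / 2) * Real.exp (‖x' - x‖ ^ 2 / (4 * h)) *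
      heatKer (σ + h) (x' - z) := by
  have hσ0 : 0 < σ := hN.trans hσ
  have e1 : (4 * Real.pi * σ) ^ (-((n : ℝ) / 2)) =
      ((σ + h) / σ) ^ ((n : ℝ) / 2) * (4 * Real.pi * (σ + h)) ^ (-((n : ℝ) / 2)) := by
    rw [show 4 * Real.pi * σ = (4 * Real.pi * (σ + h)) * ((σ + h) / σ)⁻¹ by field_simp,
      Real.mul_rpow (by positivity) (by positivity), Real.inv_rpow (by positivity),
      Real.rpow_neg (by positivity : (0 : ℝ) ≤ (σ + h) / σ), inv_inv, mul_comm]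
  have e2 : ((σ + h) / σ) ^ ((n : ℝ) / 2) ≤ (1 + h / N) ^ ((n : ℝ) / 2) := by
    apply Real.rpow_le_rpow (by positivity) _ (by positivity)
    rw [add_div, div_self hσ0.ne']
    gcongr
  have e3 : Real.exp (-‖x - z‖ ^ 2 / (4 * σ)) ≤ Real.exp (‖x' - x‖ ^ 2 / (4 * h)) *
      Real.exp (-‖x' - z‖ ^ 2 / (4 * (σ + h))) := by
    rw [← Real.exp_add, Real.exp_le_exp]
    have h1 : ‖x' - z‖ ≤ ‖x' - x‖ + ‖x - z‖ := by
      rw [← sub_add_sub_cancel x' x z]; exact norm_add_le _ _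
    set p := ‖x' - x‖ with hp
    set q := ‖x - z‖ with hq
    have h2 : ‖x' - z‖ ^ 2 / (4 * (σ + h)) ≤ (p + q) ^ 2 / (4 * (σ + h)) := by gcongr
    have h3 : p ^ 2 / (4 * h) + q ^ 2 / (4 * σ) - (p + q) ^ 2 / (4 * (σ + h)) =
        (p * σ - q * h) ^ 2 / (4 * h * σ * (σ + h)) := by
      field_simp; ring
    have h4 : 0 ≤ (p * σ - q * h) ^ 2 / (4 * h * σ * (σ + h)) := by positivity
    rw [neg_div, neg_div]
    linarith
  unfold heatKer
  rw [e1]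
  calc _ ≤ (1 + h / N) ^ ((n : ℝ) / 2) * (4 * Real.pi * (σ + h)) ^ (-((n : ℝ) / 2)) *
        (Real.exp (‖x' - x‖ ^ 2 / (4 * h)) *
      Real.exp (-‖x' - z‖ ^ 2 / (4 * (σ + h)))) := by gcongr
    _ = _ := by ring

/-- Shifting level and lag together keeps σ - N, the singular factor; only 1/σ is affected, by at
most 1 + h/N. -/
theorem exitW_le_shift {s N h : ℝ} (hs0 : 0 < s) (hs1 : s < 1) (hN : 0 < N) (hh : 0 < h) (σ : ℝ) :
    exitW s N σ ≤ ENNReal.ofReal (1 + h / N) * exitW s (N + h) (σ + h) := by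
  have hC := stableConst_pos hs0 hs1
  unfold exitW
  by_cases hσ : N < σ
  · have hσ0 : 0 < σ := hN.trans hσ
    have hd : 0 < σ - N := by linarith
    rw [if_pos hσ, if_pos (by linarith), ← ENNReal.ofReal_mul (by positivity)]
    apply ENNReal.ofReal_le_ofReal
    rw [add_sub_add_right_eq_sub]
    have h1 : N ^ s ≤ (N + h) ^ s := Real.rpow_le_rpow hN.le (by linarith) hs0.le
    have h2 : σ⁻¹ ≤ (1 + h / N) * (σ + h)⁻¹ := by
      rw [← div_eq_mul_inv, le_div_iff₀ (by positivity), mul_add, inv_mul_cancel₀ hσ0.ne',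
        ← div_eq_inv_mul]
      gcongr
    have hp : 0 < (σ - N) ^ s := by positivity
    calc stableConst s * (N ^ s / (σ * (σ - N) ^ s))
        = stableConst s * (N ^ s * σ⁻¹ * ((σ - N) ^ s)⁻¹) := by field_simp
      _ ≤ stableConst s * ((N + h) ^ s * ((1 + h / N) * (σ + h)⁻¹) * ((σ - N) ^ s)⁻¹) := by gcongr
      _ = _ := by field_simp
  · rw [if_neg hσ]; exact zero_le

/-- Forward Harnack inequality for the exit potentials. -/
theorem heatPot_exitW_le_shift {n : ℕ} {s N h : ℝ} (hs0 : 0 < s) (hs1 : s < 1) (hN : 0 < N)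
    (hh : 0 < h) {U : RSpace n → ℝ → ℝ≥0∞} (hU : Measurable fun p : RSpace n × ℝ => U p.1 p.2)
    (x x' : RSpace n) (t : ℝ) :
    heatPot (exitW s N) U x t ≤
      ENNReal.ofReal ((1 + h / N) * ((1 + h / N) ^ ((n : ℝ) / 2) *
        Real.exp (‖x' - x‖ ^ 2 / (4 * h)))) * heatPot (exitW s (N + h)) U x' (t + h) := by
  -- The lag is shifted by h, so that both sides look at the same point (y, t-σ), once from (x,t)
  -- and once from (x', t+h).
  rw [heatPot_eq_lintegral hU, heatPot_eq_lintegral hU,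
    ← lintegral_add_right_eq_self (fun σ => ∫⁻ y, exitW s (N + h) σ *
      (ENNReal.ofReal (heatKer σ (x' - y)) * U y (t + h - σ))) h,
    ← lintegral_const_mul' _ _ ENNReal.ofReal_ne_top]
  refine lintegral_mono fun σ => ?_
  dsimp only
  rw [← lintegral_const_mul' _ _ ENNReal.ofReal_ne_top]
  refine lintegral_mono fun y => ?_
  dsimp only
  rw [add_sub_add_right_eq_sub]
  by_cases hσ : N < σ
  · have hk := heatKer_le_shift (n := n) hN hh hσ x x' y
    rw [ENNReal.ofReal_mul (by positivity)]
    calc _ ≤ (ENNReal.ofReal (1 + h / N) * exitW s (N + h) (σ + h)) *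
          (ENNReal.ofReal ((1 + h / N) ^ ((n : ℝ) / 2) * Real.exp (‖x' - x‖ ^ 2 / (4 * h)) *
            heatKer (σ + h) (x' - y)) * U y (t - σ)) :=
          mul_le_mul' (exitW_le_shift hs0 hs1 hN hh σ)
            (mul_le_mul' (ENNReal.ofReal_le_ofReal hk) le_rfl)
      _ = _ := by
        rw [ENNReal.ofReal_mul (by positivity : 0 ≤ (1 + h / N) ^ ((n : ℝ) / 2) *
          Real.exp (‖x' - x‖ ^ 2 / (4 * h)))]
        ring
  · rw [exitW, if_neg hσ, zero_mul]; exact zero_le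

/-- At least half of the heat kernel lives at the parabolic scale. -/
theorem half_le_lintegral_heatKer {n : ℕ} {σ : ℝ} (hσ : 0 < σ) (x : RSpace n) :
    ENNReal.ofReal (1 / 2) ≤ ∫⁻ y, if ‖x - y‖ ^ 2 ≤ 16 * 2 ^ ((n : ℝ) / 2) * σ then
      ENNReal.ofReal (heatKer σ (x - y)) else 0 := by
  set c : ℝ := 8 * 2 ^ ((n : ℝ) / 2) with hc
  have hc0 : 0 < c := by positivity
  have m2 : Measurable fun y : RSpace n => ENNReal.ofReal (heatKer (2 * σ) (x - y)) :=
    (measurable_heatKer measurable_const (by fun_prop)).ennreal_ofReal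
  -- A Chebyshev argument: outside the ball the kernel is at most half of the kernel at time 2σ,
  -- whose total mass is 1.
  have h1 : (1 : ℝ≥0∞) ≤ (∫⁻ y, if ‖x - y‖ ^ 2 ≤ 16 * 2 ^ ((n : ℝ) / 2) * σ then
      ENNReal.ofReal (heatKer σ (x - y)) else 0) + ENNReal.ofReal (1 / 2) := by
    have e : ENNReal.ofReal (1 / 2) =
        ∫⁻ y : RSpace n, ENNReal.ofReal (1 / 2) * ENNReal.ofReal (heatKer (2 * σ) (x - y)) := by
      rw [lintegral_const_mul _ m2, lintegral_heatKer_sub (by linarith), mul_one]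
    rw [← lintegral_heatKer_sub hσ x, e, ← lintegral_add_right _ (m2.const_mul _)]
    refine lintegral_mono fun y => ?_
    dsimp only
    split_ifs with h
    · exact le_self_add
    · rw [zero_add, ← ENNReal.ofReal_mul (by norm_num)]
      apply ENNReal.ofReal_le_ofReal
      have h2 := sq_mul_heatKer_le hσ (x - y)
      have hk := heatKer_pos hσ (x - y)
      have h3 : 2 * c * σ * heatKer σ (x - y) ≤ ‖x - y‖ ^ 2 * heatKer σ (x - y) := by
        gcongr
        rw [hc]; linarith [not_le.1 h]
      rw [← hc] at h2
      have h4 : (c * σ) * (2 * heatKer σ (x - y)) ≤ (c * σ) * heatKer (2 * σ) (x - y) := by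
        linarith
      have := le_of_mul_le_mul_left h4 (by positivity)
      linarith
  have e2 : (1 : ℝ≥0∞) = ENNReal.ofReal (1 / 2) + ENNReal.ofReal (1 / 2) := by
    rw [← ENNReal.ofReal_add (by norm_num) (by norm_num)]; norm_num
  rw [e2] at h1
  exact (ENNReal.add_le_add_iff_right ENNReal.ofReal_ne_top).1 h1

/-- Only lags below T and points at the parabolic scale are kept; they carry half of each heat
average, and the Riesz density has mass T^s/(sΓ(s)) on (0,T). -/
theorem riesz_lintegral_Ioo_ge {n : ℕ} {s T C : ℝ} (hs0 : 0 < s) (hT : 0 < T) (hC : 0 ≤ C)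
    {G : RSpace n → ℝ → ℝ≥0∞} {x : RSpace n} {t : ℝ}
    (hG : ∀ σ y, 0 < σ → σ < T → ‖x - y‖ ^ 2 ≤ 16 * 2 ^ ((n : ℝ) / 2) * σ →
      ENNReal.ofReal C ≤ G y (t - σ)) :
    ENNReal.ofReal (T ^ s / (s * Real.Gamma s) * (C / 2)) ≤ heatPot (rieszW s) G x t := by
  have hΓ := Real.Gamma_pos_of_pos hs0
  have mT := measurable_rieszTrunc s T
  rw [ENNReal.ofReal_mul (by positivity), ← lintegral_rieszTrunc hs0 hT.le,
    ← lintegral_mul_const _ mT]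
  refine lintegral_mono fun σ => ?_
  dsimp only
  unfold rieszTrunc
  split_ifs with h
  · rw [rieszW, if_pos h.1]
    refine mul_le_mul' le_rfl ?_
    rw [show C / 2 = C * (1 / 2) by ring, ENNReal.ofReal_mul hC]
    refine (mul_le_mul' le_rfl (half_le_lintegral_heatKer h.1 x)).trans ?_
    rw [← lintegral_const_mul' _ _ ENNReal.ofReal_ne_top]
    refine lintegral_mono fun y => ?_
    dsimp only
    split_ifs with h2
    · rw [mul_comm]; exact mul_le_mul' le_rfl (hG σ y h.1 h.2 h2)
    · rw [mul_zero]; exact zero_le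
  · rw [zero_mul]; exact zero_le

theorem lintegral_Ioi_inv_eq_top : ∫⁻ T in Ioi (1 : ℝ), ENNReal.ofReal T⁻¹ = ∞ := by
  by_contra h
  refine not_integrableOn_Ioi_inv (a := (1 : ℝ)) ⟨by fun_prop, ?_⟩
  rw [hasFiniteIntegral_iff_ofReal]
  · exact lt_top_iff_ne_top.2 h
  · filter_upwards [ae_restrict_mem measurableSet_Ioi] with T hT
    have : (0 : ℝ) < T := one_pos.trans hT
    positivity

theorem growthWeight_le_of_parabola {n : ℕ} {s : ℝ} (hs : 0 < s) (x₀ : RSpace n) (t₀ : ℝ) :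
    ∃ M : ℝ, 0 < M ∧ ∀ (z : RSpace n) (T : ℝ), 1 ≤ T → ‖z - x₀‖ ≤ √T →
      growthWeight s z (t₀ + T) ≤ M * T ^ ((n : ℝ) / 2 + 1 + s) := by
  have hn : (0 : ℝ) ≤ n := n.cast_nonneg
  refine ⟨1 + (‖x₀‖ + 1) ^ ((n : ℝ) + 2 + 2 * s) + (|t₀| + 1) ^ ((n : ℝ) / 2 + 1 + s),
    by positivity, fun z T hT hz => ?_⟩
  have hT0 : 0 < T := by linarith
  have hsT : 1 ≤ √T := Real.one_le_sqrt.2 hT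
  have h1 : ‖z‖ ≤ (‖x₀‖ + 1) * √T := by
    have : ‖z‖ ≤ ‖z - x₀‖ + ‖x₀‖ := by
      calc ‖z‖ = ‖(z - x₀) + x₀‖ := by rw [sub_add_cancel]
        _ ≤ _ := norm_add_le _ _
    nlinarith [norm_nonneg x₀]
  have h2 : |t₀ + T| ≤ (|t₀| + 1) * T := by
    have := abs_add_le t₀ T
    rw [abs_of_pos hT0] at this
    nlinarith [abs_nonneg t₀]
  have e1 : √T ^ ((n : ℝ) + 2 + 2 * s) = T ^ ((n : ℝ) / 2 + 1 + s) := by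
    rw [Real.sqrt_eq_rpow, ← Real.rpow_mul hT0.le]; congr 1; ring
  have h3 : ‖z‖ ^ ((n : ℝ) + 2 + 2 * s) ≤
      (‖x₀‖ + 1) ^ ((n : ℝ) + 2 + 2 * s) * T ^ ((n : ℝ) / 2 + 1 + s) := by
    rw [← e1, ← Real.mul_rpow (by positivity) (by positivity)]
    exact Real.rpow_le_rpow (norm_nonneg _) h1 (by positivity)
  have h4 : |t₀ + T| ^ ((n : ℝ) / 2 + 1 + s) ≤
      (|t₀| + 1) ^ ((n : ℝ) / 2 + 1 + s) * T ^ ((n : ℝ) / 2 + 1 + s) := by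
    rw [← Real.mul_rpow (by positivity) hT0.le]
    exact Real.rpow_le_rpow (abs_nonneg _) h2 (by positivity)
  have h5 : 1 ≤ T ^ ((n : ℝ) / 2 + 1 + s) := Real.one_le_rpow hT (by positivity)
  unfold growthWeight
  linarith

/-- A slowly increasing function cannot grow like `t ^ s` in a forward paraboloid. -/
theorem SlowlyIncreasing.not_growth {n : ℕ} {s : ℝ} (hs : 0 < s) {u : RSpace n → ℝ → ℝ}
    (hu : SlowlyIncreasing s u) (hc : Continuous fun p : RSpace n × ℝ => u p.1 p.2)
    (x₀ : RSpace n) (t₀ : ℝ) {c : ℝ} (hc0 : 0 < c) :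
    ¬ ∀ (x : RSpace n) (T : ℝ), 0 < T → ‖x - x₀‖ ^ 2 ≤ T → c * T ^ s ≤ u x (t₀ + T) := by
  intro hgrow
  refine hu.lintegral_ne_top hc ?_
  obtain ⟨M, hM, hw⟩ := growthWeight_le_of_parabola (n := n) hs x₀ t₀
  rw [← lintegral_add_left_eq_self _ t₀]
  set v : ℝ≥0∞ := volume (Metric.closedBall (0 : RSpace n) 1) with hv
  have hv0 : v ≠ 0 := (Metric.measure_closedBall_pos volume _ one_pos).ne'
  have hk0 : ENNReal.ofReal (c / M) * v ≠ 0 :=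
    mul_ne_zero (ENNReal.ofReal_pos.2 (by positivity)).ne' hv0
  -- On the ball of radius √T, of volume proportional to T^{n/2}, the integrand is at least of order
  -- T^s/T^{n/2+1+s}: each time slice contributes a multiple of 1/T.
  have hle : ∀ T ∈ Ioi (1 : ℝ), ENNReal.ofReal T⁻¹ * (ENNReal.ofReal (c / M) * v) ≤
      ∫⁻ z, ENNReal.ofReal (growthWeight s z (t₀ + T))⁻¹ * ENNReal.ofReal (u z (t₀ + T)) := by
    intro T hT
    have hT1 : (1 : ℝ) < T := hT
    have hT0 : 0 < T := by linarith
    have e1 : ENNReal.ofReal T⁻¹ * (ENNReal.ofReal (c / M) * v) =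
        ∫⁻ _ in Metric.closedBall x₀ (√T),
          ENNReal.ofReal (c / M * T ^ (-((n : ℝ) / 2) - 1)) ∂(volume : Measure (RSpace n)) := by
      rw [setLIntegral_const, Measure.addHaar_closedBall' _ _ (Real.sqrt_nonneg T),
        finrank_euclideanSpace_fin, ← mul_assoc, ← mul_assoc, ← ENNReal.ofReal_mul (by positivity),
        ← ENNReal.ofReal_mul (by positivity)]
      congr 2
      have e2 : √T ^ n = T ^ ((n : ℝ) / 2) := by
        rw [Real.sqrt_eq_rpow, ← Real.rpow_natCast, ← Real.rpow_mul hT0.le]; congr 1; ring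
      rw [e2, mul_assoc, ← Real.rpow_add hT0,
        show -((n : ℝ) / 2) - 1 + (n : ℝ) / 2 = -1 by ring, Real.rpow_neg_one]
      ring
    rw [e1]
    refine le_trans ?_ (setLIntegral_le_lintegral (Metric.closedBall x₀ (√T)) _)
    refine setLIntegral_mono' Metric.isClosed_closedBall.measurableSet fun z hz => ?_
    rw [Metric.mem_closedBall, dist_eq_norm] at hz
    have hz2 : ‖z - x₀‖ ^ 2 ≤ T := by
      calc _ ≤ √T ^ 2 := by gcongr
        _ = T := Real.sq_sqrt hT0.le
    have h1 := hgrow z T hT0 hz2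
    have h2 := hw z T hT1.le hz
    have h3 := growthWeight_pos s z (t₀ + T)
    rw [← ENNReal.ofReal_mul (by positivity)]
    apply ENNReal.ofReal_le_ofReal
    calc c / M * T ^ (-((n : ℝ) / 2) - 1)
        = (M * T ^ ((n : ℝ) / 2 + 1 + s))⁻¹ * (c * T ^ s) := by
          rw [mul_inv, ← Real.rpow_neg hT0.le,
            show -((n : ℝ) / 2) - 1 = -((n : ℝ) / 2 + 1 + s) + s by ring, Real.rpow_add hT0]
          field_simp
      _ ≤ _ := by gcongr
  have h1 := (setLIntegral_mono' (μ := volume) measurableSet_Ioi hle).trans (setLIntegral_le_lintegral _ _)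
  rw [lintegral_mul_const _ (by fun_prop), lintegral_Ioi_inv_eq_top, ENNReal.top_mul hk0] at h1
  exact top_le_iff.1 h1

theorem heatPot_rieszW_le {n : ℕ} {s : ℝ} {G : RSpace n → ℝ → ℝ≥0∞}
    (mG : Measurable fun p : RSpace n × ℝ => G p.1 p.2) {x : RSpace n} {t : ℝ} {b : ℝ≥0∞}
    (h : ∀ N : ℝ, 0 < N → heatPot (rieszTrunc s N) G x t ≤ b) : heatPot (rieszW s) G x t ≤ b := by
  have hlim : Tendsto (fun k : ℕ => heatPot (rieszTrunc s ((k : ℝ) + 1)) G x t) atTop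
      (𝓝 (heatPot (rieszW s) G x t)) := by
    apply tendsto_heatPot (fun k => measurable_rieszTrunc s _) (fun _ => mG)
    · intro σ i j hij
      have : (i : ℝ) ≤ j := Nat.cast_le.2 hij
      dsimp only
      unfold rieszTrunc
      split_ifs with h2 h3 h3
      · exact le_rfl
      · exact absurd ⟨h2.1, by linarith [h2.2]⟩ h3
      · exact zero_le
      · exact le_rfl
    · exact fun _ _ _ _ _ => le_rfl
    · intro σ
      obtain ⟨k₀, hk₀⟩ := exists_nat_ge σ
      filter_upwards [eventually_ge_atTop k₀] with k hk
      have : (k₀ : ℝ) ≤ k := Nat.cast_le.2 hk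
      unfold rieszTrunc rieszW
      by_cases hσ : 0 < σ
      · rw [if_pos ⟨hσ, by linarith⟩, if_pos hσ]
      · rw [if_neg fun h => hσ h.1, if_neg hσ]
    · exact fun _ _ => Eventually.of_forall fun _ => rfl
    · intro σ
      unfold rieszW
      split_ifs <;> simp
  exact le_of_tendsto' hlim fun k => h _ (by positivity)

/-! ### From the fractional equation to the integral equation -/

/-- A solution of the fractional heat equation is the fractional heat potential of its source. -/
theorem eq_heatPot_rieszW_of_fracHeat {n : ℕ} {s : ℝ} (hs0 : 0 < s) (hs1 : s < 1) {α : ℝ}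
    (hα : s < α) {u : RSpace n → ℝ → ℝ} (hreg : ParabolicHolderLoc α u)
    (hu : SlowlyIncreasing s u) (hpos : ∀ x t, 0 < u x t) {g : RSpace n → ℝ → ℝ}
    (hg : Continuous fun p : RSpace n × ℝ => g p.1 p.2) (hg0 : ∀ y τ, 0 ≤ g y τ)
    (hlow : ∀ C₁ : ℝ, 0 < C₁ → ∃ C₂ : ℝ, 0 < C₂ ∧ ∀ y τ, C₁ ≤ u y τ → C₂ ≤ g y τ)
    (hfrac : ∀ x t, fracHeat s u x t = g x t) (x₀ : RSpace n) (t₀ : ℝ) :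
    ENNReal.ofReal (u x₀ t₀) = heatPot (rieszW s) (fun y τ => ENNReal.ofReal (g y τ)) x₀ t₀ := by
  have hΓ := Real.Gamma_pos_of_pos hs0
  have hcu : Continuous fun p : RSpace n × ℝ => u p.1 p.2 := hreg.continuous
  have mG := measurable_toENNReal hg
  have mU := measurable_toENNReal hcu
  have hrep := fun {N : ℝ} (hN : 0 < N) => slab_representation hs0 hs1 hα hreg hu hpos hg hg0
    hfrac hN
  set U : RSpace n → ℝ → ℝ≥0∞ := fun y τ => ENNReal.ofReal (u y τ) with hU
  set G : RSpace n → ℝ → ℝ≥0∞ := fun y τ => ENNReal.ofReal (g y τ) with hG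
  have hPle : ∀ x t, heatPot (rieszW s) G x t ≤ ENNReal.ofReal (u x t) := fun x t =>
    heatPot_rieszW_le mG fun N hN => by rw [hrep hN x t]; exact le_self_add
  by_contra hne
  have hlt := lt_of_le_of_ne (hPle x₀ t₀) (Ne.symm hne)
  have hPtop : heatPot (rieszW s) G x₀ t₀ ≠ ∞ := hlt.ne_top
  set P := (heatPot (rieszW s) G x₀ t₀).toReal with hP
  have hP0 : 0 ≤ P := ENNReal.toReal_nonneg
  have hPe : heatPot (rieszW s) G x₀ t₀ = ENNReal.ofReal P := (ENNReal.ofReal_toReal hPtop).symm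
  set w := u x₀ t₀ - P with hw
  have hw0 : 0 < w := by
    rw [hPe, ENNReal.ofReal_lt_ofReal_iff (hpos _ _)] at hlt
    linarith
  -- The potential up to level N is at most P, so the missing amount w must sit in every exit
  -- potential.
  have hA : ∀ N : ℝ, 0 < N → ENNReal.ofReal w ≤ heatPot (exitW s N) U x₀ t₀ := by
    intro N hN
    refine (ENNReal.add_le_add_iff_left (a := ENNReal.ofReal P) ENNReal.ofReal_ne_top).1 ?_
    rw [← ENNReal.ofReal_add hP0 hw0.le, show P + w = u x₀ t₀ by rw [hw]; ring, hrep hN x₀ t₀, ← hPe]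
    refine add_le_add (heatPot_mono (fun σ => ?_) (fun _ _ => le_rfl) x₀ t₀) le_rfl
    unfold rieszTrunc rieszW
    split_ifs with h1 h2 h2
    · exact le_rfl
    · exact absurd h1.1 h2
    · exact zero_le
    · exact le_rfl
  have hharnack : ∀ (x : RSpace n) (h : ℝ), 0 < h →
      w ≤ Real.exp (‖x - x₀‖ ^ 2 / (4 * h)) * u x (t₀ + h) := by
    intro x h hh
    -- The exit potential at level N+h based at (x, t₀+h) is bounded by u there; letting N → ∞ then
    -- removes the factors 1 + h/N.
    have h1 : ∀ N : ℝ, 0 < N → w ≤ (1 + h / N) * ((1 + h / N) ^ ((n : ℝ) / 2) *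
        Real.exp (‖x - x₀‖ ^ 2 / (4 * h))) * u x (t₀ + h) := by
      intro N hN
      have hup := hpos x (t₀ + h)
      have h2 := (hA N hN).trans (heatPot_exitW_le_shift hs0 hs1 hN hh mU x₀ x t₀)
      have h3 : heatPot (exitW s (N + h)) U x (t₀ + h) ≤ ENNReal.ofReal (u x (t₀ + h)) := by
        rw [hrep (by linarith : 0 < N + h) x (t₀ + h)]; exact le_add_self
      have h4 := h2.trans (mul_le_mul' le_rfl h3)
      rwa [← ENNReal.ofReal_mul (by positivity), ENNReal.ofReal_le_ofReal_iff (by positivity)] at h4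
    have hlim0 : Tendsto (fun N : ℝ => 1 + h / N) atTop (𝓝 (1 + 0)) :=
      tendsto_const_nhds.add (tendsto_const_nhds.div_atTop tendsto_id)
    rw [add_zero] at hlim0
    have hlim1 := ((hlim0.mul ((hlim0.rpow_const (p := (n : ℝ) / 2)
      (Or.inl one_ne_zero)).mul_const (Real.exp (‖x - x₀‖ ^ 2 / (4 * h))))).mul_const
      (u x (t₀ + h)))
    rw [Real.one_rpow, one_mul, one_mul] at hlim1
    exact ge_of_tendsto hlim1 ((eventually_gt_atTop 0).mono h1)
  set a : ℝ := 16 * 2 ^ ((n : ℝ) / 2) with ha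
  have ha0 : 0 < a := by positivity
  -- For lags σ < T/2 and ‖x-y‖² ≤ aσ one has ‖y-x₀‖² ≤ (2+a)T, while 4(T-σ) ≥ 2T, so the Harnack
  -- exponent is at most (2+a)/2. The resulting lower bound for u, and hence C₂, does not depend on
  -- T.
  obtain ⟨C₂, hC₂, hlow⟩ := hlow (w * Real.exp (-((2 + a) / 2))) (by positivity)
  refine hu.not_growth hs0 hcu x₀ t₀
    (c := (1 / 2) ^ s / (s * Real.Gamma s) * (C₂ / 2)) (by positivity) fun x T hT hx => ?_
  have h1 : ENNReal.ofReal ((T / 2) ^ s / (s * Real.Gamma s) * (C₂ / 2)) ≤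
      heatPot (rieszW s) G x (t₀ + T) := by
    refine riesz_lintegral_Ioo_ge hs0 (by positivity) hC₂.le fun σ y hσ0 hσT hy => ?_
    apply ENNReal.ofReal_le_ofReal
    apply hlow
    have hh : 0 < T - σ := by linarith
    have h2 := hharnack y (T - σ) hh
    rw [show t₀ + (T - σ) = t₀ + T - σ by ring] at h2
    have h3 : ‖y - x₀‖ ^ 2 ≤ (2 + a) * T := by
      have h4 : ‖y - x₀‖ ≤ ‖x - y‖ + ‖x - x₀‖ := by
        rw [norm_sub_rev x y, ← sub_add_sub_cancel y x x₀]; exact norm_add_le _ _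
      have h5 : ‖y - x₀‖ ^ 2 ≤ (‖x - y‖ + ‖x - x₀‖) ^ 2 := by gcongr
      rw [← ha] at hy
      have h6 : a * σ ≤ a * (T / 2) := by gcongr
      nlinarith [sq_nonneg (‖x - y‖ - ‖x - x₀‖)]
    have h7 : ‖y - x₀‖ ^ 2 / (4 * (T - σ)) ≤ (2 + a) / 2 := by
      rw [div_le_iff₀ (by positivity)]
      nlinarith
    have h8 : Real.exp (‖y - x₀‖ ^ 2 / (4 * (T - σ))) ≤ Real.exp ((2 + a) / 2) :=
      Real.exp_le_exp.2 h7
    have hup := hpos y (t₀ + T - σ)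
    rw [Real.exp_neg, ← div_eq_mul_inv, div_le_iff₀ (Real.exp_pos _), mul_comm]
    exact h2.trans (by gcongr)
  have h2 := h1.trans (hPle x (t₀ + T))
  rw [ENNReal.ofReal_le_ofReal_iff (hpos _ _).le] at h2
  refine le_trans (le_of_eq ?_) h2
  rw [div_eq_mul_one_div T 2, Real.mul_rpow hT.le (by norm_num)]
  ring

theorem theorem1p3 (n : ℕ) (hn : 1 ≤ n) (s : ℝ) (hs0 : 0 < s) (hs1 : s < 1)
    (u : RSpace n → ℝ → ℝ) (f : RSpace n → ℝ → ℝ → ℝ)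
    (ε : ℝ) (hε : 0 < ε)
    (hureg : ParabolicHolderLoc (s + ε / 2) u)
    (huint : SlowlyIncreasing s u)
    (hupos : ∀ x t, 0 < u x t)
    (hfcont : ContinuousOn (fun p : RSpace n × ℝ × ℝ => f p.1 p.2.1 p.2.2)
      {p : RSpace n × ℝ × ℝ | 0 < p.2.2})
    (hfnonneg : ∀ x t ζ, 0 < ζ → 0 ≤ f x t ζ)
    (hflower : ∀ C₁ : ℝ, 0 < C₁ → ∃ C₂ : ℝ, 0 < C₂ ∧ ∀ x t ζ, C₁ ≤ ζ → C₂ ≤ f x t ζ) :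
    (∀ x t, HasFracHeatAt s u x t (f x t (u x t))) ↔
    (∀ x t,
      Integrable (fun p : RSpace n × ℝ =>
        masterKernel s (x - p.1) (t - p.2) * f p.1 p.2 (u p.1 p.2)) ∧
      u x t = ∫ τ : ℝ, ∫ y : RSpace n,
        masterKernel s (x - y) (t - τ) * f y τ (u y τ)) := by
  have hα : s < s + ε / 2 := by linarith
  have hcu : Continuous fun p : RSpace n × ℝ => u p.1 p.2 := hureg.continuous
  have hg : Continuous fun p : RSpace n × ℝ => (fun y τ => f y τ (u y τ)) p.1 p.2 :=
    hfcont.comp_continuous (f := fun p : RSpace n × ℝ => (p.1, p.2, u p.1 p.2))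
      (continuous_fst.prodMk (continuous_snd.prodMk hcu)) fun p => hupos p.1 p.2
  have hg0 : ∀ y τ, 0 ≤ f y τ (u y τ) := fun y τ => hfnonneg y τ _ (hupos y τ)
  have hleft : (∀ x t, HasFracHeatAt s u x t (f x t (u x t))) ↔
      ∀ x t, fracHeat s u x t = f x t (u x t) :=
    forall₂_congr fun x t => hasFracHeatAt_iff hn hs0 hs1 hα hureg huint hupos x t _
  have hright := fun (x : RSpace n) (t : ℝ) =>
    integral_masterKernel_iff hs0 (g := fun y τ => f y τ (u y τ)) hg hg0 x t (hupos x t).le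
  rw [hleft]
  constructor
  · intro h x t
    refine (hright x t).2 (eq_heatPot_rieszW_of_fracHeat hs0 hs1 hα hureg huint hupos hg hg0 ?_ h x t)
    intro C₁ hC₁
    obtain ⟨C₂, hC₂, hle⟩ := hflower C₁ hC₁
    exact ⟨C₂, hC₂, fun y τ hy => hle y τ _ hy⟩
  · intro h
    exact fracHeat_eq_of_potential hs0 hs1 hα hureg huint hupos hg hg0
      fun x t => (hright x t).1 (h x t)
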